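/- Let $\Gamma\le \operatorname{SO}^+(3,1)$ be a discrete torsion-free subgroup such that the orientable hyperbolic $3$-manifold $\Gamma\backslash\mathbb H^3$ is non-compact and of finite volume (for example, arithmetic), and let $M$ be the compact manifold with boundary obtained by truncating its cusps $C_0,\dots,C_{n-1}$ along a $\Gamma$-invariant family of horoballs with pairwise disjoint closures; the components $S_0,\dots,S_{n-1}$ of $\partial M$ are the cusp cross-sections. Assume that $M$ fibers over the circle, that is, there are a compact connected orientable surface $\Sigma$ with non-empty boundary and a homeomorphism $f:\Sigma\to\Sigma$ such that the pair $(M,\partial M)$ is homeomorphic to the mapping torus of $f$ together with its part over $\partial\Sigma$. Let $DM$ be the double of $M$: the geometric realization of the graph of spaces with two vertices, whose spaces are two copies of $M$, and with $n$ edges joining them, with edge spaces $S_0,\dots,S_{n-1}$ and with the inclusions $S_i\hookrightarrow M$ as edge maps. Let $FM$ be the folded double of $M$: the geometric realization of the graph of spaces obtained by identifying the two vertices, with one vertex space $M$ and $n$ loops with edge spaces $S_0,\dots,S_{n-1}$, both edge maps of the $i$-th loop being the inclusion $S_i\hookrightarrow M$. Then $\pi_1(DM)$ embeds into $\pi_1(FM)$,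 and $\pi_1(FM)$ has a surface subgroup, that is, a subgroup isomorphic to $\langle a_1,b_1,\dots,a_g,b_g\mid [a_1,b_1]\cdots[a_g,b_g]\rangle$, the fundamental group of a closed orientable surface of genus $g$, for some $g\ge 2$. -/

import Mathlib

open scoped MatrixGroups

noncomputable section

/-! # Hyperbolic space, its isometries and horoballs (hyperboloid model) -/

/-- The Lorentzian form of signature `(n, 1)`: `-x₀ y₀ + x₁ y₁ + ⋯ + xₙ yₙ`. -/
def lorentz {n : ℕ} (x y : Fin (n + 1) → ℝ) : ℝ :=
  -(x 0 * y 0) + ∑ i : Fin n, x i.succ * y i.succ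

/-- Hyperbolic `n`-space as the upper sheet of the hyperboloid, with the subspace topology. -/
def hyperbolicSpace (n : ℕ) : Set (Fin (n + 1) → ℝ) :=
  {x | lorentz x x = -1 ∧ 0 < x 0}

/-- The group `SO⁺(n, 1)`: the matrices of determinant one that preserve the Lorentzian form and
the upper sheet of the hyperboloid, that is, the orientation preserving isometries of hyperbolic
`n`-space. -/
def SOplus (n : ℕ) : Subgroup SL(n + 1, ℝ) where
  carrier := {A | (∀ x y, lorentz (A.1.mulVec x) (A.1.mulVec y) = lorentz x y) ∧
    ∀ x, A.1.mulVec x ∈ hyperbolicSpace n ↔ x ∈ hyperbolicSpace n}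
  one_mem' := by simp
  mul_mem' := by
    rintro A B ⟨hA, hA'⟩ ⟨hB, hB'⟩
    refine ⟨fun x y => ?_, fun x => ?_⟩
    · have h := hA (B.1.mulVec x) (B.1.mulVec y)
      rw [hB] at h
      simpa [Matrix.mulVec_mulVec] using h
    · have h := (hA' (B.1.mulVec x)).trans (hB' x)
      simpa [Matrix.mulVec_mulVec] using h
  inv_mem' := by
    rintro A ⟨hA, hA'⟩
    have key : ∀ x, A.1.mulVec ((A⁻¹).1.mulVec x) = x := fun x => by
      rw [Matrix.mulVec_mulVec, ← Matrix.SpecialLinearGroup.coe_mul, mul_inv_cancel]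
      simp
    refine ⟨fun x y => ?_, fun x => ?_⟩
    · rw [← hA, key, key]
    · rw [← hA', key]

/-- The nonzero future-pointing light-like vectors. The vector `ℓ` encodes the horoball
`{x | -⟨x, ℓ⟩ < 1}`: the ray through `ℓ` is its base point in the sphere at infinity, and rescaling
`ℓ` changes its depth. Every horoball arises from exactly one such `ℓ`. -/
def futureLightCone (n : ℕ) : Set (Fin (n + 1) → ℝ) :=
  {l | lorentz l l = 0 ∧ 0 < l 0}

/-- The open horoball of `ℓ`. -/
def openHoroball {n : ℕ} (l : Fin (n + 1) → ℝ) : Set (Fin (n + 1) → ℝ) :=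
  {x | x ∈ hyperbolicSpace n ∧ -lorentz x l < 1}

/-- The closed horoball of `ℓ`. -/
def closedHoroball {n : ℕ} (l : Fin (n + 1) → ℝ) : Set (Fin (n + 1) → ℝ) :=
  {x | x ∈ hyperbolicSpace n ∧ -lorentz x l ≤ 1}

/-- The horosphere of `ℓ`. -/
def horosphere {n : ℕ} (l : Fin (n + 1) → ℝ) : Set (Fin (n + 1) → ℝ) :=
  {x | x ∈ hyperbolicSpace n ∧ -lorentz x l = 1}

/-! # Truncating the cusps of a hyperbolic manifold -/

/-- The complement in hyperbolic space of the open horoballs given by a set `L` of light-like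
vectors. -/
def horoballComplement {n : ℕ} (L : Set (Fin (n + 1) → ℝ)) : Set (Fin (n + 1) → ℝ) :=
  hyperbolicSpace n \ ⋃ l ∈ L, openHoroball l

/-- The relation "being in the same `Γ`-orbit" on a set of vectors. -/
def orbitSetoid {n : ℕ} (Γ : Subgroup SL(n + 1, ℝ)) (T : Set (Fin (n + 1) → ℝ)) : Setoid T where
  r x y := ∃ g ∈ Γ, g.1.mulVec x.1 = y.1
  iseqv :=
    { refl := fun x => ⟨1, Γ.one_mem, by simp⟩
      symm := by
        rintro x y ⟨g, hg, h⟩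
        refine ⟨g⁻¹, Γ.inv_mem hg, ?_⟩
        rw [← h, Matrix.mulVec_mulVec, ← Matrix.SpecialLinearGroup.coe_mul, inv_mul_cancel]
        simp
      trans := by
        rintro x y z ⟨g, hg, h⟩ ⟨g', hg', h'⟩
        refine ⟨g' * g, Γ.mul_mem hg' hg, ?_⟩
        rw [← h', ← h, Matrix.mulVec_mulVec, ← Matrix.SpecialLinearGroup.coe_mul] }

/-- The manifold `Γ \ ℍⁿ` truncated along the horoballs of `L`, with the quotient topology. -/
abbrev TruncatedManifold {n : ℕ} (Γ : Subgroup SL(n + 1, ℝ)) (L : Set (Fin (n + 1) → ℝ)) : Type :=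
  Quotient (orbitSetoid Γ (horoballComplement L))

/-- The boundary of the truncated manifold: the image of the horospheres of `L`. Its connected
components are the cross-sections of the truncated cusps. -/
def truncatedBoundary {n : ℕ} (Γ : Subgroup SL(n + 1, ℝ)) (L : Set (Fin (n + 1) → ℝ)) :
    Set (TruncatedManifold Γ L) :=
  {p | ∃ x : horoballComplement L, (∃ l ∈ L, x.1 ∈ horosphere l) ∧ Quotient.mk _ x = p}

/-- `L` describes a truncation of all the cusps of `Γ \ ℍⁿ`, which has at least one cusp: a
nonempty `Γ`-invariant family of horoballs with pairwise disjoint closures, for which the truncated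
manifold is compact. (For `n ≥ 2` and a discrete torsion-free `Γ ≤ SO⁺(n, 1)` such an `L` exists
exactly if `Γ \ ℍⁿ` is noncompact and has finite volume; `L` is then a choice of a cross-section in each
cusp.) -/
structure IsCuspTruncation {n : ℕ} (Γ : Subgroup SL(n + 1, ℝ))
    (L : Set (Fin (n + 1) → ℝ)) : Prop where
  nonempty : L.Nonempty
  lightlike : L ⊆ futureLightCone n
  invariant : ∀ g ∈ Γ, ∀ l ∈ L, g.1.mulVec l ∈ L
  disjoint : ∀ l ∈ L, ∀ l' ∈ L, l ≠ l' → Disjoint (closedHoroball l) (closedHoroball l')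
  compact : CompactSpace (TruncatedManifold Γ L)

/-! # Graphs of spaces, the double and the folded double -/

/-- The data of a graph of spaces: an oriented graph (loops and multiple edges allowed), a space
for every vertex and every edge, and continuous maps from the edge spaces to the spaces of the two
ends. -/
structure GraphOfSpaces where
  Vertex : Type
  Edge : Type
  vertexSpace : Vertex → Type
  edgeSpace : Edge → Type
  vertexTop : ∀ v, TopologicalSpace (vertexSpace v)
  edgeTop : ∀ e, TopologicalSpace (edgeSpace e)
  source : Edge → Vertex
  target : Edge → Vertex
  mapSource : ∀ e, C(edgeSpace e, vertexSpace (source e))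
  mapTarget : ∀ e, C(edgeSpace e, vertexSpace (target e))

attribute [instance] GraphOfSpaces.vertexTop GraphOfSpaces.edgeTop

/-- The disjoint union of the vertex spaces and of the cylinders over the edge spaces. -/
abbrev GraphOfSpaces.Pieces (W : GraphOfSpaces) : Type :=
  (Σ v, W.vertexSpace v) ⊕ (Σ e, W.edgeSpace e × unitInterval)

/-- The two ends of each cylinder are glued to the vertex spaces. -/
inductive GraphOfSpaces.Glue (W : GraphOfSpaces) : W.Pieces → W.Pieces → Prop
  | source (e : W.Edge) (w : W.edgeSpace e) :
      GraphOfSpaces.Glue W (Sum.inr ⟨e, (w, 0)⟩) (Sum.inl ⟨W.source e, W.mapSource e w⟩)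
  | target (e : W.Edge) (w : W.edgeSpace e) :
      GraphOfSpaces.Glue W (Sum.inr ⟨e, (w, 1)⟩) (Sum.inl ⟨W.target e, W.mapTarget e w⟩)

/-- The geometric realization of a graph of spaces, with the quotient topology. -/
abbrev GraphOfSpaces.Realization (W : GraphOfSpaces) : Type := Quot W.Glue

/-- A connected component of a subset `A` of `X`, as a space. -/
abbrev ComponentSpace {X : Type} [TopologicalSpace X] (A : Set X) (e : ConnectedComponents A) :
    Type :=
  {a : A // (a : ConnectedComponents A) = e}

/-- The inclusion of a component of `A` into `X`. -/
def componentInclusion {X : Type} [TopologicalSpace X] (A : Set X) (e : ConnectedComponents A) :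
    C(ComponentSpace A e, X) :=
  ⟨fun a => a.1.1, continuous_subtype_val.comp continuous_subtype_val⟩

/-- The graph of spaces of the double of `X` along `A`: two vertices, whose spaces are copies of
`X`, and an edge between them for every component of `A`. -/
def doubleGraph (X : Type) [TopologicalSpace X] (A : Set X) : GraphOfSpaces where
  Vertex := Bool
  Edge := ConnectedComponents A
  vertexSpace := fun _ => X
  edgeSpace := ComponentSpace A
  vertexTop := fun _ => inferInstance
  edgeTop := fun _ => inferInstance
  source := fun _ => false
  target := fun _ => true
  mapSource := componentInclusion A
  mapTarget := componentInclusion A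

/-- The graph of spaces of the folded double of `X` along `A`: the two vertices of the double are
identified, so that there are one vertex with space `X` and a loop for every component of `A`. -/
def foldedDoubleGraph (X : Type) [TopologicalSpace X] (A : Set X) : GraphOfSpaces where
  Vertex := Unit
  Edge := ConnectedComponents A
  vertexSpace := fun _ => X
  edgeSpace := ComponentSpace A
  vertexTop := fun _ => inferInstance
  edgeTop := fun _ => inferInstance
  source := fun _ => ()
  target := fun _ => ()
  mapSource := componentInclusion A
  mapTarget := componentInclusion A

/-- The double of `X` along `A`. -/
abbrev Double (X : Type) [TopologicalSpace X] (A : Set X) : Type :=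
  (doubleGraph X A).Realization

/-- The folded double of `X` along `A`. -/
abbrev FoldedDouble (X : Type) [TopologicalSpace X] (A : Set X) : Type :=
  (foldedDoubleGraph X A).Realization

/-! # Surfaces, mapping tori and fibered manifolds -/

/-- The closed unit disc. -/
abbrev ClosedDisc : Type := Metric.closedBall (0 : ℂ) 1

/-- The circle bounding the disc is divided into `N` arcs, numbered from `0` to `N - 1`; this is
the point with parameter `s` on the arc number `j`. -/
def arcPoint (N j : ℕ) (s : unitInterval) : ClosedDisc :=
  ⟨(Circle.exp (2 * Real.pi * ((j : ℝ) + (s : ℝ)) / (N : ℝ)) : ℂ),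
    mem_closedBall_zero_iff.2 (Circle.norm_coe _).le⟩

/-- The identification of arcs of the circle according to the word
`a₁ b₁ a₁⁻¹ b₁⁻¹ ⋯ a_h b_h a_h⁻¹ b_h⁻¹ · c₁ d₁ c₁⁻¹ ⋯ c_b d_b c_b⁻¹`, where the arcs `d_k` are left
free. -/
inductive ArcGlue (h b : ℕ) : ClosedDisc → ClosedDisc → Prop
  | handleA (i : ℕ) (hi : i < h) (s : unitInterval) :
      ArcGlue h b (arcPoint (4 * h + 3 * b) (4 * i) s)
        (arcPoint (4 * h + 3 * b) (4 * i + 2) (unitInterval.symm s))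
  | handleB (i : ℕ) (hi : i < h) (s : unitInterval) :
      ArcGlue h b (arcPoint (4 * h + 3 * b) (4 * i + 1) s)
        (arcPoint (4 * h + 3 * b) (4 * i + 3) (unitInterval.symm s))
  | hole (k : ℕ) (hk : k < b) (s : unitInterval) :
      ArcGlue h b (arcPoint (4 * h + 3 * b) (4 * h + 3 * k) s)
        (arcPoint (4 * h + 3 * b) (4 * h + 3 * k + 2) (unitInterval.symm s))

/-- For `b ≥ 1`, the compact connected oriented surface of genus `h` with `b` boundary circles. -/
abbrev CompactSurface (h b : ℕ) : Type := Quot (ArcGlue h b)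

/-- The boundary circles of the surface of genus `h` with `b` boundary circles. -/
def surfaceBoundary (h b : ℕ) : Set (CompactSurface h b) :=
  {p | ∃ k < b, ∃ s : unitInterval,
    Quot.mk _ (arcPoint (4 * h + 3 * b) (4 * h + 3 * k + 1) s) = p}

/-- The gluing of the two ends of the cylinder `S × [0, 1]` by `f`. -/
inductive TorusGlue {S : Type} [TopologicalSpace S] (f : S ≃ₜ S) :
    S × unitInterval → S × unitInterval → Prop
  | glue (x : S) : TorusGlue f (x, 1) (f x, 0)

/-- The mapping torus of a homeomorphism `f : S → S`. -/
abbrev MappingTorus {S : Type} [TopologicalSpace S] (f : S ≃ₜ S) : Type := Quot (TorusGlue f)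

/-- The part of the mapping torus of `f` that lies over a subset `A` of `S`. -/
def mappingTorusOver {S : Type} [TopologicalSpace S] (f : S ≃ₜ S) (A : Set S) :
    Set (MappingTorus f) :=
  {p | ∃ x ∈ A, ∃ s : unitInterval, Quot.mk _ (x, s) = p}

/-- A manifold `X` with boundary `A` fibers over the circle with fiber a compact connected
orientable surface with nonempty boundary: `X` is the mapping torus of a homeomorphism of such a
surface, in such a way that `A` is the part over the boundary of the surface. -/
def IsFibered (X : Type) [TopologicalSpace X] (A : Set X) : Prop :=
  ∃ h b : ℕ, 1 ≤ b ∧ ∃ f : CompactSurface h b ≃ₜ CompactSurface h b,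
    f '' surfaceBoundary h b = surfaceBoundary h b ∧
    ∃ Φ : X ≃ₜ MappingTorus f, Φ '' A = mappingTorusOver f (surfaceBoundary h b)

/-- The fundamental group `⟨a₁, b₁, …, a_g, b_g | [a₁, b₁] ⋯ [a_g, b_g]⟩` of the closed orientable
surface of genus `g`. -/
abbrev SurfaceGroup (g : ℕ) : Type :=
  PresentedGroup (α := Fin g ⊕ Fin g)
    {(List.ofFn fun i : Fin g =>
      FreeGroup.of (Sum.inl i) * FreeGroup.of (Sum.inr i) *
        (FreeGroup.of (Sum.inl i))⁻¹ * (FreeGroup.of (Sum.inr i))⁻¹).prod}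

/-- `G` has a surface subgroup: a subgroup isomorphic to the fundamental group of a closed
orientable surface of genus at least two. -/
def HasSurfaceSubgroup (G : Type) [Group G] : Prop :=
  ∃ g : ℕ, 2 ≤ g ∧ ∃ H : Subgroup G, Nonempty (H ≃* SurfaceGroup g)

end

section

open Topology

/-! # Fundamental groups and quotient maps -/

/-! Let the fiber `Σ` have genus `h` and `b` holes. Two copies of `Σ`, joined by tubes over the
boundary circles, form a closed surface `DΣ` of genus `2h + b - 1` inside `DM`. The theorem follows
from three facts.

The fundamental group of `DM` embeds into that of `FM`. The folded double has a two-sheeted covering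
with two vertices, in which every loop unfolds to two opposite edges. Folding the two edges together
retracts this covering onto `DM`. Coverings and sections of retractions are injective on fundamental
groups (`exists_injective_double_foldedDouble`).

The group of `DΣ` embeds into that of `DM` (`exists_injective_surfaceGroup_double`). Collapsing the
tubes maps `DM` to the mapping torus of the double of `f`, which is covered by the product of the
doubled fiber with a line. The fundamental group of `DΣ` is never computed. Instead, a regular
covering of the doubled fiber with the abstract surface group `G` as deck group is glued from copies
of a polygon (`SideHolonomy.gluing`). Loops in `DM` whose image stays in the fiber have a holonomy
in `G`, and null-homotopic ones have trivial holonomy (`injective_fst_holonomyGraph`). The polygons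
and tubes give a homomorphism from `G` to the (opposite) group of `DM`, and the image of each `x`
has holonomy `x`, so this homomorphism is injective.

The genus is at least two, that is, `Σ` is neither a disc nor an annulus
(`IsCuspTruncation.two_lt_of_fibered`). If it were, the complement of the horoballs would be swept
out by a covering of `Σ × ℝ` whose deck group fixes every boundary strip, so there would be at most
two horospheres (`finite_boundary_labels`). But there are infinitely many horoballs
(`IsCuspTruncation.infinite`): for a finite family, the sum of the functions `-⟨x, l⟩` would be
invariant and hence bounded on the compact quotient, although it is unbounded far from the
horoballs. -/

theorem FundamentalGroup.map_injective_of_isCoveringMap {E B : Type*} [TopologicalSpace E]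
    [TopologicalSpace B] (p : C(E, B)) (hp : IsCoveringMap p) (x : E) :
    Function.Injective (FundamentalGroup.map p x) :=
  hp.injective_path_homotopic_map x x

theorem FundamentalGroup.map_injective_of_leftInverse {X Y : Type*} [TopologicalSpace X]
    [TopologicalSpace Y] (i : C(X, Y)) (r : C(Y, X)) (h : ∀ x, r (i x) = x) (x : X) :
    Function.Injective (FundamentalGroup.map i x) := by
  intro a b hab
  induction a using Quotient.inductionOn with | _ a => ?_
  induction b using Quotient.inductionOn with | _ b => ?_
  have h1 : (a.map i.continuous).Homotopic (b.map i.continuous) := Quotient.exact hab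
  have h2 := h1.map r
  refine Quotient.sound ?_
  have e : ∀ c : Path x x, ((c.map i.continuous).map r.continuous).toContinuousMap =
      c.toContinuousMap := fun c => by ext t; simp [h]
  change ContinuousMap.HomotopicRel _ _ _
  rw [← e a, ← e b]
  exact h2

theorem HasSurfaceSubgroup.of_surfaceGroup {G : Type} [Group G] {g : ℕ} (hg : 2 ≤ g)
    (f : SurfaceGroup g →* G) (hf : Function.Injective f) : HasSurfaceSubgroup G :=
  ⟨g, hg, f.range, ⟨(f.ofInjective hf).symm⟩⟩

/-- To recognise the quotient by a group action it suffices to invert the induced map on orbits. -/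
theorem IsQuotientCoveringMap.of_section {E B G : Type*} [TopologicalSpace E] [TopologicalSpace B]
    [Group G] [MulAction G E] [ContinuousConstSMul G E] (p : E → B) (hp : Continuous p)
    (hsmul : ∀ (g : G) x, p (g • x) = p x)
    (inv : B → MulAction.orbitRel.Quotient G E) (hinv : Continuous inv)
    (hinv' : ∀ x, inv (p x) = Quotient.mk _ x) (hsurj : Function.Surjective p)
    (hdis : ∀ e : E, ∃ U ∈ 𝓝 e, ∀ g : G, ((g • ·) '' U ∩ U).Nonempty → g = 1) :
    IsQuotientCoveringMap p G where
  toIsQuotientMap := by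
    refine isQuotientMap_iff_isClosed.2 ⟨hsurj, fun s => ⟨fun h => h.preimage hp, fun h => ?_⟩⟩
    let pbar : MulAction.orbitRel.Quotient G E → B :=
      Quotient.lift p (by rintro _ y ⟨g, rfl⟩; exact hsmul g y)
    have h1 : IsClosed (pbar ⁻¹' s) := isQuotientMap_quotient_mk'.isClosed_preimage.1 h
    -- `inv` is inverse to `pbar`, so closedness upstairs descends along the continuous map `inv`.
    have h2 : s = inv ⁻¹' (pbar ⁻¹' s) := by
      ext b
      obtain ⟨x, rfl⟩ := hsurj b
      simp [hinv', pbar]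
    rw [h2]
    exact h1.preimage hinv
  continuous_const_smul := continuous_const_smul
  apply_eq_iff_mem_orbit := by
    intro x y
    constructor
    · intro h
      have := congrArg inv h
      rw [hinv', hinv'] at this
      exact Quotient.exact this
    · rintro ⟨g, rfl⟩
      exact hsmul g y
  disjoint := hdis

end

section

open Topology
noncomputable section

/-! # Maps out of the realization of a graph of spaces -/

namespace GraphOfSpaces

variable (W : GraphOfSpaces)

/-- The inclusion of a vertex space into the realization. -/
def vertexMap (v : W.Vertex) : C(W.vertexSpace v, W.Realization) :=
  ⟨fun x => Quot.mk _ (Sum.inl ⟨v, x⟩),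
    continuous_quot_mk.comp (continuous_inl.comp continuous_sigmaMk)⟩

/-- The cylinder over an edge space in the realization. -/
def tubeMap (e : W.Edge) : C(W.edgeSpace e × unitInterval, W.Realization) :=
  ⟨fun x => Quot.mk _ (Sum.inr ⟨e, x⟩),
    continuous_quot_mk.comp (continuous_inr.comp continuous_sigmaMk)⟩

theorem tubeMap_zero (e : W.Edge) (w : W.edgeSpace e) :
    W.tubeMap e (w, 0) = W.vertexMap (W.source e) (W.mapSource e w) :=
  Quot.sound (Glue.source e w)

theorem tubeMap_one (e : W.Edge) (w : W.edgeSpace e) :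
    W.tubeMap e (w, 1) = W.vertexMap (W.target e) (W.mapTarget e w) :=
  Quot.sound (Glue.target e w)

variable {W}

theorem Realization.induction {P : W.Realization → Prop} (hv : ∀ v x, P (W.vertexMap v x))
    (he : ∀ e x, P (W.tubeMap e x)) (z : W.Realization) : P z := by
  induction z using Quot.inductionOn with | _ z => ?_
  rcases z with ⟨v, x⟩ | ⟨e, x⟩
  exacts [hv v x, he e x]

/-- The continuous map on the realization given by compatible maps on its pieces. -/
def lift {Z : Type*} [TopologicalSpace Z] (fv : ∀ v, C(W.vertexSpace v, Z))
    (fe : ∀ e, C(W.edgeSpace e × unitInterval, Z))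
    (h0 : ∀ e w, fe e (w, 0) = fv _ (W.mapSource e w))
    (h1 : ∀ e w, fe e (w, 1) = fv _ (W.mapTarget e w)) : C(W.Realization, Z) :=
  ⟨Quot.lift (Sum.elim (fun p => fv p.1 p.2) fun p => fe p.1 p.2) (by
      rintro _ _ (⟨e, w⟩ | ⟨e, w⟩)
      exacts [h0 e w, h1 e w]),
    continuous_quot_lift _ <| Continuous.sumElim
      (continuous_sigma fun v => (fv v).continuous) (continuous_sigma fun e => (fe e).continuous)⟩

end GraphOfSpaces

/-! # The double covering of the folded double -/

section Unfolded

variable (X : Type) [TopologicalSpace X] (A : Set X)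

open GraphOfSpaces

/-- The double covering of the folded double: two vertices, and for every component of `A` two
edges between them, one in each direction. -/
def unfoldedDoubleGraph : GraphOfSpaces where
  Vertex := Bool
  Edge := ConnectedComponents A × Bool
  vertexSpace := fun _ => X
  edgeSpace := fun e => ComponentSpace A e.1
  vertexTop := fun _ => inferInstance
  edgeTop := fun _ => inferInstance
  source := fun e => e.2
  target := fun e => !e.2
  mapSource := fun e => componentInclusion A e.1
  mapTarget := fun e => componentInclusion A e.1

/-- The realization of the unfolded double. -/
abbrev UnfoldedDouble : Type := (unfoldedDoubleGraph X A).Realization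

variable {X}

/-- A copy of `X` in the double. -/
def doubleVertex (v : Bool) : C(X, Double X A) := (doubleGraph X A).vertexMap v

/-- The copy of `X` in the folded double. -/
def foldedVertex : C(X, FoldedDouble X A) := (foldedDoubleGraph X A).vertexMap ()

/-- A copy of `X` in the unfolded double. -/
def unfoldedVertex (v : Bool) : C(X, UnfoldedDouble X A) := (unfoldedDoubleGraph X A).vertexMap v

variable {A}

/-- A tube of the double. -/
def doubleTube (e : ConnectedComponents A) : C(ComponentSpace A e × unitInterval, Double X A) :=
  (doubleGraph X A).tubeMap e

/-- A tube of the folded double. -/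
def foldedTube (e : ConnectedComponents A) :
    C(ComponentSpace A e × unitInterval, FoldedDouble X A) :=
  (foldedDoubleGraph X A).tubeMap e

/-- A tube of the unfolded double. -/
def unfoldedTube (e : ConnectedComponents A) (b : Bool) :
    C(ComponentSpace A e × unitInterval, UnfoldedDouble X A) :=
  (unfoldedDoubleGraph X A).tubeMap (e, b)

theorem doubleTube_zero (e : ConnectedComponents A) (w : ComponentSpace A e) :
    doubleTube e (w, 0) = doubleVertex A false w.1.1 :=
  (doubleGraph X A).tubeMap_zero e w

theorem doubleTube_one (e : ConnectedComponents A) (w : ComponentSpace A e) :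
    doubleTube e (w, 1) = doubleVertex A true w.1.1 :=
  (doubleGraph X A).tubeMap_one e w

theorem foldedTube_zero (e : ConnectedComponents A) (w : ComponentSpace A e) :
    foldedTube e (w, 0) = foldedVertex A w.1.1 :=
  (foldedDoubleGraph X A).tubeMap_zero e w

theorem foldedTube_one (e : ConnectedComponents A) (w : ComponentSpace A e) :
    foldedTube e (w, 1) = foldedVertex A w.1.1 :=
  (foldedDoubleGraph X A).tubeMap_one e w

theorem unfoldedTube_zero (e : ConnectedComponents A) (b : Bool) (w : ComponentSpace A e) :
    unfoldedTube e b (w, 0) = unfoldedVertex A b w.1.1 :=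
  (unfoldedDoubleGraph X A).tubeMap_zero (e, b) w

theorem unfoldedTube_one (e : ConnectedComponents A) (b : Bool) (w : ComponentSpace A e) :
    unfoldedTube e b (w, 1) = unfoldedVertex A (!b) w.1.1 :=
  (unfoldedDoubleGraph X A).tubeMap_one (e, b) w

theorem Double.induction {P : Double X A → Prop} (hv : ∀ v x, P (doubleVertex A v x))
    (he : ∀ e x, P (doubleTube e x)) (z : Double X A) : P z :=
  GraphOfSpaces.Realization.induction hv he z

theorem FoldedDouble.induction {P : FoldedDouble X A → Prop} (hv : ∀ x, P (foldedVertex A x))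
    (he : ∀ e x, P (foldedTube e x)) (z : FoldedDouble X A) : P z :=
  GraphOfSpaces.Realization.induction (fun _ => hv) he z

theorem UnfoldedDouble.induction {P : UnfoldedDouble X A → Prop}
    (hv : ∀ v x, P (unfoldedVertex A v x)) (he : ∀ e b x, P (unfoldedTube e b x))
    (z : UnfoldedDouble X A) : P z :=
  GraphOfSpaces.Realization.induction hv
    (fun (e : ConnectedComponents A × Bool) => he e.1 e.2) z

section lifts

variable {Z : Type*} [TopologicalSpace Z]

/-- Continuous maps on the double. -/
def doubleLift (fv : Bool → C(X, Z)) (fe : ∀ e, C(ComponentSpace A e × unitInterval, Z))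
    (h0 : ∀ e (w : ComponentSpace A e), fe e (w, 0) = fv false w.1.1)
    (h1 : ∀ e (w : ComponentSpace A e), fe e (w, 1) = fv true w.1.1) : C(Double X A, Z) :=
  GraphOfSpaces.lift (W := doubleGraph X A) fv fe h0 h1

/-- Continuous maps on the folded double. -/
def foldedLift (fv : C(X, Z)) (fe : ∀ e, C(ComponentSpace A e × unitInterval, Z))
    (h0 : ∀ e (w : ComponentSpace A e), fe e (w, 0) = fv w.1.1)
    (h1 : ∀ e (w : ComponentSpace A e), fe e (w, 1) = fv w.1.1) : C(FoldedDouble X A, Z) :=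
  GraphOfSpaces.lift (W := foldedDoubleGraph X A) (fun _ => fv) fe h0 h1

/-- Continuous maps on the unfolded double. -/
def unfoldedLift (fv : Bool → C(X, Z)) (fe : ∀ e, Bool → C(ComponentSpace A e × unitInterval, Z))
    (h0 : ∀ e b (w : ComponentSpace A e), fe e b (w, 0) = fv b w.1.1)
    (h1 : ∀ e b (w : ComponentSpace A e), fe e b (w, 1) = fv (!b) w.1.1) :
    C(UnfoldedDouble X A, Z) :=
  GraphOfSpaces.lift (W := unfoldedDoubleGraph X A) fv (fun e => fe e.1 e.2)
    (fun (e : ConnectedComponents A × Bool) => h0 e.1 e.2)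
    (fun (e : ConnectedComponents A × Bool) => h1 e.1 e.2)

@[simp] theorem unfoldedLift_vertex (fv : Bool → C(X, Z)) (fe h0 h1) (v x) :
    unfoldedLift (A := A) fv fe h0 h1 (unfoldedVertex A v x) = fv v x := rfl
@[simp] theorem unfoldedLift_tube (fv : Bool → C(X, Z)) (fe h0 h1) (e b x) :
    unfoldedLift (A := A) fv fe h0 h1 (unfoldedTube e b x) = fe e b x := rfl

end lifts

variable (X A)

/-- The double sits in the unfolded double. -/
def doubleToUnfolded : C(Double X A, UnfoldedDouble X A) :=
  doubleLift (unfoldedVertex A) (fun e => unfoldedTube e false)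
    (fun e w => unfoldedTube_zero e false w) (fun e w => unfoldedTube_one e false w)

/-- The retraction of the unfolded double onto the double. -/
def unfoldedToDouble : C(UnfoldedDouble X A, Double X A) :=
  unfoldedLift (doubleVertex A)
    (fun e b => match b with
      | false => doubleTube e
      -- The additional tubes run from `true` to `false`; they are folded onto the tubes of the
      -- double with reversed parameter.
      | true => (doubleTube e).comp ⟨fun q => (q.1, unitInterval.symm q.2), by fun_prop⟩)
    (by
      rintro e (_ | _) w
      · exact doubleTube_zero e w
      · simp [doubleTube_one])
    (by
      rintro e (_ | _) w
      · exact doubleTube_one e w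
      · simp [doubleTube_zero])

/-- The exchange of the two sheets of the unfolded double. -/
def unfoldedSwap : C(UnfoldedDouble X A, UnfoldedDouble X A) :=
  unfoldedLift (fun v => unfoldedVertex A (!v)) (fun e b => unfoldedTube e (!b))
    (fun e b w => unfoldedTube_zero e (!b) w) (fun e b w => unfoldedTube_one e (!b) w)

variable {X A}

theorem unfoldedSwap_swap (z : UnfoldedDouble X A) :
    unfoldedSwap X A (unfoldedSwap X A z) = z := by
  induction z using UnfoldedDouble.induction with
  | hv v x => simp [unfoldedSwap]
  | he e b x => simp [unfoldedSwap]

theorem unfoldedToDouble_doubleToUnfolded (z : Double X A) :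
    unfoldedToDouble X A (doubleToUnfolded X A z) = z := by
  induction z using Double.induction with
  | hv v x => rfl
  | he e x => rfl

open Classical in
instance : MulAction ℤˣ (UnfoldedDouble X A) where
  smul u z := if u = 1 then z else unfoldedSwap X A z
  one_smul z := if_pos rfl
  mul_smul u v z := by
    change (if u * v = 1 then _ else _) = (if u = 1 then _ else _)
    rcases Int.units_eq_one_or u with rfl | rfl <;> rcases Int.units_eq_one_or v with rfl | rfl
    all_goals simp [HSMul.hSMul, SMul.smul, unfoldedSwap_swap]

theorem neg_one_smul_unfolded (z : UnfoldedDouble X A) : (-1 : ℤˣ) • z = unfoldedSwap X A z :=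
  if_neg (by decide)

instance : ContinuousConstSMul ℤˣ (UnfoldedDouble X A) where
  continuous_const_smul u := by
    rcases Int.units_eq_one_or u with rfl | rfl
    · simpa only [one_smul] using continuous_id'
    · simpa only [neg_one_smul_unfolded] using (unfoldedSwap X A).continuous

variable (X A)

/-- The covering of the folded double by the unfolded one. -/
def unfoldedToFolded : C(UnfoldedDouble X A, FoldedDouble X A) :=
  unfoldedLift (fun _ => foldedVertex A) (fun e _ => foldedTube e)
    (fun e _ w => foldedTube_zero e w) (fun e _ w => foldedTube_one e w)

/-- The sheet exchange acts as multiplication by `-1` under this nowhere vanishing function. -/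
def unfoldedAngle : C(UnfoldedDouble X A, ℂ) :=
  unfoldedLift (fun v => .const _ (if v then -1 else 1))
    -- The tubes leaving `false` run from `1` to `-1` through the upper half-plane, the others are
    -- their negatives. The imaginary part `t(1 - t)` avoids zero at the midpoint.
    (fun e b => ⟨fun q => (if b then -1 else 1) *
      ((1 - 2 * (q.2 : ℝ) : ℝ) + ((q.2 : ℝ) * (1 - (q.2 : ℝ)) : ℝ) * Complex.I), by fun_prop⟩)
    (by rintro e (_ | _) w <;> simp)
    (by rintro e (_ | _) w <;> simp <;> norm_num)

/-- The inverse, on orbits, of the covering of the folded double. -/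
def foldedToOrbits :
    C(FoldedDouble X A, MulAction.orbitRel.Quotient ℤˣ (UnfoldedDouble X A)) :=
  let mk : C(UnfoldedDouble X A, MulAction.orbitRel.Quotient ℤˣ (UnfoldedDouble X A)) :=
    ⟨Quotient.mk _, continuous_quotient_mk'⟩
  foldedLift (mk.comp (unfoldedVertex A false)) (fun e => mk.comp (unfoldedTube e false))
    (fun e w => congrArg mk (unfoldedTube_zero e false w))
    (fun e w => (congrArg mk (unfoldedTube_one e false w)).trans
      (Quotient.sound ⟨-1, neg_one_smul_unfolded _⟩))

variable {X A}

theorem unfoldedAngle_swap (z : UnfoldedDouble X A) :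
    unfoldedAngle X A (unfoldedSwap X A z) = -unfoldedAngle X A z := by
  induction z using UnfoldedDouble.induction with
  | hv v x => cases v <;> simp [unfoldedAngle, unfoldedSwap]
  | he e b x => cases b <;> simp [unfoldedAngle, unfoldedSwap]

theorem unfoldedAngle_ne_zero (z : UnfoldedDouble X A) : unfoldedAngle X A z ≠ 0 := by
  induction z using UnfoldedDouble.induction with
  | hv v x => cases v <;> simp [unfoldedAngle]
  | he e b x =>
    have : ((1 - 2 * (x.2 : ℝ) : ℝ) + ((x.2 : ℝ) * (1 - (x.2 : ℝ)) : ℝ) * Complex.I : ℂ) ≠ 0 := by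
      intro h
      have h1 := congrArg Complex.re h
      have h2 := congrArg Complex.im h
      simp only [Complex.add_re, Complex.ofReal_re, Complex.re_ofReal_mul, Complex.I_re, mul_zero,
        add_zero, Complex.zero_re, Complex.add_im, Complex.ofReal_im, Complex.im_ofReal_mul,
        Complex.I_im, mul_one, zero_add, Complex.zero_im] at h1 h2
      have h3 : (x.2 : ℝ) = 1 / 2 := by linarith
      rw [h3] at h2
      norm_num at h2
    refine mul_ne_zero ?_ this
    cases b <;> simp

theorem isQuotientCoveringMap_unfoldedToFolded :
    IsQuotientCoveringMap (unfoldedToFolded X A) ℤˣ := by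
  have hswap : ∀ z, unfoldedToFolded X A (unfoldedSwap X A z) = unfoldedToFolded X A z := by
    intro z
    induction z using UnfoldedDouble.induction with
    | hv v x => rfl
    | he e b x => rfl
  refine .of_section _ (unfoldedToFolded X A).continuous ?_ (foldedToOrbits X A)
    (foldedToOrbits X A).continuous ?_ ?_ ?_
  · intro u z
    rcases Int.units_eq_one_or u with rfl | rfl
    · rw [one_smul]
    · rw [neg_one_smul_unfolded, hswap]
  · intro z
    induction z using UnfoldedDouble.induction with
    | hv v x =>
      cases v
      · rfl
      · exact Quotient.sound ⟨-1, neg_one_smul_unfolded _⟩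
    | he e b x =>
      cases b
      · rfl
      · exact Quotient.sound ⟨-1, neg_one_smul_unfolded _⟩
  · intro z
    induction z using FoldedDouble.induction with
    | hv x => exact ⟨unfoldedVertex A false x, rfl⟩
    | he e x => exact ⟨unfoldedTube e false x, rfl⟩
  · intro z
    -- The swap changes the sign of `φ`, so the neighborhood `φ > 0` of `z` is disjoint from its
    -- image.
    let φ : UnfoldedDouble X A → ℝ :=
      fun y => (unfoldedAngle X A y * (starRingEnd ℂ) (unfoldedAngle X A z)).re
    have hφ : Continuous φ := by fun_prop
    refine ⟨φ ⁻¹' Set.Ioi 0, (isOpen_Ioi.preimage hφ).mem_nhds ?_, ?_⟩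
    · change 0 < (unfoldedAngle X A z * (starRingEnd ℂ) (unfoldedAngle X A z)).re
      rw [Complex.mul_conj, Complex.ofReal_re]
      exact Complex.normSq_pos.2 (unfoldedAngle_ne_zero z)
    · rintro u ⟨_, ⟨y, hy, rfl⟩, hy'⟩
      rcases Int.units_eq_one_or u with rfl | rfl
      · rfl
      · exfalso
        simp only [neg_one_smul_unfolded, Set.mem_preimage, Set.mem_Ioi, φ, unfoldedAngle_swap,
          neg_mul, Complex.neg_re] at hy hy'
        linarith

theorem FoldedDouble.pathConnectedSpace [PathConnectedSpace X] :
    PathConnectedSpace (FoldedDouble X A) := by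
  obtain ⟨x₀⟩ := (inferInstance : Nonempty X)
  refine ⟨⟨foldedVertex A x₀⟩, ?_⟩
  suffices h : ∀ z, Joined (foldedVertex A x₀) z from fun y z => (h y).symm.trans (h z)
  have hv : ∀ x, Joined (foldedVertex A x₀) (foldedVertex A x) := fun x =>
    ⟨(PathConnectedSpace.somePath x₀ x).map (foldedVertex A).continuous⟩
  intro z
  induction z using FoldedDouble.induction with
  | hv x => exact hv x
  | he e x =>
    obtain ⟨w, t⟩ := x
    have : Joined (foldedTube e (w, 0)) (foldedTube e (w, t)) :=
      ⟨⟨⟨fun s => foldedTube e (w, s * t), by fun_prop⟩, by simp, by simp⟩⟩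
    refine Joined.trans ?_ this
    rw [foldedTube_zero]
    exact hv _

/-- The fundamental group of the double embeds into the one of the folded double. -/
theorem exists_injective_double_foldedDouble [PathConnectedSpace X] (x : Double X A)
    (y : FoldedDouble X A) :
    ∃ f : FundamentalGroup (Double X A) x →* FundamentalGroup (FoldedDouble X A) y,
      Function.Injective f := by
  have := FoldedDouble.pathConnectedSpace (X := X) (A := A)
  let e := FundamentalGroup.fundamentalGroupMulEquivOfPathConnected
    (unfoldedToFolded X A (doubleToUnfolded X A x)) y
  have h1 := FundamentalGroup.map_injective_of_isCoveringMap (unfoldedToFolded X A)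
    isQuotientCoveringMap_unfoldedToFolded.isCoveringMap (doubleToUnfolded X A x)
  have h2 := FundamentalGroup.map_injective_of_leftInverse (doubleToUnfolded X A)
    (unfoldedToDouble X A) unfoldedToDouble_doubleToUnfolded x
  refine ⟨e.toMonoidHom.comp ((FundamentalGroup.map (unfoldedToFolded X A) _).comp
    (FundamentalGroup.map (doubleToUnfolded X A) x)), fun a b h => ?_⟩
  exact h2 (h1 (e.injective h))

end Unfolded

end

end

section

open Topology
noncomputable section

/-! # Regular coverings of spaces glued from isometric arcs -/

/-- Pairs of isometric arcs in copies (indexed by `K`) of a metric space `D`, labelled by elements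
of a group `G`, such that the labels come from a `G`-valued function `pot` on the disjoint union of
the copies. -/
structure ArcGluing (D K G : Type) [MetricSpace D] [Group G] where
  ι : Type
  fin : Finite ι
  l : ι → unitInterval → D
  r : ι → unitInterval → D
  lk : ι → K
  rk : ι → K
  lab : ι → G
  cont_l : ∀ j, Continuous (l j)
  cont_r : ∀ j, Continuous (r j)
  isom : ∀ j s t, dist (l j s) (l j t) = dist (r j s) (r j t)
  -- No continuity is required. `pot` trivializes the covering merely as a set, which excludes
  -- nontrivial holonomy around the corners and makes `G` act freely on the glued space.
  pot : K × D → G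
  pot_eq : ∀ j t, pot (lk j, l j t) = lab j * pot (rk j, r j t)
  -- Every point lies in a finite set saturated under the gluing; small balls around its members
  -- assemble to an open set of the quotient.
  finite_class : ∀ p : K × D, ∃ T : Set (K × D), T.Finite ∧ p ∈ T ∧
    ∀ j t, (lk j, l j t) ∈ T ↔ (rk j, r j t) ∈ T

namespace ArcGluing

variable {D K G : Type} [MetricSpace D] [Group G] (S : ArcGluing D K G)

/-- The gluing of the copies of `D` indexed by `K × G`. -/
inductive Rel : (Σ _ : K × G, D) → (Σ _ : K × G, D) → Prop
  | glue (j : S.ι) (t : unitInterval) (g : G) :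
      Rel ⟨(S.lk j, g), S.l j t⟩ ⟨(S.rk j, g * S.lab j), S.r j t⟩

/-- The total space of the regular covering. -/
abbrev Total : Type := Quot S.Rel

/-- The point of the total space given by a point of a copy of `D`. -/
def tot (k : K) (g : G) (x : D) : S.Total := Quot.mk _ ⟨(k, g), x⟩

variable {S}

theorem tot_glue (j : S.ι) (t : unitInterval) (g : G) :
    S.tot (S.lk j) g (S.l j t) = S.tot (S.rk j) (g * S.lab j) (S.r j t) :=
  Quot.sound (Rel.glue j t g)

theorem continuous_tot (k : K) (g : G) : Continuous (S.tot k g) :=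
  continuous_quot_mk.comp continuous_sigmaMk

theorem Total.induction {P : S.Total → Prop} (h : ∀ k g x, P (S.tot k g x)) (e : S.Total) :
    P e := by
  induction e using Quot.inductionOn with | _ e => ?_
  exact h _ _ _

/-- Maps out of the total space. -/
def totalLift {Z : Type*} (f : K → G → D → Z)
    (h : ∀ j t g, f (S.lk j) g (S.l j t) = f (S.rk j) (g * S.lab j) (S.r j t)) : S.Total → Z :=
  Quot.lift (fun p => f p.1.1 p.1.2 p.2) (by rintro _ _ ⟨j, t, g⟩; exact h j t g)

theorem continuous_totalLift {Z : Type*} [TopologicalSpace Z] (f : K → G → D → Z)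
    (h : ∀ j t g, f (S.lk j) g (S.l j t) = f (S.rk j) (g * S.lab j) (S.r j t))
    (hf : ∀ k g, Continuous (f k g)) : Continuous (totalLift (S := S) f h) :=
  continuous_quot_lift _ (continuous_sigma fun p => hf p.1 p.2)

@[simp] theorem totalLift_tot {Z : Type*} (f : K → G → D → Z)
    (h : ∀ j t g, f (S.lk j) g (S.l j t) = f (S.rk j) (g * S.lab j) (S.r j t)) (k g x) :
    totalLift (S := S) f h (S.tot k g x) = f k g x := rfl

instance : MulAction G S.Total where
  smul a := totalLift (fun k g x => S.tot k (a * g) x) fun j t g => by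
    rw [tot_glue, mul_assoc]
  one_smul e := by
    induction e using Total.induction with | h k g x => ?_
    change S.tot k (1 * g) x = _
    rw [one_mul]
  mul_smul a b e := by
    induction e using Total.induction with | h k g x => ?_
    change S.tot k (a * b * g) x = S.tot k (a * (b * g)) x
    rw [mul_assoc]

@[simp] theorem smul_tot (a : G) (k : K) (g : G) (x : D) : a • S.tot k g x = S.tot k (a * g) x := rfl

instance : ContinuousConstSMul G S.Total where
  continuous_const_smul _ := continuous_totalLift _ _ fun k _ => continuous_tot k _

variable (S) in
/-- The normalized point of the total space: it depends on `x` only up to gluing. -/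
def pt (k : K) (g : G) (x : D) : S.Total := S.tot k (g * (S.pot (k, x))⁻¹) x

theorem pt_glue (j : S.ι) (t : unitInterval) (g : G) :
    S.pt (S.lk j) g (S.l j t) = S.pt (S.rk j) g (S.r j t) := by
  rw [pt, tot_glue, pt, S.pot_eq, mul_inv_rev, ← mul_assoc, inv_mul_cancel_right]

variable (S) in
/-- The coordinate of the normalized points in the group. -/
def coord : S.Total → G :=
  totalLift (fun k g x => g * S.pot (k, x)) fun j t g => by rw [S.pot_eq, mul_assoc]

theorem coord_pt (k : K) (g : G) (x : D) : S.coord (S.pt k g x) = g := by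
  simp [coord, pt]

theorem tot_eq_pt (k : K) (g : G) (x : D) : S.tot k g x = S.pt k (g * S.pot (k, x)) x := by
  simp [pt]

/-- An arc is compact, so if it misses `p` it keeps a positive distance from `p`. -/
theorem eventually_mem_range (f : unitInterval → D) (hf : Continuous f) (p : D) :
    ∀ᶠ ε in 𝓝[>] (0 : ℝ), ∀ t, dist (f t) p < ε → p ∈ Set.range f := by
  by_cases hp : p ∈ Set.range f
  · exact Filter.Eventually.of_forall fun _ _ _ => hp
  · have hc : IsClosed (Set.range f) := (isCompact_range hf).isClosed
    obtain ⟨δ, hδ, h⟩ := Metric.isOpen_iff.1 hc.isOpen_compl p hp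
    filter_upwards [nhdsWithin_le_nhds (Iio_mem_nhds hδ)] with ε hε t ht
    exact absurd ⟨t, rfl⟩ (h (ht.trans hε))

/-- The neighborhood `V` consists of the `ε`-balls around a finite saturated set `T`, taken in the
copies where the normalized coordinate of the center is `c`. For small `ε` an arc that enters such a
ball passes through its center. As glued arcs are isometric, the partner arc is then equally close
to the glued center, so `V` is compatible with the gluing. A translate of `V` that meets `V` shares
a center with it, and comparing coordinates gives `a = 1`. -/
theorem exists_nhds_smul_disjoint (e : S.Total) :
    ∃ U ∈ 𝓝 e, ∀ a : G, ((a • ·) '' U ∩ U).Nonempty → a = 1 := by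
  induction e using Total.induction with | h k₀ g₀ x₀ => ?_
  obtain ⟨T, hTfin, hxT, hT⟩ := S.finite_class (k₀, x₀)
  have := S.fin
  have h1 : ∀ᶠ ε in 𝓝[>] (0 : ℝ), ∀ p ∈ T, ∀ j, ∀ t, dist (S.l j t) p.2 < ε →
      p.2 ∈ Set.range (S.l j) :=
    (Filter.eventually_all_finite hTfin).2 fun p _ => Filter.eventually_all.2 fun j =>
      eventually_mem_range _ (S.cont_l j) _
  have h2 : ∀ᶠ ε in 𝓝[>] (0 : ℝ), ∀ p ∈ T, ∀ j, ∀ t, dist (S.r j t) p.2 < ε →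
      p.2 ∈ Set.range (S.r j) :=
    (Filter.eventually_all_finite hTfin).2 fun p _ => Filter.eventually_all.2 fun j =>
      eventually_mem_range _ (S.cont_r j) _
  have h3 : ∀ᶠ ε in 𝓝[>] (0 : ℝ), ∀ p ∈ T, ∀ q ∈ T, dist p.2 q.2 < ε + ε → p.2 = q.2 := by
    refine (Filter.eventually_all_finite hTfin).2 fun p _ =>
      (Filter.eventually_all_finite hTfin).2 fun q _ => ?_
    by_cases hpq : p.2 = q.2
    · exact Filter.Eventually.of_forall fun _ _ => hpq
    · have := dist_pos.2 hpq
      filter_upwards [nhdsWithin_le_nhds (Iio_mem_nhds (half_pos this))] with ε hε hd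
      rw [Set.mem_Iio] at hε
      linarith
  obtain ⟨ε, h1, h2, h3, hε⟩ :=
    (h1.and (h2.and (h3.and (self_mem_nhdsWithin (s := Set.Ioi (0 : ℝ)))))).exists
  set c := g₀ * S.pot (k₀, x₀)
  let V : S.Total → Prop := totalLift
    (fun k g x => ∃ p ∈ T, p.1 = k ∧ dist x p.2 < ε ∧ g * S.pot p = c) <| by
      intro j t g
      refine propext ⟨?_, ?_⟩
      · rintro ⟨⟨k, y⟩, hp, hk, hd, hc⟩
        obtain ⟨t₀, rfl⟩ := h1 _ hp j t hd
        obtain rfl : k = S.lk j := hk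
        refine ⟨(S.rk j, S.r j t₀), (hT j t₀).1 hp, rfl, ?_, ?_⟩
        · rwa [← S.isom]
        · rw [mul_assoc, ← S.pot_eq, hc]
      · rintro ⟨⟨k, y⟩, hp, hk, hd, hc⟩
        obtain ⟨t₀, rfl⟩ := h2 _ hp j t hd
        obtain rfl : k = S.rk j := hk
        refine ⟨(S.lk j, S.l j t₀), (hT j t₀).2 hp, rfl, ?_, ?_⟩
        · rwa [S.isom]
        · rw [S.pot_eq, ← mul_assoc, hc]
  have hVopen : IsOpen {e | V e} := by
    refine isOpen_coinduced.2 (isOpen_sigma_iff.2 fun q => ?_)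
    have : (Sigma.mk q ⁻¹' (Quot.mk S.Rel ⁻¹' {e | V e})) =
        ⋃ p ∈ {p | p ∈ T ∧ p.1 = q.1 ∧ q.2 * S.pot p = c}, Metric.ball p.2 ε := by
      ext y
      simp only [Set.mem_preimage, Set.mem_ofPred_eq, Set.mem_iUnion, Metric.mem_ball, exists_prop]
      exact ⟨fun ⟨p, a, b, d, e⟩ => ⟨p, ⟨a, b, e⟩, d⟩, fun ⟨p, ⟨a, b, e⟩, d⟩ => ⟨p, a, b, d, e⟩⟩
    rw [this]
    exact isOpen_biUnion fun _ _ => Metric.isOpen_ball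
  refine ⟨{e | V e}, hVopen.mem_nhds ⟨(k₀, x₀), hxT, rfl, by simpa using hε, rfl⟩, ?_⟩
  rintro a ⟨_, ⟨y, hy, rfl⟩, hy'⟩
  induction y using Total.induction with | h k g x => ?_
  obtain ⟨p, hp, hpk, hpd, hpc⟩ := hy
  obtain ⟨q, hq, hqk, hqd, hqc⟩ := hy'
  have hpq : p = q := by
    refine Prod.ext (hpk.trans hqk.symm) (h3 p hp q hq ?_)
    calc dist p.2 q.2 ≤ dist x p.2 + dist x q.2 := dist_triangle_left _ _ _
      _ < ε + ε := add_lt_add hpd hqd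
  subst hpq
  have := mul_right_cancel (hqc.trans hpc.symm)
  simpa using this

end ArcGluing

/-! # The infinite cyclic covering of a mapping torus -/

section Torus

variable {S : Type} [TopologicalSpace S] (F : S ≃ₜ S)

/-- The product of a space with the line, with the action of the integers whose quotient is the
mapping torus of `F`. -/
def TorusCover (_ : S ≃ₜ S) : Type := S × ℝ

instance : TopologicalSpace (TorusCover F) := inferInstanceAs (TopologicalSpace (S × ℝ))

instance : MulAction (Multiplicative ℤ) (TorusCover F) where
  smul n p := ((F ^ n.toAdd) p.1, p.2 - (n.toAdd : ℤ))
  one_smul p := by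
    change ((F ^ (0 : ℤ)) p.1, p.2 - ((0 : ℤ) : ℝ)) = p
    rw [zpow_zero, Int.cast_zero, sub_zero]
    rfl
  mul_smul m n p := by
    change ((F ^ (m.toAdd + n.toAdd)) p.1, p.2 - ((m.toAdd + n.toAdd : ℤ) : ℝ)) =
      ((F ^ m.toAdd) ((F ^ n.toAdd) p.1), p.2 - ((n.toAdd : ℤ) : ℝ) - ((m.toAdd : ℤ) : ℝ))
    rw [zpow_add]
    refine Prod.ext rfl ?_
    push_cast
    ring

instance : ContinuousConstSMul (Multiplicative ℤ) (TorusCover F) where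
  continuous_const_smul n :=
    ((F ^ n.toAdd).continuous.comp continuous_fst).prodMk (continuous_snd.sub continuous_const)

theorem TorusCover.exists_nhds_smul_disjoint (e : TorusCover F) :
    ∃ U ∈ 𝓝 e, ∀ a : Multiplicative ℤ, ((a • ·) '' U ∩ U).Nonempty → a = 1 := by
  have hc : Continuous fun p : TorusCover F => p.2 := continuous_snd
  refine ⟨{p | p.2 ∈ Metric.ball e.2 (1 / 2)}, (Metric.isOpen_ball.preimage hc).mem_nhds
    (Metric.mem_ball_self (by norm_num)), ?_⟩
  rintro a ⟨_, ⟨y, hy, rfl⟩, hy'⟩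
  have hy1 : |y.2 - e.2| < 1 / 2 := hy
  have hy2 : |y.2 - (a.toAdd : ℤ) - e.2| < 1 / 2 := hy'
  have h : |((a.toAdd : ℤ) : ℝ)| < 1 := by
    rw [abs_lt] at *
    constructor <;> linarith
  have h' : |(a.toAdd : ℤ)| < 1 := by exact_mod_cast h
  exact Int.abs_lt_one_iff.1 h'

/-- The mapping torus, as the quotient of the product with the line. -/
abbrev TorusQuotient : Type := MulAction.orbitRel.Quotient (Multiplicative ℤ) (TorusCover F)

/-- The quotient map onto the mapping torus. -/
def torusQuotientMk : C(TorusCover F, TorusQuotient F) := ⟨Quotient.mk _, continuous_quotient_mk'⟩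

theorem isQuotientCoveringMap_torusQuotientMk :
    IsQuotientCoveringMap (torusQuotientMk F) (Multiplicative ℤ) where
  toIsQuotientMap := isQuotientMap_quotient_mk'
  continuous_const_smul := continuous_const_smul
  apply_eq_iff_mem_orbit := Quotient.eq
  disjoint := TorusCover.exists_nhds_smul_disjoint F

/-- The comparison of the two descriptions of the mapping torus. -/
def mappingTorusToQuotient : C(MappingTorus F, TorusQuotient F) :=
  ⟨Quot.lift (fun p => torusQuotientMk F (p.1, (p.2 : ℝ))) (by
    rintro _ _ ⟨x⟩
    refine Quotient.sound ⟨Multiplicative.ofAdd (-1), ?_⟩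
    change ((F ^ (-1 : ℤ)) (F x), ((0 : unitInterval) : ℝ) - ((-1 : ℤ) : ℝ)) = _
    refine Prod.ext ?_ (by simp)
    rw [zpow_neg_one]
    exact F.symm_apply_apply x),
    continuous_quot_lift _ ((torusQuotientMk F).continuous.comp
      (continuous_fst.prodMk (continuous_subtype_val.comp continuous_snd)))⟩

/-- The covering of the mapping torus, as a function. -/
def torusCoverMap (p : TorusCover F) : MappingTorus F :=
  Quot.mk _ ((F ^ ⌊p.2⌋) p.1, ⟨Int.fract p.2, Int.fract_nonneg _, (Int.fract_lt_one _).le⟩)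

theorem torusCoverMap_smul (n : Multiplicative ℤ) (p : TorusCover F) :
    torusCoverMap F (n • p) = torusCoverMap F p := by
  have h1 : ⌊p.2 - ((n.toAdd : ℤ) : ℝ)⌋ = ⌊p.2⌋ - n.toAdd := Int.floor_sub_intCast _ _
  have h2 : Int.fract (p.2 - ((n.toAdd : ℤ) : ℝ)) = Int.fract p.2 := Int.fract_sub_intCast _ _
  have h3 : (F ^ ⌊p.2 - ((n.toAdd : ℤ) : ℝ)⌋) ((F ^ n.toAdd) p.1) = (F ^ ⌊p.2⌋) p.1 := by
    rw [h1, zpow_sub]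
    change (F ^ ⌊p.2⌋) ((F ^ n.toAdd)⁻¹ ((F ^ n.toAdd) p.1)) = _
    exact congrArg _ ((F ^ n.toAdd).symm_apply_apply p.1)
  exact congrArg (Quot.mk _) (Prod.ext h3 (Subtype.ext h2))

theorem torusCoverMap_eq_of_mem_Icc (x : S) (r : ℝ) (hr : r ∈ Set.Icc (0 : ℝ) 1) :
    torusCoverMap F (x, r) = Quot.mk _ (x, ⟨r, hr⟩) := by
  rcases hr.2.lt_or_eq with h | h
  · have h1 : ⌊r⌋ = 0 := Int.floor_eq_zero_iff.2 ⟨hr.1, h⟩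
    have h2 : Int.fract r = r := Int.fract_eq_self.2 ⟨hr.1, h⟩
    refine congrArg (Quot.mk _) (Prod.ext ?_ (Subtype.ext h2))
    change (F ^ ⌊r⌋) x = x
    rw [h1, zpow_zero]
    rfl
  · subst h
    have h1 : ⌊(1 : ℝ)⌋ = 1 := Int.floor_one
    have h2 : Int.fract (1 : ℝ) = 0 := Int.fract_one
    refine Eq.trans ?_ (Quot.sound (TorusGlue.glue (f := F) x)).symm
    refine congrArg (Quot.mk _) (Prod.ext ?_ (Subtype.ext h2))
    change (F ^ ⌊(1 : ℝ)⌋) x = F x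
    rw [h1, zpow_one]

/-- The integer part jumps, but invariance under the integers reduces the claim to heights in `(-1,
1)`. There the map is pieced together from two continuous formulas that agree at height zero by the
gluing of the mapping torus. -/
theorem continuous_torusCoverMap : Continuous (torusCoverMap F) := by
  have hfst : Continuous fun p : TorusCover F => p.1 := continuous_fst
  have hsnd : Continuous fun p : TorusCover F => p.2 := continuous_snd
  let g : TorusCover F → MappingTorus F := fun p =>
    if (0 : ℝ) ≤ p.2 then Quot.mk _ (p.1, Set.projIcc 0 1 zero_le_one p.2)
    else Quot.mk _ (F.symm p.1, Set.projIcc 0 1 zero_le_one (p.2 + 1))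
  have hg : Continuous g := by
    refine Continuous.if_le ?_ ?_ continuous_const hsnd ?_
    · exact continuous_quot_mk.comp (hfst.prodMk (continuous_projIcc.comp hsnd))
    · exact continuous_quot_mk.comp ((F.symm.continuous.comp hfst).prodMk
        (continuous_projIcc.comp (hsnd.add continuous_const)))
    · rintro ⟨x, r⟩ hr
      obtain rfl : (0 : ℝ) = r := hr
      have h0 : Set.projIcc (0 : ℝ) 1 zero_le_one 0 = 0 := Set.projIcc_left _
      have h1 : Set.projIcc (0 : ℝ) 1 zero_le_one (0 + 1) = 1 := by
        rw [zero_add]; exact Set.projIcc_right _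
      rw [h0, h1]
      have := Quot.sound (TorusGlue.glue (f := F) (F.symm x))
      rw [F.apply_symm_apply] at this
      exact this.symm
  have hlocal : ∀ p : TorusCover F, p.2 ∈ Set.Ioo (-1 : ℝ) 1 → torusCoverMap F p = g p := by
    rintro ⟨x, r⟩ ⟨h1, h2⟩
    change -1 < r at h1
    change r < 1 at h2
    by_cases h : 0 ≤ r
    · rw [torusCoverMap_eq_of_mem_Icc F x r ⟨h, h2.le⟩]
      simp only [g, if_pos h]
      rw [Set.projIcc_of_mem _ ⟨h, h2.le⟩]
    · simp only [g, if_neg h]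
      have hm : r + 1 ∈ Set.Icc (0 : ℝ) 1 := ⟨by linarith, by linarith⟩
      rw [Set.projIcc_of_mem _ hm, ← torusCoverMap_eq_of_mem_Icc,
        ← torusCoverMap_smul F (Multiplicative.ofAdd (-1)) (x, r)]
      refine congrArg _ (Prod.ext ?_ ?_)
      · change (F ^ (-1 : ℤ)) x = _
        rw [zpow_neg_one]
        rfl
      · change r - ((-1 : ℤ) : ℝ) = r + 1
        push_cast
        ring
  refine continuous_iff_continuousAt.2 fun p => ?_
  let n : Multiplicative ℤ := Multiplicative.ofAdd ⌊p.2⌋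
  have h1 : torusCoverMap F = torusCoverMap F ∘ fun q => n • q :=
    funext fun q => (torusCoverMap_smul F n q).symm
  rw [h1]
  refine ContinuousAt.comp (f := fun q : TorusCover F => n • q) ?_
    (continuous_const_smul n).continuousAt
  refine hg.continuousAt.congr (Filter.eventuallyEq_of_mem
    ((isOpen_Ioo.preimage hsnd).mem_nhds ?_) fun q hq => (hlocal q hq).symm)
  change p.2 - (⌊p.2⌋ : ℝ) ∈ Set.Ioo (-1 : ℝ) 1
  have h2 := Int.floor_le p.2
  have h3 := Int.lt_floor_add_one p.2
  constructor <;> linarith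

theorem isQuotientCoveringMap_torusCoverMap :
    IsQuotientCoveringMap (torusCoverMap F) (Multiplicative ℤ) := by
  refine .of_section _ (continuous_torusCoverMap F) (torusCoverMap_smul F)
    (mappingTorusToQuotient F) (mappingTorusToQuotient F).continuous ?_ ?_
    (TorusCover.exists_nhds_smul_disjoint F)
  · intro p
    exact Quotient.sound ⟨Multiplicative.ofAdd ⌊p.2⌋, rfl⟩
  · intro z
    induction z using Quot.inductionOn with | _ z => ?_
    exact ⟨(z.1, z.2), torusCoverMap_eq_of_mem_Icc F z.1 z.2 z.2.2⟩

end Torus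
end

end

section

open Topology
noncomputable section

/-! # Arcs of the circle -/

theorem continuous_arcPoint (N j : ℕ) : Continuous (arcPoint N j) := by
  unfold arcPoint
  fun_prop

theorem arcPoint_eq_iff {N : ℕ} (hN : 0 < N) (i j : ℕ) (s t : unitInterval) :
    arcPoint N i s = arcPoint N j t ↔ ∃ m : ℤ, (i : ℝ) + s = j + t + m * N := by
  have hN' : (N : ℝ) ≠ 0 := by positivity
  rw [arcPoint, arcPoint, Subtype.mk.injEq, Circle.coe_inj, Circle.exp_eq_exp]
  refine exists_congr fun m => ?_
  constructor
  · intro h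
    have hpi := Real.pi_ne_zero
    field_simp at h
    linarith
  · intro h
    rw [h]
    field_simp

theorem arcPoint_one (N j : ℕ) : arcPoint N j 1 = arcPoint N (j + 1) 0 := by
  simp [arcPoint]

theorem arcPoint_self {N : ℕ} (hN : 0 < N) : arcPoint N N 0 = arcPoint N 0 0 :=
  (arcPoint_eq_iff hN _ _ _ _).2 ⟨1, by simp⟩

theorem eq_of_sub_eq_int {s t : unitInterval} {m : ℤ} (h : (s : ℝ) - t = m) :
    s = t ∨ s = unitInterval.symm t := by
  have h1 := s.2.1
  have h2 := s.2.2
  have h3 := t.2.1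
  have h4 := t.2.2
  have hm1 : ((-2 : ℤ) : ℝ) < m := by push_cast; linarith
  have hm2 : (m : ℝ) < (2 : ℤ) := by push_cast; linarith
  have hm1' : -2 < m := by exact_mod_cast hm1
  have hm2' : m < 2 := by exact_mod_cast hm2
  obtain rfl | rfl | rfl : m = -1 ∨ m = 0 ∨ m = 1 := by omega
  · right
    apply Subtype.ext
    rw [unitInterval.coe_symm_eq]
    push_cast at h
    linarith
  · left
    apply Subtype.ext
    push_cast at h
    linarith
  · right
    apply Subtype.ext
    rw [unitInterval.coe_symm_eq]
    push_cast at h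
    linarith

/-- Distinct arcs meet only at ends. Hence the boundary points whose parameter is `t₀` or `1 - t₀`
form a set that does not depend on the arc used to name a point. -/
theorem param_of_arcPoint_eq {N : ℕ} (hN : 0 < N) {i j : ℕ} {s t : unitInterval}
    (h : arcPoint N i s = arcPoint N j t) : s = t ∨ s = unitInterval.symm t := by
  obtain ⟨m, hm⟩ := (arcPoint_eq_iff hN _ _ _ _).1 h
  refine eq_of_sub_eq_int (m := j - i + m * N) ?_
  push_cast
  linarith

theorem arcPoint_injective {N : ℕ} (hN : 0 < N) {i j : ℕ} (hi : i < N) (hj : j < N)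
    {s t : unitInterval} (hs : s ≠ 1) (ht : t ≠ 1) (h : arcPoint N i s = arcPoint N j t) :
    i = j ∧ s = t := by
  obtain ⟨m, hm⟩ := (arcPoint_eq_iff hN _ _ _ _).1 h
  have hs1 : (s : ℝ) < 1 := lt_of_le_of_ne s.2.2 fun h => hs (Subtype.ext h)
  have ht1 : (t : ℝ) < 1 := lt_of_le_of_ne t.2.2 fun h => ht (Subtype.ext h)
  have hs0 := s.2.1
  have ht0 := t.2.1
  have hij : (i : ℤ) = j + m * N := by
    have h1 : ((i : ℤ) : ℝ) < (j + m * N + 1 : ℤ) := by push_cast; linarith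
    have h2 : ((j + m * N : ℤ) : ℝ) < (i + 1 : ℤ) := by push_cast; linarith
    have h1' : (i : ℤ) < j + m * N + 1 := by exact_mod_cast h1
    have h2' : j + m * N < (i : ℤ) + 1 := by exact_mod_cast h2
    omega
  have hm0 : m = 0 := by
    have h1 : m * N < 1 * N := by omega
    have h2 : (-1) * (N : ℤ) < m * N := by omega
    have h1' := lt_of_mul_lt_mul_right h1 (by omega)
    have h2' := lt_of_mul_lt_mul_right h2 (by omega)
    omega
  subst hm0
  have hij' : i = j := by simpa using hij
  subst hij'
  refine ⟨rfl, Subtype.ext ?_⟩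
  simpa using hm

theorem dist_arcPoint (N i : ℕ) (s t : unitInterval) :
    dist (arcPoint N i s) (arcPoint N i t) =
      ‖(Circle.exp (2 * Real.pi * ((s : ℝ) - t) / N) : ℂ) - 1‖ := by
  have h : (Circle.exp (2 * Real.pi * ((i : ℝ) + s) / N) : ℂ) =
      Circle.exp (2 * Real.pi * ((i : ℝ) + t) / N) *
        Circle.exp (2 * Real.pi * ((s : ℝ) - t) / N) := by
    rw [← Circle.coe_mul, ← Circle.exp_add]
    congr 2
    ring
  rw [Subtype.dist_eq, dist_eq_norm, arcPoint, arcPoint]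
  simp only
  rw [h, ← mul_sub_one, norm_mul, Circle.norm_coe, one_mul]

/-- The chord length depends only on the difference of the parameters, up to sign. -/
theorem dist_arcPoint_symm (N i j : ℕ) (s t : unitInterval) :
    dist (arcPoint N i s) (arcPoint N i t) =
      dist (arcPoint N j (unitInterval.symm s)) (arcPoint N j (unitInterval.symm t)) := by
  rw [dist_comm (arcPoint N j _), dist_arcPoint, dist_arcPoint]
  simp only [unitInterval.coe_symm_eq]
  congr 5
  ring

/-! # Words along the boundary of the polygon -/

/-- The product of the first `n` terms of a sequence in a group. -/
def wordProd {G : Type*} [Group G] (u : ℕ → G) : ℕ → G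
  | 0 => 1
  | n + 1 => wordProd u n * u n

/-- A holonomy along the sides of the polygon of a surface of genus `h` with `b` holes, for every
sheet in `K`, compatible with the identification of the sides and of the boundaries of the
sheets. -/
structure SideHolonomy (h b : ℕ) (K G : Type) [Group G] where
  u : K → ℕ → G
  handleA : ∀ k i, i < h → u k (4 * i + 2) = (u k (4 * i))⁻¹
  handleB : ∀ k i, i < h → u k (4 * i + 3) = (u k (4 * i + 1))⁻¹
  hole : ∀ k l, l < b → u k (4 * h + 3 * l + 2) = (u k (4 * h + 3 * l))⁻¹
  free : ∀ k k' l, l < b → u k (4 * h + 3 * l + 1) = u k' (4 * h + 3 * l + 1)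
  close : ∀ k, wordProd (u k) (4 * h + 3 * b) = 1

namespace SideHolonomy

variable {h b : ℕ} {K G : Type} [Group G] (H : SideHolonomy h b K G)

/-- The sides that are glued to an earlier side. -/
def IsBack (h j : ℕ) : Prop :=
  (j < 4 * h ∧ (j % 4 = 2 ∨ j % 4 = 3)) ∨ (4 * h ≤ j ∧ (j - 4 * h) % 3 = 2)

open Classical in
/-- The value of the potential in the interior of a side. -/
def sidePot (k : K) (j : ℕ) : G :=
  -- A back side is traversed against its partner, so it carries the value at its end, which
  -- corresponds to the start of the partner.
  if IsBack h j then wordProd (H.u k) (j + 1) else wordProd (H.u k) j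

open Classical in
/-- The potential: on the sides of the polygon it records the holonomy from the first vertex. -/
def pot (p : K × ClosedDisc) : G :=
  if hp : ∃ q : ℕ × unitInterval, q.1 < 4 * h + 3 * b ∧ q.2 ≠ 1 ∧
      p.2 = arcPoint (4 * h + 3 * b) q.1 q.2 then
    if hp.choose.2 = 0 then wordProd (H.u p.1) hp.choose.1 else H.sidePot p.1 hp.choose.1
  else 1

theorem pot_of_ne_one (k : K) {j : ℕ} (hj : j < 4 * h + 3 * b) {t : unitInterval} (ht : t ≠ 1) :
    H.pot (k, arcPoint (4 * h + 3 * b) j t) =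
      if t = 0 then wordProd (H.u k) j else H.sidePot k j := by
  have hp : ∃ q : ℕ × unitInterval, q.1 < 4 * h + 3 * b ∧ q.2 ≠ 1 ∧
      arcPoint (4 * h + 3 * b) j t = arcPoint (4 * h + 3 * b) q.1 q.2 := ⟨(j, t), hj, ht, rfl⟩
  obtain ⟨h1, h2, h3⟩ := hp.choose_spec
  obtain ⟨h4, h5⟩ := arcPoint_injective (by omega) hj h1 ht h2 h3
  rw [pot, dif_pos hp, ← h4, ← h5]

theorem pot_zero (k : K) {j : ℕ} (hj : j < 4 * h + 3 * b) :
    H.pot (k, arcPoint (4 * h + 3 * b) j 0) = wordProd (H.u k) j := by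
  rw [H.pot_of_ne_one k hj zero_ne_one, if_pos rfl]

theorem pot_one (k : K) {j : ℕ} (hj : j < 4 * h + 3 * b) :
    H.pot (k, arcPoint (4 * h + 3 * b) j 1) = wordProd (H.u k) (j + 1) := by
  rw [arcPoint_one]
  rcases Nat.lt_or_ge (j + 1) (4 * h + 3 * b) with h1 | h1
  · exact H.pot_zero k h1
  -- The last side ends at corner `0`, and `close` says that the word has returned to `1` there.
  · obtain h2 : j + 1 = 4 * h + 3 * b := by omega
    rw [h2, arcPoint_self (by omega), H.pot_zero k (by omega), H.close]
    rfl

theorem pot_arcPoint (k : K) {j : ℕ} (hj : j < 4 * h + 3 * b) (t : unitInterval) :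
    H.pot (k, arcPoint (4 * h + 3 * b) j t) =
      if t = 0 then wordProd (H.u k) j else if t = 1 then wordProd (H.u k) (j + 1)
      else H.sidePot k j := by
  by_cases h1 : t = 1
  · subst h1
    rw [H.pot_one k hj, if_neg one_ne_zero, if_pos rfl]
  · rw [H.pot_of_ne_one k hj h1, if_neg h1]

/-- The condition under which two sides can be glued with reversed orientation. -/
theorem pot_reversed (k : K) {i j : ℕ} (hi : i < 4 * h + 3 * b) (hj : j < 4 * h + 3 * b)
    (hi' : ¬ IsBack h i) (hj' : IsBack h j) (hu : H.u k j = (H.u k i)⁻¹) (t : unitInterval) :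
    H.pot (k, arcPoint (4 * h + 3 * b) i t) =
      wordProd (H.u k) i * (wordProd (H.u k) (j + 1))⁻¹ *
        H.pot (k, arcPoint (4 * h + 3 * b) j (unitInterval.symm t)) := by
  rw [H.pot_arcPoint k hi, H.pot_arcPoint k hj]
  have h0 : unitInterval.symm t = 0 ↔ t = 1 := unitInterval.symm_eq_zero
  have h1 : unitInterval.symm t = 1 ↔ t = 0 := unitInterval.symm_eq_one
  simp only [h0, h1]
  by_cases ht0 : t = 0
  · have : t ≠ 1 := by rw [ht0]; exact zero_ne_one
    simp [ht0]
  · by_cases ht1 : t = 1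
    · simp only [ht1, one_ne_zero, if_true, if_false]
      rw [wordProd, wordProd, hu]
      group
    · simp only [ht0, ht1, if_false, sidePot, hi', hj', if_true]
      group

variable [Finite K]

/-- The gluing of the sides of the polygons of the sheets, and of the sheets along their
boundaries, with labels given by the holonomy. -/
def gluing : ArcGluing ClosedDisc K G where
  ι := (K × (Fin h ⊕ Fin h ⊕ Fin b)) ⊕ (Fin b × K × K)
  fin := inferInstance
  l := fun j => match j with
    | .inl (_, .inl i) => arcPoint (4 * h + 3 * b) (4 * i)
    | .inl (_, .inr (.inl i)) => arcPoint (4 * h + 3 * b) (4 * i + 1)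
    | .inl (_, .inr (.inr l)) => arcPoint (4 * h + 3 * b) (4 * h + 3 * l)
    | .inr (l, _, _) => arcPoint (4 * h + 3 * b) (4 * h + 3 * l + 1)
  r := fun j => match j with
    | .inl (_, .inl i) => fun t => arcPoint (4 * h + 3 * b) (4 * i + 2) (unitInterval.symm t)
    | .inl (_, .inr (.inl i)) => fun t =>
        arcPoint (4 * h + 3 * b) (4 * i + 3) (unitInterval.symm t)
    | .inl (_, .inr (.inr l)) => fun t =>
        arcPoint (4 * h + 3 * b) (4 * h + 3 * l + 2) (unitInterval.symm t)
    | .inr (l, _, _) => arcPoint (4 * h + 3 * b) (4 * h + 3 * l + 1)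
  lk := fun j => match j with
    | .inl (k, _) => k
    | .inr (_, k, _) => k
  rk := fun j => match j with
    | .inl (k, _) => k
    | .inr (_, _, k') => k'
  lab := fun j => match j with
    | .inl (k, .inl i) => wordProd (H.u k) (4 * i) * (wordProd (H.u k) (4 * i + 2 + 1))⁻¹
    | .inl (k, .inr (.inl i)) =>
        wordProd (H.u k) (4 * i + 1) * (wordProd (H.u k) (4 * i + 3 + 1))⁻¹
    | .inl (k, .inr (.inr l)) =>
        wordProd (H.u k) (4 * h + 3 * l) * (wordProd (H.u k) (4 * h + 3 * l + 2 + 1))⁻¹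
    | .inr (l, k, k') =>
        wordProd (H.u k) (4 * h + 3 * l + 1) * (wordProd (H.u k') (4 * h + 3 * l + 1))⁻¹
  cont_l := by
    rintro (⟨k, i | i | l⟩ | ⟨l, k, k'⟩) <;> exact continuous_arcPoint _ _
  cont_r := by
    rintro (⟨k, i | i | l⟩ | ⟨l, k, k'⟩)
    on_goal 4 => exact continuous_arcPoint _ _
    all_goals exact (continuous_arcPoint _ _).comp unitInterval.continuous_symm
  isom := by
    rintro (⟨k, i | i | l⟩ | ⟨l, k, k'⟩) s t
    on_goal 4 => rfl
    all_goals exact dist_arcPoint_symm _ _ _ s t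
  pot := H.pot
  pot_eq := by
    rintro (⟨k, i | i | l⟩ | ⟨l, k, k'⟩) t
    · have := i.2
      exact H.pot_reversed k (by omega) (by omega) (by unfold IsBack; omega)
        (by unfold IsBack; omega) (H.handleA k i i.2) t
    · have := i.2
      exact H.pot_reversed k (by omega) (by omega) (by unfold IsBack; omega)
        (by unfold IsBack; omega) (H.handleB k i i.2) t
    · have := l.2
      exact H.pot_reversed k (by omega) (by omega) (by unfold IsBack; omega)
        (by unfold IsBack; omega) (H.hole k l l.2) t
    · have := l.2
      have hl : 4 * h + 3 * (l : ℕ) + 1 < 4 * h + 3 * b := by omega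
      have hb : ¬ IsBack h (4 * h + 3 * (l : ℕ) + 1) := by unfold IsBack; omega
      change H.pot (k, _) = _ * H.pot (k', _)
      simp only [H.pot_arcPoint _ hl, sidePot, if_neg hb]
      have hu := H.free k k' l l.2
      split_ifs
      · group
      · change wordProd (H.u k) (4 * h + 3 * l + 1) * H.u k (4 * h + 3 * l + 1) =
          _ * (wordProd (H.u k') (4 * h + 3 * l + 1) * H.u k' (4 * h + 3 * l + 1))
        rw [hu, ← mul_assoc, inv_mul_cancel_right]
      · group
  finite_class := by
    rintro ⟨k₀, x⟩
    by_cases hx : ∃ j < 4 * h + 3 * b, ∃ t, x = arcPoint (4 * h + 3 * b) j t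
    · obtain ⟨j₀, hj₀, t₀, rfl⟩ := hx
      have hN : 0 < 4 * h + 3 * b := by omega
      -- The saturated set takes, on every side of every sheet, the points with parameter `t₀` and
      -- `1 - t₀`: each gluing preserves or reverses the parameter. Corners need no separate
      -- treatment.
      let f : K × Fin (4 * h + 3 * b) × Bool → K × ClosedDisc := fun q =>
        (q.1, arcPoint (4 * h + 3 * b) q.2.1 (if q.2.2 then t₀ else unitInterval.symm t₀))
      have hf : ∀ k j t, j < 4 * h + 3 * b → ((k, arcPoint (4 * h + 3 * b) j t) ∈ Set.range f ↔
          t = t₀ ∨ t = unitInterval.symm t₀) := by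
        intro k j t hj
        constructor
        · rintro ⟨⟨k', j', c⟩, hq⟩
          have h1 := (Prod.ext_iff.1 hq).2
          have h2 := param_of_arcPoint_eq hN h1.symm
          cases c
          · simpa [or_comm] using h2
          · simpa using h2
        · rintro (rfl | rfl)
          · exact ⟨(k, ⟨j, hj⟩, true), by simp [f]⟩
          · exact ⟨(k, ⟨j, hj⟩, false), by simp [f]⟩
      refine ⟨Set.range f, Set.finite_range f, (hf _ _ _ hj₀).2 (Or.inl rfl), ?_⟩
      have hs : ∀ t : unitInterval, (t = t₀ ∨ t = unitInterval.symm t₀) ↔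
          (unitInterval.symm t = t₀ ∨ unitInterval.symm t = unitInterval.symm t₀) := by
        intro t
        rw [unitInterval.symm_bijective.injective.eq_iff, or_comm]
        refine or_congr ⟨fun h => by rw [h, unitInterval.symm_symm],
          fun h => by rw [← h, unitInterval.symm_symm]⟩ Iff.rfl
      rintro (⟨k, i | i | l⟩ | ⟨l, k, k'⟩) t
      · have := i.2
        exact ((hf _ _ _ (by omega)).trans (hs t)).trans (hf _ _ _ (by omega)).symm
      · have := i.2
        exact ((hf _ _ _ (by omega)).trans (hs t)).trans (hf _ _ _ (by omega)).symm
      · have := l.2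
        exact ((hf _ _ _ (by omega)).trans (hs t)).trans (hf _ _ _ (by omega)).symm
      · have := l.2
        exact (hf _ _ _ (by omega)).trans (hf _ _ _ (by omega)).symm
    · refine ⟨{(k₀, x)}, Set.finite_singleton _, rfl, ?_⟩
      have hf : ∀ k j t, j < 4 * h + 3 * b →
          (k, arcPoint (4 * h + 3 * b) j t) ∉ ({(k₀, x)} : Set (K × ClosedDisc)) :=
        fun k j t hj hq => hx ⟨j, hj, t, (Prod.ext_iff.1 hq).2.symm⟩
      rintro (⟨k, i | i | l⟩ | ⟨l, k, k'⟩) t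
      · have := i.2
        exact iff_of_false (hf _ _ _ (by omega)) (hf _ _ _ (by omega))
      · have := i.2
        exact iff_of_false (hf _ _ _ (by omega)) (hf _ _ _ (by omega))
      · have := l.2
        exact iff_of_false (hf _ _ _ (by omega)) (hf _ _ _ (by omega))
      · have := l.2
        exact iff_of_false (hf _ _ _ (by omega)) (hf _ _ _ (by omega))

end SideHolonomy

end

end

section

open Topology
noncomputable section

/-! # Several copies of a space glued along a subset -/

section MultiDouble

variable (K : Type) {X : Type} [TopologicalSpace X] (A : Set X)

/-- The gluing of the copies of `X` along `A`. -/
inductive MultiDoubleRel : (Σ _ : K, X) → (Σ _ : K, X) → Prop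
  | glue (k k' : K) (x : X) (hx : x ∈ A) : MultiDoubleRel ⟨k, x⟩ ⟨k', x⟩

/-- The copies of `X` indexed by `K`, glued along `A`. -/
abbrev MultiDouble : Type := Quot (MultiDoubleRel K A)

variable {K}

/-- A copy of `X`. -/
def sheet (k : K) : C(X, MultiDouble K A) :=
  ⟨fun x => Quot.mk _ ⟨k, x⟩, continuous_quot_mk.comp continuous_sigmaMk⟩

variable {A}

theorem sheet_eq (k k' : K) {x : X} (hx : x ∈ A) : sheet A k x = sheet A k' x :=
  Quot.sound (MultiDoubleRel.glue k k' x hx)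

theorem MultiDouble.induction {P : MultiDouble K A → Prop} (h : ∀ k x, P (sheet A k x))
    (z : MultiDouble K A) : P z := by
  induction z using Quot.inductionOn with | _ z => ?_
  exact h _ _

/-- Maps out of the glued copies. -/
def multiLift {Z : Type*} [TopologicalSpace Z] (f : K → C(X, Z))
    (hf : ∀ k k', ∀ x ∈ A, f k x = f k' x) : C(MultiDouble K A, Z) :=
  ⟨Quot.lift (fun p => f p.1 p.2) (by rintro _ _ ⟨k, k', x, hx⟩; exact hf k k' x hx),
    continuous_quot_lift _ (continuous_sigma fun k => (f k).continuous)⟩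

@[simp] theorem multiLift_sheet {Z : Type*} [TopologicalSpace Z] (f : K → C(X, Z))
    (hf : ∀ k k', ∀ x ∈ A, f k x = f k' x) (k : K) (x : X) :
    multiLift f hf (sheet A k x) = f k x := rfl

variable (K) in
/-- A homeomorphism that preserves `A` acts on the glued copies. -/
def multiHomeomorph (F : X ≃ₜ X) (hF : F '' A = A) : MultiDouble K A ≃ₜ MultiDouble K A where
  toFun := multiLift (fun k => (sheet A k).comp ⟨F, F.continuous⟩) fun k k' _ hx =>
    sheet_eq k k' (hF ▸ Set.mem_image_of_mem F hx)
  invFun := multiLift (fun k => (sheet A k).comp ⟨F.symm, F.symm.continuous⟩) fun k k' x hx =>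
    sheet_eq k k' (by
      rw [← hF] at hx
      obtain ⟨y, hy, rfl⟩ := hx
      simpa using hy)
  left_inv z := by
    induction z using MultiDouble.induction with | h k x => ?_
    simp
  right_inv z := by
    induction z using MultiDouble.induction with | h k x => ?_
    simp
  continuous_toFun := ContinuousMap.continuous _
  continuous_invFun := ContinuousMap.continuous _

end MultiDouble

/-! # The regular covering defined by a holonomy along the sides -/

namespace SideHolonomy

variable {h b : ℕ} {K G : Type} [Group G] (H : SideHolonomy h b K G) [Finite K]

/-- The point of the compact surface given by a point of the polygon. -/
def _root_.surfaceMk (h b : ℕ) : C(ClosedDisc, CompactSurface h b) :=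
  ⟨Quot.mk _, continuous_quot_mk⟩

/-- The total space of the covering. -/
abbrev Cover : Type := H.gluing.Total

/-- The point of the covering over a point of a sheet with given normalized coordinate. -/
def coverPt (k : K) (g : G) : CompactSurface h b → H.Cover :=
  Quot.lift (H.gluing.pt k g) (by
    rintro _ _ (⟨i, hi, s⟩ | ⟨i, hi, s⟩ | ⟨l, hl, s⟩)
    · exact H.gluing.pt_glue (.inl (k, .inl ⟨i, hi⟩)) s g
    · exact H.gluing.pt_glue (.inl (k, .inr (.inl ⟨i, hi⟩))) s g
    · exact H.gluing.pt_glue (.inl (k, .inr (.inr ⟨l, hl⟩))) s g)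

theorem coverPt_boundary (k k' : K) (g : G) {x : CompactSurface h b}
    (hx : x ∈ surfaceBoundary h b) : H.coverPt k g x = H.coverPt k' g x := by
  obtain ⟨l, hl, s, rfl⟩ := hx
  exact H.gluing.pt_glue (.inr (⟨l, hl⟩, k, k')) s g

/-- The (discontinuous) function `coord` is well defined on the covering and recovers `g`. -/
theorem coverPt_injective (k : K) {g g' : G} {x : CompactSurface h b}
    (hg : H.coverPt k g x = H.coverPt k g' x) : g = g' := by
  induction x using Quot.inductionOn with | _ x => ?_
  have := congrArg H.gluing.coord hg
  exact (H.gluing.coord_pt k g x).symm.trans (this.trans (H.gluing.coord_pt k g' x))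

/-- The projection of the covering. -/
def proj : C(H.Cover, MultiDouble K (surfaceBoundary h b)) :=
  ⟨ArcGluing.totalLift (fun k _ x => sheet _ k (surfaceMk h b x)) (by
    rintro (⟨k, i | i | l⟩ | ⟨l, k, k'⟩) t g
    · exact congrArg (sheet _ k) (Quot.sound (ArcGlue.handleA i i.2 t))
    · exact congrArg (sheet _ k) (Quot.sound (ArcGlue.handleB i i.2 t))
    · exact congrArg (sheet _ k) (Quot.sound (ArcGlue.hole l l.2 t))
    · exact sheet_eq k k' ⟨l, l.2, t, rfl⟩),
    ArcGluing.continuous_totalLift _ _ fun k _ =>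
      (sheet _ k).continuous.comp (surfaceMk h b).continuous⟩

@[simp] theorem proj_tot (k : K) (g : G) (x : ClosedDisc) :
    H.proj (H.gluing.tot k g x) = sheet _ k (surfaceMk h b x) := rfl

theorem proj_coverPt (k : K) (g : G) (x : CompactSurface h b) :
    H.proj (H.coverPt k g x) = sheet _ k x := by
  induction x using Quot.inductionOn with | _ x => ?_
  rfl

/-- The inverse on orbits sends a point of a sheet to the orbit of its representative in the copy
with index `1`; the labels of the gluing disappear in the orbit space. -/
theorem isQuotientCoveringMap_proj : IsQuotientCoveringMap H.proj G := by
  let mk : C(H.Cover, MulAction.orbitRel.Quotient G H.Cover) :=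
    ⟨Quotient.mk _, continuous_quotient_mk'⟩
  have hmk : ∀ k g x, mk (H.gluing.tot k g x) = mk (H.gluing.tot k 1 x) := fun k g x =>
    Quotient.sound ⟨g, by simp⟩
  have hglue : ∀ j t, mk (H.gluing.tot (H.gluing.lk j) 1 (H.gluing.l j t)) =
      mk (H.gluing.tot (H.gluing.rk j) 1 (H.gluing.r j t)) := fun j t => by
    rw [ArcGluing.tot_glue, hmk]
  let f : K → C(CompactSurface h b, MulAction.orbitRel.Quotient G H.Cover) := fun k =>
    ⟨Quot.lift (fun x => mk (H.gluing.tot k 1 x)) (by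
      rintro _ _ (⟨i, hi, s⟩ | ⟨i, hi, s⟩ | ⟨l, hl, s⟩)
      · exact hglue (.inl (k, .inl ⟨i, hi⟩)) s
      · exact hglue (.inl (k, .inr (.inl ⟨i, hi⟩))) s
      · exact hglue (.inl (k, .inr (.inr ⟨l, hl⟩))) s),
      continuous_quot_lift _ (mk.continuous.comp (ArcGluing.continuous_tot k 1))⟩
  let inv : C(MultiDouble K (surfaceBoundary h b), MulAction.orbitRel.Quotient G H.Cover) :=
    multiLift f (by
      rintro k k' _ ⟨l, hl, s, rfl⟩
      exact hglue (.inr (⟨l, hl⟩, k, k')) s)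
  refine .of_section _ H.proj.continuous ?_ inv inv.continuous ?_ ?_
    ArcGluing.exists_nhds_smul_disjoint
  · intro g z
    induction z using ArcGluing.Total.induction with | h k g' x => ?_
    rfl
  · intro z
    induction z using ArcGluing.Total.induction with | h k g' x => ?_
    exact (hmk k g' x).symm
  · intro z
    induction z using MultiDouble.induction with | h k x => ?_
    exact ⟨H.coverPt k 1 x, H.proj_coverPt k 1 x⟩

/-- The lift of a side of the polygon to the covering. -/
def sideLift (k : K) (g : G) {j : ℕ} (hj : j < 4 * h + 3 * b) :
    Path (H.coverPt k g (surfaceMk h b (arcPoint (4 * h + 3 * b) j 0)))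
      (H.coverPt k (g * H.u k j) (surfaceMk h b (arcPoint (4 * h + 3 * b) j 1))) where
  -- The lift stays in one copy of the polygon. The potential goes from `wordProd (H.u k) j` to
  -- `wordProd (H.u k) (j + 1)` along the side, so the normalized coordinate changes from `g` to `g
  -- * H.u k j`.
  toFun t := H.gluing.tot k (g * (wordProd (H.u k) j)⁻¹) (arcPoint (4 * h + 3 * b) j t)
  continuous_toFun := (ArcGluing.continuous_tot _ _).comp (continuous_arcPoint _ _)
  source' := by
    rw [ArcGluing.tot_eq_pt]
    change H.gluing.pt k (_ * H.pot _) _ = H.gluing.pt _ _ _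
    rw [H.pot_zero k hj, inv_mul_cancel_right]
  target' := by
    rw [ArcGluing.tot_eq_pt]
    change H.gluing.pt k (_ * H.pot _) _ = H.gluing.pt _ _ _
    rw [H.pot_one k hj, wordProd, mul_assoc, inv_mul_cancel_left]

end SideHolonomy

end

end

section

open Topology commutatorElement
noncomputable section

/-! # Words in surface groups -/

section Words

variable {G H : Type*} [Group G] [Group H]

theorem map_wordProd (f : G →* H) (u : ℕ → G) (n : ℕ) :
    f (wordProd u n) = wordProd (fun i => f (u i)) n := by
  induction n with
  | zero => simp [wordProd]
  | succ n ih => simp [wordProd, ih]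

theorem wordProd_congr {u v : ℕ → G} {n : ℕ} (h : ∀ i < n, u i = v i) :
    wordProd u n = wordProd v n := by
  induction n with
  | zero => rfl
  | succ n ih =>
    rw [wordProd, wordProd, ih fun i hi => h i (by omega), h n (by omega)]

theorem wordProd_add (u : ℕ → G) (m n : ℕ) :
    wordProd u (m + n) = wordProd u m * wordProd (fun i => u (m + i)) n := by
  induction n with
  | zero => simp [wordProd]
  | succ n ih => rw [← add_assoc, wordProd, ih, wordProd, mul_assoc]

theorem wordProd_conj (x : G) (u : ℕ → G) (n : ℕ) :
    wordProd (fun i => x * u i * x⁻¹) n = x * wordProd u n * x⁻¹ := by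
  have := map_wordProd (MulAut.conj x).toMonoidHom u n
  simpa using this.symm

theorem wordProd_reverse_inv (u : ℕ → G) (n : ℕ) :
    wordProd (fun i => (u (n - 1 - i))⁻¹) n = (wordProd u n)⁻¹ := by
  induction n with
  | zero => simp [wordProd]
  | succ n ih =>
    rw [add_comm n 1, wordProd_add, add_comm 1 n, wordProd, wordProd, wordProd, mul_inv_rev, ← ih]
    congr 1
    · simp
    · refine wordProd_congr fun i _ => ?_
      rw [show n + 1 - 1 - (1 + i) = n - 1 - i by omega]

theorem wordProd_sides {u : ℕ → G} {h b : ℕ} (hA : ∀ i < h, u (4 * i + 2) = (u (4 * i))⁻¹)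
    (hB : ∀ i < h, u (4 * i + 3) = (u (4 * i + 1))⁻¹)
    (hC : ∀ l < b, u (4 * h + 3 * l + 2) = (u (4 * h + 3 * l))⁻¹) :
    wordProd u (4 * h + 3 * b) = wordProd (fun i => ⁅u (4 * i), u (4 * i + 1)⁆) h *
      wordProd (fun l => u (4 * h + 3 * l) * u (4 * h + 3 * l + 1) * (u (4 * h + 3 * l))⁻¹) b := by
  have h1 : ∀ i ≤ h, wordProd u (4 * i) = wordProd (fun i => ⁅u (4 * i), u (4 * i + 1)⁆) i := by
    intro i hi
    induction i with
    | zero => rfl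
    | succ i ih =>
      rw [show 4 * (i + 1) = 4 * i + 1 + 1 + 1 + 1 by ring, wordProd, wordProd, wordProd, wordProd,
        ih (by omega), wordProd, hA i (by omega), hB i (by omega), commutatorElement_def]
      simp only [mul_assoc]
  have h2 : ∀ l ≤ b, wordProd u (4 * h + 3 * l) =
      wordProd (fun i => ⁅u (4 * i), u (4 * i + 1)⁆) h * wordProd (fun l => u (4 * h + 3 * l) *
        u (4 * h + 3 * l + 1) * (u (4 * h + 3 * l))⁻¹) l := by
    intro l hl
    induction l with
    | zero => rw [mul_zero, add_zero, h1 h le_rfl]; simp [wordProd]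
    | succ l ih =>
      rw [show 4 * h + 3 * (l + 1) = 4 * h + 3 * l + 1 + 1 + 1 by ring, wordProd, wordProd,
        wordProd, ih (by omega), wordProd, hC l (by omega)]
      simp only [mul_assoc]
  exact h2 b le_rfl

theorem List.prod_ofFn_eq_wordProd (n : ℕ) (u : ℕ → G) :
    (List.ofFn fun i : Fin n => u i).prod = wordProd u n := by
  induction n with
  | zero => simp [wordProd]
  | succ n ih => rw [List.ofFn_succ', List.concat_eq_append, List.prod_append]; simp [ih, wordProd]

end Words

namespace SurfaceGroup

variable {g : ℕ}

/-- The generators `aᵢ` of the surface group, indexed by natural numbers. -/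
def genA (g i : ℕ) : SurfaceGroup g :=
  if hi : i < g then PresentedGroup.of (Sum.inl ⟨i, hi⟩) else 1

/-- The generators `bᵢ` of the surface group, indexed by natural numbers. -/
def genB (g i : ℕ) : SurfaceGroup g :=
  if hi : i < g then PresentedGroup.of (Sum.inr ⟨i, hi⟩) else 1

theorem relation (g : ℕ) : wordProd (fun i => ⁅genA g i, genB g i⁆) g = 1 := by
  rw [← List.prod_ofFn_eq_wordProd]
  have h := PresentedGroup.one_of_mem (rels := {(List.ofFn fun i : Fin g =>
      FreeGroup.of (Sum.inl i) * FreeGroup.of (Sum.inr i) *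
        (FreeGroup.of (Sum.inl i))⁻¹ * (FreeGroup.of (Sum.inr i))⁻¹).prod}) rfl
  rw [map_list_prod, List.map_ofFn] at h
  rw [← h]
  congr 2
  funext i
  simp [genA, genB, commutatorElement_def, PresentedGroup.of]

/-- Homomorphisms out of the surface group. -/
def lift {P : Type*} [Group P] (a b : ℕ → P) (hab : wordProd (fun i => ⁅a i, b i⁆) g = 1) :
    SurfaceGroup g →* P :=
  PresentedGroup.toGroup (f := Sum.elim (fun i : Fin g => a i) (fun i : Fin g => b i)) (by
    rintro _ rfl
    rw [map_list_prod, List.map_ofFn, ← hab, ← List.prod_ofFn_eq_wordProd]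
    congr 2
    funext i
    simp [commutatorElement_def])

theorem lift_genA {P : Type*} [Group P] (a b : ℕ → P)
    (hab : wordProd (fun i => ⁅a i, b i⁆) g = 1) {i : ℕ} (hi : i < g) :
    lift a b hab (genA g i) = a i := by
  simp [lift, genA, hi]

theorem lift_genB {P : Type*} [Group P] (a b : ℕ → P)
    (hab : wordProd (fun i => ⁅a i, b i⁆) g = 1) {i : ℕ} (hi : i < g) :
    lift a b hab (genB g i) = b i := by
  simp [lift, genB, hi]

end SurfaceGroup

/-! # The surface relation in the double of a surface with boundary -/

/-- Group elements carried by the sides of two polygons (`a`, `b` for the handles, `c` for the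
paths to the holes, `d` for the boundary circles) and by the tubes `t` that join their holes. -/
structure DoubleData (P : Type*) where
  a₀ : ℕ → P
  b₀ : ℕ → P
  c₀ : ℕ → P
  d₀ : ℕ → P
  a₁ : ℕ → P
  b₁ : ℕ → P
  c₁ : ℕ → P
  d₁ : ℕ → P
  t : ℕ → P

namespace DoubleData

variable {P Q : Type*} [Group P] [Group Q] (D : DoubleData P) (h m : ℕ)

/-- The relations in the double of a surface of genus `h` with `m + 1` holes. -/
structure IsDouble : Prop where
  rel₀ : wordProd (fun i => ⁅D.a₀ i, D.b₀ i⁆) h *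
    wordProd (fun l => D.c₀ l * D.d₀ l * (D.c₀ l)⁻¹) (m + 1) = 1
  rel₁ : wordProd (fun i => ⁅D.a₁ i, D.b₁ i⁆) h *
    wordProd (fun l => D.c₁ l * D.d₁ l * (D.c₁ l)⁻¹) (m + 1) = 1
  tube : ∀ l < m + 1, D.d₀ l = D.t l * D.d₁ l * (D.t l)⁻¹

/-- The loop around a hole. -/
def loop (l : ℕ) : P := D.c₀ l * D.d₀ l * (D.c₀ l)⁻¹

/-- The passage from the first to the second polygon through the last tube. -/
def pass : P := D.c₀ m * D.t m * (D.c₁ m)⁻¹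

/-- The loop through the last tube and back through another one. -/
def cross (l : ℕ) : P := D.pass m * D.c₁ l * (D.t l)⁻¹ * (D.c₀ l)⁻¹

/-- The generators `aᵢ` of the fundamental group of the double. -/
def genA (i : ℕ) : P :=
  if i < h then D.pass m * D.a₁ i * (D.pass m)⁻¹
  else if i < h + m then
    wordProd D.loop (i - h) * D.cross m (i - h) * (wordProd D.loop (i - h))⁻¹
  -- The handles of the first polygon enter in reverse order with `a` and `b` exchanged, so that
  -- their commutators multiply to the inverse of `∏ [a₀, b₀]`.
  else D.b₀ (h - 1 - (i - (h + m)))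

/-- The generators `bᵢ` of the fundamental group of the double. -/
def genB (i : ℕ) : P :=
  if i < h then D.pass m * D.b₁ i * (D.pass m)⁻¹
  else if i < h + m then
    wordProd D.loop (i - h) * D.loop (i - h) * (wordProd D.loop (i - h))⁻¹
  else D.a₀ (h - 1 - (i - (h + m)))

/-- The product telescopes: conjugating by the product of the earlier loops leaves `cross * loop *
cross⁻¹` from each commutator and moves the inverse loops to the end. -/
theorem wordProd_cross (n : ℕ) :
    wordProd (fun l => ⁅wordProd D.loop l * D.cross m l * (wordProd D.loop l)⁻¹,
      wordProd D.loop l * D.loop l * (wordProd D.loop l)⁻¹⁆) n =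
    wordProd (fun l => D.cross m l * D.loop l * (D.cross m l)⁻¹) n * (wordProd D.loop n)⁻¹ := by
  induction n with
  | zero => simp [wordProd]
  | succ n ih =>
    rw [wordProd, ih, wordProd, wordProd, commutatorElement_def]
    group

variable {D h m}

theorem cross_self : D.cross m m = 1 := by
  unfold cross pass
  group

/-- Through the tube number `l`, the loop of the second polygon, moved to the base point by `pass`,
becomes the `cross`-conjugate of the loop of the first one; for the last tube `cross` is trivial.
The first polygon's relation supplies this last loop. The relation of the second polygon is not
assumed, so the identity serves in both directions: for the surface relation in `IsDouble.relation`,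
and for `rel₁` in `SurfaceGroup.doubleData_isDouble`. -/
theorem wordProd_gen (rel₀ : wordProd (fun i => ⁅D.a₀ i, D.b₀ i⁆) h *
      wordProd (fun l => D.c₀ l * D.d₀ l * (D.c₀ l)⁻¹) (m + 1) = 1)
    (tube : ∀ l < m + 1, D.d₀ l = D.t l * D.d₁ l * (D.t l)⁻¹) :
    wordProd (fun i => ⁅D.genA h m i, D.genB h m i⁆) (h + m + h) =
      D.pass m * (wordProd (fun i => ⁅D.a₁ i, D.b₁ i⁆) h *
        wordProd (fun l => D.c₁ l * D.d₁ l * (D.c₁ l)⁻¹) (m + 1)) * (D.pass m)⁻¹ := by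
  have e1 : wordProd (fun i => ⁅D.genA h m i, D.genB h m i⁆) h =
      D.pass m * wordProd (fun i => ⁅D.a₁ i, D.b₁ i⁆) h * (D.pass m)⁻¹ := by
    rw [← wordProd_conj]
    refine wordProd_congr fun i hi => ?_
    rw [genA, genB, if_pos hi, if_pos hi, commutatorElement_def, commutatorElement_def]
    group
  have e2 : wordProd (fun i => ⁅D.genA h m (h + i), D.genB h m (h + i)⁆) m =
      wordProd (fun l => D.cross m l * D.loop l * (D.cross m l)⁻¹) m *
        (wordProd D.loop m)⁻¹ := by
    rw [← wordProd_cross]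
    refine wordProd_congr fun i hi => ?_
    simp only [genA, genB]
    rw [if_neg (by omega), if_pos (by omega), if_neg (by omega), if_pos (by omega),
      Nat.add_sub_cancel_left]
  have e3 : wordProd (fun i => ⁅D.genA h m (h + m + i), D.genB h m (h + m + i)⁆) h =
      (wordProd (fun i => ⁅D.a₀ i, D.b₀ i⁆) h)⁻¹ := by
    rw [← wordProd_reverse_inv]
    refine wordProd_congr fun i hi => ?_
    simp only [genA, genB]
    rw [if_neg (by omega), if_neg (by omega), if_neg (by omega), if_neg (by omega),
      Nat.add_sub_cancel_left, commutatorElement_inv]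
  have e4 : ∀ l < m + 1, D.cross m l * D.loop l * (D.cross m l)⁻¹ =
      D.pass m * (D.c₁ l * D.d₁ l * (D.c₁ l)⁻¹) * (D.pass m)⁻¹ := by
    intro l hl
    rw [loop, tube l hl, cross]
    group
  have e5 : D.c₁ m * D.d₁ m * (D.c₁ m)⁻¹ = (D.pass m)⁻¹ * D.loop m * D.pass m := by
    have h4 := e4 m (by omega)
    rw [cross_self, one_mul, inv_one, mul_one] at h4
    rw [h4]
    group
  -- The relation of the first polygon, solved for the last loop.
  have r0 : (wordProd D.loop m)⁻¹ * (wordProd (fun i => ⁅D.a₀ i, D.b₀ i⁆) h)⁻¹ = D.loop m := by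
    rw [← mul_inv_rev, inv_eq_iff_mul_eq_one, mul_assoc]
    exact rel₀
  rw [wordProd_add, wordProd_add, e1, e2, e3,
    wordProd_congr fun l (hl : l < m) => e4 l (by omega), wordProd_conj, wordProd, e5, ← r0]
  group

theorem IsDouble.relation (hD : D.IsDouble h m) :
    wordProd (fun i => ⁅D.genA h m i, D.genB h m i⁆) (h + m + h) = 1 := by
  rw [wordProd_gen hD.rel₀ hD.tube, hD.rel₁, mul_one, mul_inv_cancel]

/-- Transport of the data by a homomorphism. -/
def map (f : P →* Q) (D : DoubleData P) : DoubleData Q where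
  a₀ i := f (D.a₀ i)
  b₀ i := f (D.b₀ i)
  c₀ i := f (D.c₀ i)
  d₀ i := f (D.d₀ i)
  a₁ i := f (D.a₁ i)
  b₁ i := f (D.b₁ i)
  c₁ i := f (D.c₁ i)
  d₁ i := f (D.d₁ i)
  t i := f (D.t i)

theorem map_loop (f : P →* Q) : (D.map f).loop = fun l => f (D.loop l) := by
  funext l
  simp [loop, map]

theorem map_pass (f : P →* Q) : (D.map f).pass m = f (D.pass m) := by
  simp [pass, map]

theorem map_cross (f : P →* Q) (l : ℕ) : (D.map f).cross m l = f (D.cross m l) := by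
  rw [cross, map_pass, cross]
  simp [map]

theorem map_genA (f : P →* Q) (i : ℕ) : (D.map f).genA h m i = f (D.genA h m i) := by
  unfold genA
  rw [map_loop, ← map_wordProd, map_cross, map_pass]
  split_ifs <;> simp [map]

theorem map_genB (f : P →* Q) (i : ℕ) : (D.map f).genB h m i = f (D.genB h m i) := by
  unfold genB
  rw [map_loop, ← map_wordProd, map_pass]
  split_ifs <;> simp [map]

/-- Pairs of data. -/
def prod (D : DoubleData P) (E : DoubleData Q) : DoubleData (P × Q) where
  a₀ i := (D.a₀ i, E.a₀ i)
  b₀ i := (D.b₀ i, E.b₀ i)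
  c₀ i := (D.c₀ i, E.c₀ i)
  d₀ i := (D.d₀ i, E.d₀ i)
  a₁ i := (D.a₁ i, E.a₁ i)
  b₁ i := (D.b₁ i, E.b₁ i)
  c₁ i := (D.c₁ i, E.c₁ i)
  d₁ i := (D.d₁ i, E.d₁ i)
  t i := (D.t i, E.t i)

theorem genA_prod (E : DoubleData Q) (i : ℕ) :
    (D.prod E).genA h m i = (D.genA h m i, E.genA h m i) :=
  Prod.ext (map_genA (MonoidHom.fst P Q) i).symm (map_genA (MonoidHom.snd P Q) i).symm

theorem genB_prod (E : DoubleData Q) (i : ℕ) :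
    (D.prod E).genB h m i = (D.genB h m i, E.genB h m i) :=
  Prod.ext (map_genB (MonoidHom.fst P Q) i).symm (map_genB (MonoidHom.snd P Q) i).symm

variable (D h m) in
/-- The data in the range of the indices that matter lie in a subgroup. -/
structure MemOn (S : Subgroup P) : Prop where
  a₀ : ∀ i < h, D.a₀ i ∈ S
  b₀ : ∀ i < h, D.b₀ i ∈ S
  c₀ : ∀ i < m + 1, D.c₀ i ∈ S
  d₀ : ∀ i < m + 1, D.d₀ i ∈ S
  a₁ : ∀ i < h, D.a₁ i ∈ S
  b₁ : ∀ i < h, D.b₁ i ∈ S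
  c₁ : ∀ i < m + 1, D.c₁ i ∈ S
  -- `d₁` is absent because it does not enter the generators.
  t : ∀ i < m + 1, D.t i ∈ S

namespace MemOn

variable {S : Subgroup P}

theorem loop (hD : D.MemOn h m S) {l : ℕ} (hl : l < m + 1) : D.loop l ∈ S :=
  mul_mem (mul_mem (hD.c₀ l hl) (hD.d₀ l hl)) (inv_mem (hD.c₀ l hl))

theorem wordProd_loop (hD : D.MemOn h m S) {l : ℕ} (hl : l < m + 1) :
    wordProd D.loop l ∈ S := by
  induction l with
  | zero => exact one_mem S
  | succ l ih => exact mul_mem (ih (by omega)) (hD.loop (by omega))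

theorem pass (hD : D.MemOn h m S) : D.pass m ∈ S :=
  mul_mem (mul_mem (hD.c₀ m (by omega)) (hD.t m (by omega))) (inv_mem (hD.c₁ m (by omega)))

theorem genA (hD : D.MemOn h m S) {i : ℕ} (hi : i < h + m + h) : D.genA h m i ∈ S := by
  unfold DoubleData.genA
  split_ifs with h1 h2
  · exact mul_mem (mul_mem hD.pass (hD.a₁ i h1)) (inv_mem hD.pass)
  · exact mul_mem (mul_mem (hD.wordProd_loop (by omega)) (mul_mem (mul_mem (mul_mem hD.pass
      (hD.c₁ _ (by omega))) (inv_mem (hD.t _ (by omega)))) (inv_mem (hD.c₀ _ (by omega)))))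
      (inv_mem (hD.wordProd_loop (by omega)))
  · exact hD.b₀ _ (by omega)

theorem genB (hD : D.MemOn h m S) {i : ℕ} (hi : i < h + m + h) : D.genB h m i ∈ S := by
  unfold DoubleData.genB
  split_ifs with h1 h2
  · exact mul_mem (mul_mem hD.pass (hD.b₁ i h1)) (inv_mem hD.pass)
  · exact mul_mem (mul_mem (hD.wordProd_loop (by omega)) (hD.loop (by omega)))
      (inv_mem (hD.wordProd_loop (by omega)))
  · exact hD.a₀ _ (by omega)

end MemOn

end DoubleData

namespace SurfaceGroup

variable (h m : ℕ)

/-- Products in reverse order. -/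
def revProd {G : Type*} [Group G] (u : ℕ → G) : ℕ → G
  | 0 => 1
  | n + 1 => u n * revProd u n

/-- The loops around the holes in the fundamental group of the double. -/
def loop (l : ℕ) : SurfaceGroup (h + m + h) :=
  -- Conjugation by the product of the earlier loops, which is `revProd`, must turn the loop into
  -- `genB (h + l)`. The last loop is forced by the relation of the first polygon.
  if l < m then
    (revProd (fun k => genB _ (h + k)) l)⁻¹ * genB _ (h + l) * revProd (fun k => genB _ (h + k)) l
  else (revProd (fun k => genB _ (h + k)) m)⁻¹ *
    (wordProd (fun i => ⁅genB (h + m + h) (h + m + (h - 1 - i)),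
      genA (h + m + h) (h + m + (h - 1 - i))⁆) h)⁻¹

/-- The data on the double that present its fundamental group. -/
def doubleData : DoubleData (SurfaceGroup (h + m + h)) where
  a₀ i := genB _ (h + m + (h - 1 - i))
  b₀ i := genA _ (h + m + (h - 1 - i))
  c₀ _ := 1
  d₀ l := loop h m l
  a₁ i := genA _ i
  b₁ i := genB _ i
  -- Since `c₀`, `t` and the last `c₁` are trivial, so is `pass`, and `cross` equals `c₁`. Its value
  -- is then determined by the prescribed generator `genA (h + l)`.
  c₁ l := if l < m then (revProd (fun k => genB _ (h + k)) l)⁻¹ * genA _ (h + l) *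
    revProd (fun k => genB _ (h + k)) l else 1
  d₁ l := loop h m l
  t _ := 1

theorem wordProd_loop {n : ℕ} (hn : n ≤ m) :
    wordProd (loop h m) n = revProd (fun k => genB _ (h + k)) n := by
  induction n with
  | zero => rfl
  | succ n ih =>
    rw [wordProd, ih (by omega), revProd, loop, if_pos (by omega)]
    group

theorem doubleData_loop : (doubleData h m).loop = loop h m := by
  funext l
  simp [DoubleData.loop, doubleData]

theorem doubleData_pass : (doubleData h m).pass m = 1 := by
  simp [DoubleData.pass, doubleData]

theorem doubleData_genA {i : ℕ} (hi : i < h + m + h) :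
    (doubleData h m).genA h m i = genA (h + m + h) i := by
  unfold DoubleData.genA
  rw [doubleData_loop, doubleData_pass]
  split_ifs with h1 h2
  · simp [doubleData]
  · rw [wordProd_loop h m (by omega), DoubleData.cross, doubleData_pass]
    simp only [doubleData]
    rw [if_pos (by omega), show h + (i - h) = i by omega]
    group
  · simp only [doubleData]
    congr 1
    omega

theorem doubleData_genB {i : ℕ} (hi : i < h + m + h) :
    (doubleData h m).genB h m i = genB (h + m + h) i := by
  unfold DoubleData.genB
  rw [doubleData_loop, doubleData_pass]
  split_ifs with h1 h2
  · simp [doubleData]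
  · rw [wordProd_loop h m (by omega), loop, if_pos (by omega), show h + (i - h) = i by omega]
    group
  · simp only [doubleData]
    congr 1
    omega

/-- The first relation holds by the choice of the last loop. By `wordProd_gen` the second one is
then exactly the defining relation of the surface group. -/
theorem doubleData_isDouble : (doubleData h m).IsDouble h m := by
  have rel₀ : wordProd (fun i => ⁅(doubleData h m).a₀ i, (doubleData h m).b₀ i⁆) h *
      wordProd (doubleData h m).loop (m + 1) = 1 := by
    rw [doubleData_loop, wordProd, wordProd_loop h m le_rfl, loop, if_neg (lt_irrefl m)]
    simp only [doubleData]
    group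
  have tube : ∀ l < m + 1, (doubleData h m).d₀ l =
      (doubleData h m).t l * (doubleData h m).d₁ l * ((doubleData h m).t l)⁻¹ :=
    fun l _ => by simp [doubleData]
  refine ⟨rel₀, ?_, tube⟩
  have h1 := DoubleData.wordProd_gen rel₀ tube
  rw [doubleData_pass, one_mul, inv_one, mul_one] at h1
  rw [← h1, ← relation (h + m + h)]
  exact wordProd_congr fun i hi => by rw [doubleData_genA h m hi, doubleData_genB h m hi]

/-- The fundamental group of the double embeds into a group `P` if the pairs of elements of `P` and
of the fundamental group of the double generate the graph of a partial map. -/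
theorem exists_injective {P : Type*} [Group P] (S : Subgroup (P × SurfaceGroup (h + m + h)))
    (hS : Function.Injective ((MonoidHom.fst _ _).comp S.subtype)) (D : DoubleData P)
    (hD : D.IsDouble h m) (hDS : (D.prod (doubleData h m)).MemOn h m S) :
    ∃ f : SurfaceGroup (h + m + h) →* P, Function.Injective f := by
  let f := lift _ _ hD.relation
  -- The generators are the same words in `D` and in `doubleData`, so their pairs are words in pairs
  -- that lie in `S`.
  have h1 : ∀ x, (f x, x) ∈ S := by
    intro x
    have h2 : (⊤ : Subgroup (SurfaceGroup (h + m + h))) ≤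
        S.comap (f.prod (MonoidHom.id _)) := by
      rw [← PresentedGroup.closure_range_of, Subgroup.closure_le]
      rintro _ ⟨i | i, rfl⟩
      · have h3 := hDS.genA i.2
        rw [DoubleData.genA_prod, doubleData_genA h m i.2, ← lift_genA _ _ hD.relation i.2] at h3
        rw [show PresentedGroup.of (Sum.inl i) = genA (h + m + h) i by simp [genA]]
        exact h3
      · have h3 := hDS.genB i.2
        rw [DoubleData.genB_prod, doubleData_genB h m i.2, ← lift_genB _ _ hD.relation i.2] at h3
        rw [show PresentedGroup.of (Sum.inr i) = genB (h + m + h) i by simp [genB]]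
        exact h3
    exact h2 (Subgroup.mem_top x)
  refine ⟨f, (injective_iff_map_eq_one f).2 fun x hx => ?_⟩
  have h2 := (injective_iff_map_eq_one _).1 hS ⟨_, h1 x⟩ hx
  exact (Prod.ext_iff.1 (Subtype.ext_iff.1 h2)).2

end SurfaceGroup

/-! # The holonomy of the double -/

section SideWord

variable {G : Type} [Group G]

/-- The word around the polygon. -/
def sideWord (h : ℕ) (a b c d : ℕ → G) (j : ℕ) : G :=
  if j < 4 * h then
    if j % 4 = 0 then a (j / 4) else if j % 4 = 1 then b (j / 4)
    else if j % 4 = 2 then (a (j / 4))⁻¹ else (b (j / 4))⁻¹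
  else if (j - 4 * h) % 3 = 0 then c ((j - 4 * h) / 3)
    else if (j - 4 * h) % 3 = 1 then d ((j - 4 * h) / 3) else (c ((j - 4 * h) / 3))⁻¹

variable {h i : ℕ} (a b c d : ℕ → G)

theorem sideWord_a (hi : i < h) : sideWord h a b c d (4 * i) = a i := by
  rw [sideWord, if_pos (by omega), if_pos (by omega), show 4 * i / 4 = i by omega]

theorem sideWord_b (hi : i < h) : sideWord h a b c d (4 * i + 1) = b i := by
  rw [sideWord, if_pos (by omega), if_neg (by omega), if_pos (by omega),
    show (4 * i + 1) / 4 = i by omega]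

theorem sideWord_a' (hi : i < h) : sideWord h a b c d (4 * i + 2) = (a i)⁻¹ := by
  rw [sideWord, if_pos (by omega), if_neg (by omega), if_neg (by omega), if_pos (by omega),
    show (4 * i + 2) / 4 = i by omega]

theorem sideWord_b' (hi : i < h) : sideWord h a b c d (4 * i + 3) = (b i)⁻¹ := by
  rw [sideWord, if_pos (by omega), if_neg (by omega), if_neg (by omega), if_neg (by omega),
    show (4 * i + 3) / 4 = i by omega]

theorem sideWord_c : sideWord h a b c d (4 * h + 3 * i) = c i := by
  rw [sideWord, if_neg (by omega), if_pos (by omega), show (4 * h + 3 * i - 4 * h) / 3 = i by omega]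

theorem sideWord_d : sideWord h a b c d (4 * h + 3 * i + 1) = d i := by
  rw [sideWord, if_neg (by omega), if_neg (by omega), if_pos (by omega),
    show (4 * h + 3 * i + 1 - 4 * h) / 3 = i by omega]

theorem sideWord_c' : sideWord h a b c d (4 * h + 3 * i + 2) = (c i)⁻¹ := by
  rw [sideWord, if_neg (by omega), if_neg (by omega), if_neg (by omega),
    show (4 * h + 3 * i + 2 - 4 * h) / 3 = i by omega]

theorem wordProd_sideWord (n : ℕ) : wordProd (sideWord h a b c d) (4 * h + 3 * n) =
    wordProd (fun i => ⁅a i, b i⁆) h * wordProd (fun l => c l * d l * (c l)⁻¹) n := by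
  rw [wordProd_sides]
  · congr 1
    · exact wordProd_congr fun i hi => by rw [sideWord_a _ _ _ _ hi, sideWord_b _ _ _ _ hi]
    · exact wordProd_congr fun i hi => by rw [sideWord_c, sideWord_d]
  · exact fun i hi => by rw [sideWord_a _ _ _ _ hi, sideWord_a' _ _ _ _ hi]
  · exact fun i hi => by rw [sideWord_b _ _ _ _ hi, sideWord_b' _ _ _ _ hi]
  · exact fun i hi => by rw [sideWord_c, sideWord_c']

/-- The holonomy along the sides of the two polygons of the double. -/
def DoubleData.sideHolonomy {D : DoubleData G} {m : ℕ} (hD : D.IsDouble h m) (hd : D.d₀ = D.d₁) :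
    SideHolonomy h (m + 1) Bool G where
  u k := cond k (sideWord h D.a₁ D.b₁ D.c₁ D.d₁) (sideWord h D.a₀ D.b₀ D.c₀ D.d₀)
  handleA k i hi := by cases k <;> simp [sideWord_a, sideWord_a', hi]
  handleB k i hi := by cases k <;> simp [sideWord_b, sideWord_b', hi]
  hole k l hl := by cases k <;> simp [sideWord_c, sideWord_c']
  free k k' l hl := by cases k <;> cases k' <;> simp [sideWord_d, hd]
  close k := by
    cases k
    · exact (wordProd_sideWord _ _ _ _ _).trans hD.rel₀
    · exact (wordProd_sideWord _ _ _ _ _).trans hD.rel₁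

end SideWord
end

end

section

open Topology commutatorElement CategoryTheory
noncomputable section

/-! # From the fundamental groupoid to the fundamental group -/

section LoopOf

variable {Z : Type*} [TopologicalSpace Z] {z₀ : Z}

/-- The class of a path in the fundamental groupoid. -/
def pathClass (c : C(unitInterval, Z)) :
    FundamentalGroupoid.mk (c 0) ⟶ FundamentalGroupoid.mk (c 1) :=
  Path.Homotopic.Quotient.mk ⟨c, rfl, rfl⟩

/-- A choice `τ` of path classes from the base point turns every path into a loop; the
multiplication of the opposite of the fundamental group is concatenation. -/
def loopOf (τ : ∀ z, FundamentalGroupoid.mk z₀ ⟶ FundamentalGroupoid.mk z)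
    (c : C(unitInterval, Z)) : (FundamentalGroup Z z₀)ᵐᵒᵖ :=
  MulOpposite.op (τ (c 0) ≫ pathClass c ≫ Groupoid.inv (τ (c 1)))

variable (τ : ∀ z, FundamentalGroupoid.mk z₀ ⟶ FundamentalGroupoid.mk z)

/-- In a simply connected space the class of a path depends only on its ends, so the associated
loops form a coboundary. Every relation below comes from this, applied to an interval, a square or a
disc. -/
theorem loopOf_comp {S : Type*} [TopologicalSpace S] [SimplyConnectedSpace S] (f : C(S, Z)) :
    ∃ V : S → (FundamentalGroup Z z₀)ᵐᵒᵖ,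
      ∀ c : C(unitInterval, S), loopOf τ (f.comp c) = (V (c 0))⁻¹ * V (c 1) := by
  obtain ⟨s₀⟩ := (inferInstance : Nonempty S)
  let p : ∀ s, FundamentalGroupoid.mk (f s₀) ⟶ FundamentalGroupoid.mk (f s) := fun s =>
    Path.Homotopic.Quotient.mk ((PathConnectedSpace.somePath s₀ s).map f.continuous)
  refine ⟨fun s => MulOpposite.op (τ (f s₀) ≫ p s ≫ Groupoid.inv (τ (f s))), fun c => ?_⟩
  rw [eq_inv_mul_iff_mul_eq]
  have hp : p (c 0) ≫ pathClass (f.comp c) = p (c 1) := by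
    let c' : Path (c 0) (c 1) := ⟨c, rfl, rfl⟩
    have h1 := SimplyConnectedSpace.paths_homotopic
      ((PathConnectedSpace.somePath s₀ (c 0)).trans c') (PathConnectedSpace.somePath s₀ (c 1))
    have h2 : Path.Homotopic.Quotient.mk (((PathConnectedSpace.somePath s₀ (c 0)).trans c').map
        f.continuous) = p (c 1) := Path.Homotopic.Quotient.eq.2 (h1.map f)
    refine Eq.trans ?_ h2
    rw [Path.map_trans]
    rfl
  refine congrArg MulOpposite.op ?_
  change (τ (f s₀) ≫ p (c 0) ≫ Groupoid.inv (τ (f (c 0)))) ≫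
    (τ (f (c 0)) ≫ pathClass (f.comp c) ≫ Groupoid.inv (τ (f (c 1)))) = _
  have h3 : Groupoid.inv (τ (f (c 0))) ≫ (τ (f (c 0)) ≫ pathClass (f.comp c) ≫
      Groupoid.inv (τ (f (c 1)))) = pathClass (f.comp c) ≫ Groupoid.inv (τ (f (c 1))) := by
    rw [← Category.assoc, Groupoid.inv_comp]
    exact Category.id_comp _
  rw [Category.assoc, Category.assoc, h3, ← Category.assoc (p (c 0))]
  exact congrArg (fun x => τ (f s₀) ≫ x ≫ Groupoid.inv (τ (f (c 1)))) hp

instance : ContractibleSpace unitInterval :=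
  (convex_Icc (0 : ℝ) 1).contractibleSpace ⟨0, by simp⟩

theorem loopOf_symm {c c' : C(unitInterval, Z)} (h : ∀ t, c' t = c (unitInterval.symm t)) :
    loopOf τ c' = (loopOf τ c)⁻¹ := by
  obtain ⟨V, hV⟩ := loopOf_comp τ c
  have h1 := hV (ContinuousMap.id _)
  have h2 := hV ⟨unitInterval.symm, unitInterval.continuous_symm⟩
  rw [ContinuousMap.comp_id] at h1
  rw [show c' = c.comp ⟨unitInterval.symm, unitInterval.continuous_symm⟩ from
    ContinuousMap.ext h, h2, h1]
  simp

theorem loopOf_square (f : C(unitInterval × unitInterval, Z)) {l r b t : C(unitInterval, Z)}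
    (hl : ∀ s, l s = f (0, s)) (hr : ∀ s, r s = f (1, s)) (hb : ∀ s, b s = f (s, 0))
    (ht : ∀ s, t s = f (s, 1)) : loopOf τ b * loopOf τ r = loopOf τ l * loopOf τ t := by
  obtain ⟨V, hV⟩ := loopOf_comp τ f
  have h1 := hV ⟨fun s => (0, s), by fun_prop⟩
  have h2 := hV ⟨fun s => (1, s), by fun_prop⟩
  have h3 := hV ⟨fun s => (s, 0), by fun_prop⟩
  have h4 := hV ⟨fun s => (s, 1), by fun_prop⟩
  rw [show l = f.comp ⟨fun s => (0, s), by fun_prop⟩ from ContinuousMap.ext hl,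
    show r = f.comp ⟨fun s => (1, s), by fun_prop⟩ from ContinuousMap.ext hr,
    show b = f.comp ⟨fun s => (s, 0), by fun_prop⟩ from ContinuousMap.ext hb,
    show t = f.comp ⟨fun s => (s, 1), by fun_prop⟩ from ContinuousMap.ext ht, h1, h2, h3, h4]
  simp

instance : ContractibleSpace ClosedDisc :=
  (convex_closedBall (0 : ℂ) 1).contractibleSpace ⟨0, by simp⟩

instance : LocallyPathConnectedSpace ClosedDisc :=
  (convex_closedBall (0 : ℂ) 1).locallyPathConnectedSpace

/-- A side of the polygon. -/
def side (N j : ℕ) : C(unitInterval, ClosedDisc) := ⟨arcPoint N j, continuous_arcPoint N j⟩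

/-- The coboundary telescopes around the circle and returns to its starting corner. -/
theorem wordProd_loopOf_side {N : ℕ} (hN : 0 < N) (f : C(ClosedDisc, Z)) :
    wordProd (fun j => loopOf τ (f.comp (side N j))) N = 1 := by
  obtain ⟨V, hV⟩ := loopOf_comp τ f
  have : ∀ n, wordProd (fun j => loopOf τ (f.comp (side N j))) n =
      (V (arcPoint N 0 0))⁻¹ * V (arcPoint N n 0) := by
    intro n
    induction n with
    | zero => simp [wordProd]
    | succ n ih =>
      rw [wordProd, ih, hV]
      change _ * ((V (arcPoint N n 0))⁻¹ * V (arcPoint N n 1)) = _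
      rw [arcPoint_one]
      group
  rw [this, arcPoint_self hN, inv_mul_cancel]

end LoopOf

/-! # Paths with controlled lifts -/

section Holonomy

variable {Z B E G : Type*} [TopologicalSpace Z] [TopologicalSpace B] [TopologicalSpace E] [Group G]
  (Q : C(Z, B)) (q : C(E, B)) (F : Z → G → E)

/-- A path class has holonomy `u` if for all `g` it has a representative whose image in `B` lifts
to a path in `E` from the `g`-th point over its source to the `g * u`-th point over its target. -/
def HasHolonomy {x y : Z} (p : FundamentalGroupoid.mk x ⟶ FundamentalGroupoid.mk y) (u : G) :
    Prop :=
  ∀ g, ∃ γ : Path x y, Path.Homotopic.Quotient.mk γ = p ∧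
    ∃ η : Path (F x g) (F y (g * u)), ∀ t, Q (γ t) = q (η t)

variable {Q q F}

theorem HasHolonomy.id {x : Z} (hx : ∀ g, Q x = q (F x g)) :
    HasHolonomy Q q F (𝟙 (FundamentalGroupoid.mk x)) 1 := fun g =>
  ⟨Path.refl x, rfl, (Path.refl _).cast rfl (by rw [mul_one]), fun _ => hx g⟩

theorem HasHolonomy.comp {x y z : Z} {p : FundamentalGroupoid.mk x ⟶ FundamentalGroupoid.mk y}
    {p' : FundamentalGroupoid.mk y ⟶ FundamentalGroupoid.mk z} {u u' : G}
    (h : HasHolonomy Q q F p u) (h' : HasHolonomy Q q F p' u') :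
    HasHolonomy Q q F (p ≫ p') (u * u') := by
  intro g
  obtain ⟨γ, rfl, η, hη⟩ := h g
  obtain ⟨γ', rfl, η', hη'⟩ := h' (g * u)
  refine ⟨γ.trans γ', rfl, (η.trans η').cast rfl (by rw [mul_assoc]), fun t => ?_⟩
  rw [Path.cast_coe, Path.trans_apply, Path.trans_apply]
  split_ifs
  exacts [hη _, hη' _]

theorem HasHolonomy.inv {x y : Z} {p : FundamentalGroupoid.mk x ⟶ FundamentalGroupoid.mk y}
    {u : G} (h : HasHolonomy Q q F p u) : HasHolonomy Q q F (Groupoid.inv p) u⁻¹ := by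
  intro g
  obtain ⟨γ, rfl, η, hη⟩ := h (g * u⁻¹)
  exact ⟨γ.symm, rfl, η.symm.cast (by rw [inv_mul_cancel_right]) rfl, fun t => hη _⟩

variable (Q q F) in
/-- The pairs of a loop and its holonomy. -/
def holonomyGraph (z₀ : Z) (hz₀ : ∀ g, Q z₀ = q (F z₀ g)) :
    Subgroup ((FundamentalGroup Z z₀)ᵐᵒᵖ × G) where
  carrier := {p | HasHolonomy Q q F p.1.unop p.2}
  one_mem' := HasHolonomy.id hz₀
  mul_mem' h h' := HasHolonomy.comp h h'
  inv_mem' h := HasHolonomy.inv h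

/-- A path is null-homotopic relative to its end points. -/
def NullPath {X : Type*} [TopologicalSpace X] (c : C(unitInterval, X)) : Prop :=
  c.HomotopicRel (.const _ (c 0)) {0, 1}

theorem NullPath.eq {X : Type*} [TopologicalSpace X] {c : C(unitInterval, X)} (h : NullPath c) :
    c 1 = c 0 := by
  obtain ⟨H⟩ := h
  rw [← H.apply_zero 1, H.eq_fst 0 (by simp), H.fst_eq_snd (by simp)]
  rfl

theorem NullPath.comp {X Y : Type*} [TopologicalSpace X] [TopologicalSpace Y]
    {c : C(unitInterval, X)} (h : NullPath c) (f : C(X, Y)) : NullPath (f.comp c) := by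
  obtain ⟨H⟩ := h
  exact ⟨H.compContinuousMap f⟩

theorem NullPath.of_isCoveringMap {X Y : Type*} [TopologicalSpace X] [TopologicalSpace Y]
    {p : C(X, Y)} (hp : IsCoveringMap p) {c : C(unitInterval, X)} (h : NullPath (p.comp c)) :
    NullPath c :=
  (hp.homotopicRel_iff_comp (f₀ := c) (f₁ := .const _ (c 0)) (S := {0, 1})
    ⟨0, by simp, rfl⟩).2 h

/-- A loop without homotopy has no holonomy. -/
theorem injective_fst_holonomyGraph {z₀ : Z} {hz₀ : ∀ g, Q z₀ = q (F z₀ g)}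
    (hF : Function.Injective (F z₀))
    (hq : ∀ c : C(unitInterval, E), NullPath (q.comp c) → NullPath c) :
    Function.Injective
      ((MonoidHom.fst _ _).comp (holonomyGraph Q q F z₀ hz₀).subtype) := by
  rw [injective_iff_map_eq_one]
  rintro ⟨⟨P, u⟩, hP⟩ h1
  obtain rfl : P = 1 := h1
  obtain ⟨γ, hγ, η, hη⟩ := hP 1
  have hγ' : γ.Homotopic (Path.refl z₀) := Path.Homotopic.Quotient.exact hγ
  have h2 : NullPath (γ : C(unitInterval, Z)) := by
    unfold NullPath
    have : ContinuousMap.const unitInterval ((γ : C(unitInterval, Z)) 0) =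
        (Path.refl z₀ : C(unitInterval, Z)) := by
      ext t
      simp
    rw [this]
    exact hγ'
  have h3 : NullPath (q.comp (η : C(unitInterval, E))) := by
    have : q.comp (η : C(unitInterval, E)) = Q.comp (γ : C(unitInterval, Z)) :=
      ContinuousMap.ext fun t => (hη t).symm
    rw [this]
    exact h2.comp Q
  have h4 := (hq _ h3).eq
  have h5 : F z₀ (1 * u) = F z₀ 1 := by simpa using h4
  have h6 : u = 1 := by simpa using hF h5
  subst h6
  rfl

end Holonomy
end

end

section

open Topology commutatorElement CategoryTheory
noncomputable section

/-! # Surface subgroups of doubles of mapping tori -/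

theorem Double.pathConnectedSpace {X : Type} [TopologicalSpace X] [PathConnectedSpace X]
    {A : Set X} (hA : A.Nonempty) : PathConnectedSpace (Double X A) := by
  obtain ⟨a, ha⟩ := hA
  have h1 : ∀ v x y, Joined (doubleVertex A v x) (doubleVertex A v y) := fun v x y =>
    ⟨(PathConnectedSpace.somePath x y).map (doubleVertex A v).continuous⟩
  have h2 : ∀ (e : ConnectedComponents A) (w : ComponentSpace A e) (t : unitInterval),
      Joined (doubleVertex A false w.1.1) (doubleTube e (w, t)) := by
    intro e w t
    exact ⟨⟨⟨fun s => doubleTube e (w, s * t), by fun_prop⟩, by simp [doubleTube_zero], by simp⟩⟩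
  let w : ComponentSpace A ((⟨a, ha⟩ : A) : ConnectedComponents A) := ⟨⟨a, ha⟩, rfl⟩
  have h3 : Joined (doubleVertex A false a) (doubleVertex A true a) := by
    have := h2 _ w 1
    rwa [doubleTube_one] at this
  have h4 : ∀ z, Joined (doubleVertex A false a) z := by
    intro z
    induction z using Double.induction with
    | hv v x =>
      cases v
      · exact h1 _ _ _
      · exact h3.trans (h1 _ _ _)
    | he e x => exact (h1 _ _ _).trans (h2 e x.1 x.2)
  exact ⟨⟨doubleVertex A false a⟩, fun x y => (h4 x).symm.trans (h4 y)⟩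

/-! ## Vertices of the polygon -/

section Vertices

variable {h b : ℕ}

theorem surfaceMk_handleA {i : ℕ} (hi : i < h) (t : unitInterval) :
    surfaceMk h b (side (4 * h + 3 * b) (4 * i + 2) t) =
      surfaceMk h b (side (4 * h + 3 * b) (4 * i) (unitInterval.symm t)) := by
  have := Quot.sound (ArcGlue.handleA (b := b) i hi (unitInterval.symm t))
  rw [unitInterval.symm_symm] at this
  exact this.symm

theorem surfaceMk_handleB {i : ℕ} (hi : i < h) (t : unitInterval) :
    surfaceMk h b (side (4 * h + 3 * b) (4 * i + 3) t) =
      surfaceMk h b (side (4 * h + 3 * b) (4 * i + 1) (unitInterval.symm t)) := by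
  have := Quot.sound (ArcGlue.handleB (b := b) i hi (unitInterval.symm t))
  rw [unitInterval.symm_symm] at this
  exact this.symm

theorem surfaceMk_hole {l : ℕ} (hl : l < b) (t : unitInterval) :
    surfaceMk h b (side (4 * h + 3 * b) (4 * h + 3 * l + 2) t) =
      surfaceMk h b (side (4 * h + 3 * b) (4 * h + 3 * l) (unitInterval.symm t)) := by
  have := Quot.sound (ArcGlue.hole (h := h) l hl (unitInterval.symm t))
  rw [unitInterval.symm_symm] at this
  exact this.symm

theorem side_one (N j : ℕ) : side N j 1 = side N (j + 1) 0 := arcPoint_one N j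

/-- The pattern `a b a⁻¹ b⁻¹` identifies all five corners of its four sides. -/
theorem surfaceMk_vertex_handle {i : ℕ} (hi : i < h) :
    (∀ r < 4, surfaceMk h b (side (4 * h + 3 * b) (4 * i + r) 0) =
      surfaceMk h b (side (4 * h + 3 * b) (4 * i) 0)) ∧
    surfaceMk h b (side (4 * h + 3 * b) (4 * (i + 1)) 0) =
      surfaceMk h b (side (4 * h + 3 * b) (4 * i) 0) := by
  have a0 := surfaceMk_handleA (b := b) hi 0
  have a1 := surfaceMk_handleA (b := b) hi 1
  have b0 := surfaceMk_handleB (b := b) hi 0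
  have b1 := surfaceMk_handleB (b := b) hi 1
  simp only [unitInterval.symm_zero, unitInterval.symm_one, side_one] at a0 a1 b0 b1
  have h1 := a0.symm.trans (b0.symm.trans a1)
  refine ⟨fun r hr => ?_, b1.trans h1⟩
  interval_cases r
  exacts [rfl, h1, b0.symm.trans a1, a1]

theorem surfaceMk_vertex {j : ℕ} (hj : j ≤ 4 * h) :
    surfaceMk h b (side (4 * h + 3 * b) j 0) = surfaceMk h b (side (4 * h + 3 * b) 0 0) := by
  have h1 : ∀ i ≤ h, surfaceMk h b (side (4 * h + 3 * b) (4 * i) 0) =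
      surfaceMk h b (side (4 * h + 3 * b) 0 0) := by
    intro i hi
    induction i with
    | zero => rfl
    | succ i ih => rw [(surfaceMk_vertex_handle (by omega)).2, ih (by omega)]
  rcases hj.lt_or_eq with h2 | h2
  · obtain ⟨i, r, hr, rfl⟩ : ∃ i r, r < 4 ∧ j = 4 * i + r := ⟨j / 4, j % 4, by omega, by omega⟩
    rw [(surfaceMk_vertex_handle (by omega)).1 r hr, h1 i (by omega)]
  · rw [h2, h1 h le_rfl]

theorem surfaceMk_boundary_vertex {l : ℕ} (hl : l < b) :
    surfaceMk h b (side (4 * h + 3 * b) (4 * h + 3 * l + 2) 0) =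
      surfaceMk h b (side (4 * h + 3 * b) (4 * h + 3 * l + 1) 0) := by
  rw [surfaceMk_hole hl, unitInterval.symm_zero, side_one]

theorem surfaceMk_hole_vertex {l : ℕ} (hl : l ≤ b) :
    surfaceMk h b (side (4 * h + 3 * b) (4 * h + 3 * l) 0) =
      surfaceMk h b (side (4 * h + 3 * b) 0 0) := by
  induction l with
  | zero => exact surfaceMk_vertex le_rfl
  | succ l ih =>
    have h1 := surfaceMk_hole (h := h) (show l < b by omega) 1
    rw [unitInterval.symm_one, side_one, ih (by omega)] at h1
    exact h1

/-- Every side joins two of the base vertex and the vertices on the boundary circles. -/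
theorem surfaceMk_vertex_cases {P : CompactSurface h b → Prop}
    (h0 : P (surfaceMk h b (side (4 * h + 3 * b) 0 0)))
    (h1 : ∀ l < b, P (surfaceMk h b (side (4 * h + 3 * b) (4 * h + 3 * l + 1) 0)))
    {j : ℕ} (hj : j ≤ 4 * h + 3 * b) : P (surfaceMk h b (side (4 * h + 3 * b) j 0)) := by
  rcases Nat.lt_or_ge (4 * h) j with h2 | h2
  · obtain ⟨l, r, hr, rfl⟩ : ∃ l r, r < 3 ∧ j = 4 * h + 3 * l + r :=
      ⟨(j - 4 * h) / 3, (j - 4 * h) % 3, by omega, by omega⟩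
    interval_cases r
    · rw [add_zero, surfaceMk_hole_vertex (by omega)]
      exact h0
    · exact h1 l (by omega)
    · rw [surfaceMk_boundary_vertex (by omega)]
      exact h1 l (by omega)
  · rw [surfaceMk_vertex h2]
    exact h0

end Vertices

/-! ## The double of a mapping torus -/

section MappingTorusDouble

variable {h b : ℕ} {f : CompactSurface h b ≃ₜ CompactSurface h b}
  (hf : f '' surfaceBoundary h b = surfaceBoundary h b)

/-- The double of the mapping torus of `f` is the mapping torus of the double of `f`. -/
def torusSheet (k : Bool) : C(MappingTorus f, TorusQuotient (multiHomeomorph Bool f hf)) :=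
  ⟨Quot.lift (fun p => torusQuotientMk _ (sheet _ k p.1, (p.2 : ℝ))) (by
    rintro _ _ ⟨x⟩
    exact congrArg (mappingTorusToQuotient (multiHomeomorph Bool f hf))
      (Quot.sound (TorusGlue.glue (sheet _ k x)))),
    continuous_quot_lift _ ((torusQuotientMk _).continuous.comp
      (((sheet _ k).continuous.comp continuous_fst).prodMk
        (continuous_subtype_val.comp continuous_snd)))⟩

theorem torusSheet_mk (k : Bool) (x : CompactSurface h b) (s : unitInterval) :
    torusSheet hf k (Quot.mk _ (x, s)) = torusQuotientMk _ (sheet _ k x, (s : ℝ)) := rfl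

theorem torusSheet_eq (k k' : Bool) {p : MappingTorus f}
    (hp : p ∈ mappingTorusOver f (surfaceBoundary h b)) :
    torusSheet hf k p = torusSheet hf k' p := by
  obtain ⟨x, hx, s, rfl⟩ := hp
  rw [torusSheet_mk, torusSheet_mk, sheet_eq k k' hx]

variable {X : Type} [TopologicalSpace X] {A : Set X} (Φ : X ≃ₜ MappingTorus f)
  (hΦ : Φ '' A = mappingTorusOver f (surfaceBoundary h b))

/-- The fiber over the base point of the circle. -/
def fiberMap : C(CompactSurface h b, X) :=
  ⟨fun x => Φ.symm (Quot.mk _ (x, 0)),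
    Φ.symm.continuous.comp (continuous_quot_mk.comp (by fun_prop))⟩

/-- The double is mapped to a mapping torus of the double of the fiber by collapsing the tubes. -/
def collapse : C(Double X A, TorusQuotient (multiHomeomorph Bool f hf)) :=
  doubleLift (fun k => (torusSheet hf k).comp Φ)
    (fun _ => ⟨fun p => torusSheet hf false (Φ p.1.1.1), by fun_prop⟩)
    (fun _ _ => rfl)
    (fun _ w => torusSheet_eq hf _ _ (hΦ ▸ Set.mem_image_of_mem Φ w.1.2))

theorem collapse_fiberMap (k : Bool) (x : CompactSurface h b) :
    collapse hf Φ hΦ (doubleVertex A k (fiberMap Φ x)) = torusQuotientMk _ (sheet _ k x, 0) := by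
  change torusSheet hf k (Φ (Φ.symm _)) = _
  rw [Φ.apply_symm_apply, torusSheet_mk]
  rfl

theorem fiberMap_mem (hΦ : Φ '' A = mappingTorusOver f (surfaceBoundary h b))
    {x : CompactSurface h b} (hx : x ∈ surfaceBoundary h b) :
    fiberMap Φ x ∈ A := by
  have h1 : (Quot.mk _ (x, 0) : MappingTorus f) ∈ Φ '' A := hΦ ▸ ⟨x, hx, 0, rfl⟩
  obtain ⟨a, ha, h2⟩ := h1
  rw [fiberMap, ContinuousMap.coe_mk, ← h2, Φ.symm_apply_apply]
  exact ha

/-- The square is the annulus that joins the two copies of a boundary circle. Under `collapse` it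
falls onto that circle, so its segments in the direction of the tube become points and carry no
holonomy. -/
theorem exists_tube {l : ℕ} (hl : l < b) : ∃ T : C(unitInterval × unitInterval, Double X A),
    (∀ s, T (s, 0) = doubleVertex A false
      (fiberMap Φ (surfaceMk h b (side (4 * h + 3 * b) (4 * h + 3 * l + 1) s)))) ∧
    (∀ s, T (s, 1) = doubleVertex A true
      (fiberMap Φ (surfaceMk h b (side (4 * h + 3 * b) (4 * h + 3 * l + 1) s)))) ∧
    (∀ t, T (0, t) = T (1, t)) ∧
    ∀ s t, collapse hf Φ hΦ (T (s, t)) = torusQuotientMk _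
      (sheet _ false (surfaceMk h b (side (4 * h + 3 * b) (4 * h + 3 * l + 1) s)), 0) := by
  let w : C(unitInterval, A) := ⟨fun s => ⟨fiberMap Φ (surfaceMk h b
    (side (4 * h + 3 * b) (4 * h + 3 * l + 1) s)), fiberMap_mem Φ hΦ ⟨l, hl, s, rfl⟩⟩, by fun_prop⟩
  -- The arc is connected, hence lies over a single edge of the graph of spaces.
  have hw : ∀ s, (w s : ConnectedComponents A) = w 0 := fun s =>
    ConnectedComponents.coe_eq_coe'.2 ((isPreconnected_range w.continuous).subset_connectedComponent
      ⟨0, rfl⟩ ⟨s, rfl⟩)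
  let W : C(unitInterval, ComponentSpace A (w 0)) := ⟨fun s => ⟨w s, hw s⟩, by fun_prop⟩
  have h01 : w 1 = w 0 := by
    refine Subtype.ext (congrArg (fiberMap Φ) ?_)
    rw [side_one]
    exact surfaceMk_boundary_vertex hl
  refine ⟨(doubleTube (w 0)).comp ⟨fun p => (W p.1, p.2), by fun_prop⟩, fun s => ?_, fun s => ?_,
    fun t => ?_, fun s t => ?_⟩
  · exact doubleTube_zero _ _
  · exact doubleTube_one _ _
  · have : W 1 = W 0 := Subtype.ext h01
    change doubleTube _ (W 0, t) = doubleTube _ (W 1, t)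
    rw [this]
  · rw [← collapse_fiberMap hf Φ hΦ]
    rfl

end MappingTorusDouble
end

end

section

open Topology commutatorElement CategoryTheory
noncomputable section

/-! ## Holonomy in the double of a mapping torus -/

/-- An integer translation between two points of height zero is trivial. -/
theorem torusQuotientMk_zero_injective {S : Type} [TopologicalSpace S] (F : S ≃ₜ S) {x y : S}
    (hxy : torusQuotientMk F (x, 0) = torusQuotientMk F (y, 0)) : x = y := by
  obtain ⟨n, hn⟩ := Quotient.exact hxy
  have h1 : ((F ^ n.toAdd) y, (0 : ℝ) - (n.toAdd : ℤ)) = (x, (0 : ℝ)) := hn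
  have h2 : n.toAdd = 0 := by
    have := (Prod.ext_iff.1 h1).2
    simpa using this
  rw [h2] at h1
  exact (Prod.ext_iff.1 h1).1.symm

section MappingTorusDouble

variable {h b : ℕ} {f : CompactSurface h b ≃ₜ CompactSurface h b}
  (hf : f '' surfaceBoundary h b = surfaceBoundary h b)
  {X : Type} [TopologicalSpace X] {A : Set X} (Φ : X ≃ₜ MappingTorus f)
  (hΦ : Φ '' A = mappingTorusOver f (surfaceBoundary h b))
  {G : Type} [Group G] (H : SideHolonomy h b Bool G)

namespace SideHolonomy

/-- The points of the covering of the double of the surface. -/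
def multiPt (g : G) : MultiDouble Bool (surfaceBoundary h b) → H.Cover :=
  Quot.lift (fun p => H.coverPt p.1 g p.2) (by
    rintro _ _ ⟨k, k', x, hx⟩
    exact H.coverPt_boundary k k' g hx)

/-- The covering of the fiber of the mapping torus of the double of the surface. -/
def toTorus : C(H.Cover, TorusQuotient (multiHomeomorph Bool f hf)) :=
  ⟨fun e => torusQuotientMk _ (H.proj e, 0),
    (torusQuotientMk _).continuous.comp (H.proj.continuous.prodMk continuous_const)⟩

/-- `toTorus` is not a covering, but it factors as a covering, the inclusion at height zero into the
product with the line, and a covering. Coverings reflect null-homotopies and the inclusion has a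
retraction. -/
theorem nullPath_of_toTorus {c : C(unitInterval, H.Cover)} (hc : NullPath ((H.toTorus hf).comp c)) :
    NullPath c := by
  let i : C(MultiDouble Bool (surfaceBoundary h b), TorusCover (multiHomeomorph Bool f hf)) :=
    ⟨fun x => (x, 0), by
      change Continuous fun x : MultiDouble Bool (surfaceBoundary h b) => (x, (0 : ℝ))
      fun_prop⟩
  let r : C(TorusCover (multiHomeomorph Bool f hf), MultiDouble Bool (surfaceBoundary h b)) :=
    ⟨fun x => x.1, continuous_fst⟩
  have h1 : NullPath (i.comp (H.proj.comp c)) :=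
    NullPath.of_isCoveringMap (isQuotientCoveringMap_torusQuotientMk _).isCoveringMap hc
  exact NullPath.of_isCoveringMap H.isQuotientCoveringMap_proj.isCoveringMap (h1.comp r)

open Classical in
/-- The points of the covering over the points of the double of the mapping torus that are mapped to
the fiber. -/
def liftPt (z : Double X A) (g : G) : H.Cover :=
  if hy : ∃ y, collapse hf Φ hΦ z = torusQuotientMk _ (y, 0) then H.multiPt g hy.choose
  -- An arbitrary value: only points over the fiber matter.
  else H.coverPt false g (surfaceMk h b 0)

theorem liftPt_eq {z : Double X A} {y} (hy : collapse hf Φ hΦ z = torusQuotientMk _ (y, 0))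
    (g : G) : H.liftPt hf Φ hΦ z g = H.multiPt g y := by
  have hy' : ∃ y, collapse hf Φ hΦ z = torusQuotientMk _ (y, 0) := ⟨y, hy⟩
  rw [liftPt, dif_pos hy']
  rw [torusQuotientMk_zero_injective _ (hy'.choose_spec.symm.trans hy)]

theorem toTorus_multiPt (g : G) (y) :
    H.toTorus hf (H.multiPt g y) = torusQuotientMk (multiHomeomorph Bool f hf) (y, 0) := by
  induction y using MultiDouble.induction with | h k x => ?_
  exact congrArg (fun y => torusQuotientMk _ (y, 0)) (H.proj_coverPt k g x)

/-- The holonomy of paths in the double of the mapping torus. -/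
abbrev Hol {x y : Double X A} (p : FundamentalGroupoid.mk x ⟶ FundamentalGroupoid.mk y) (u : G) :
    Prop :=
  HasHolonomy (collapse hf Φ hΦ) (H.toTorus hf) (H.liftPt hf Φ hΦ) p u

/-- A side of a polygon as a path in the double of the mapping torus. -/
def sidePath (_ : SideHolonomy h b Bool G) (A : Set X) (k : Bool) (j : ℕ) :
    C(unitInterval, Double X A) :=
  ((doubleVertex A k).comp ((fiberMap Φ).comp (surfaceMk h b))).comp (side (4 * h + 3 * b) j)

theorem hol_sidePath (k : Bool) {j : ℕ} (hj : j < 4 * h + 3 * b) :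
    H.Hol hf Φ hΦ (pathClass (H.sidePath Φ A k j)) (H.u k j) := by
  intro g
  have h1 : ∀ (s : unitInterval) (g : G), H.liftPt hf Φ hΦ (H.sidePath Φ A k j s) g =
      H.coverPt k g (surfaceMk h b (arcPoint (4 * h + 3 * b) j s)) := fun s g =>
    H.liftPt_eq hf Φ hΦ (collapse_fiberMap hf Φ hΦ k _) g
  refine ⟨⟨H.sidePath Φ A k j, rfl, rfl⟩, rfl, (H.sideLift k g hj).cast (h1 0 g) (h1 1 _),
    fun t => ?_⟩
  exact collapse_fiberMap hf Φ hΦ k _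

theorem hol_const {c : C(unitInterval, Double X A)} {y}
    (hc : ∀ t, collapse hf Φ hΦ (c t) = torusQuotientMk _ (y, 0)) :
    H.Hol hf Φ hΦ (pathClass c) 1 := by
  intro g
  have h1 : ∀ t g, H.liftPt hf Φ hΦ (c t) g = H.multiPt g y := fun t g =>
    H.liftPt_eq hf Φ hΦ (hc t) g
  refine ⟨⟨c, rfl, rfl⟩, rfl, (Path.refl (H.multiPt g y)).cast (h1 0 g)
    ((h1 1 _).trans (by rw [mul_one])), fun t => ?_⟩
  exact (hc t).trans (H.toTorus_multiPt hf g y).symm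

/-- The base point of the double of the mapping torus. -/
def basePt (_ : SideHolonomy h b Bool G) (A : Set X) : Double X A :=
  doubleVertex A false (fiberMap Φ (surfaceMk h b (side (4 * h + 3 * b) 0 0)))

/-- The points that can be reached from the base point without holonomy. -/
def Good (z : Double X A) : Prop :=
  ∃ p : FundamentalGroupoid.mk (H.basePt Φ A) ⟶ FundamentalGroupoid.mk z, H.Hol hf Φ hΦ p 1

variable {hf Φ hΦ H}

theorem Good.of_path {c : C(unitInterval, Double X A)} (hc : H.Hol hf Φ hΦ (pathClass c) 1)
    (h0 : H.Good hf Φ hΦ (c 0)) : H.Good hf Φ hΦ (c 1) := by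
  obtain ⟨p, hp⟩ := h0
  exact ⟨p ≫ pathClass c, by simpa using hp.comp hc⟩

theorem Good.of_path_symm {c : C(unitInterval, Double X A)} (hc : H.Hol hf Φ hΦ (pathClass c) 1)
    (h1 : H.Good hf Φ hΦ (c 1)) : H.Good hf Φ hΦ (c 0) := by
  obtain ⟨p, hp⟩ := h1
  exact ⟨p ≫ Groupoid.inv (pathClass c), by simpa using hp.comp hc.inv⟩

variable (hf Φ hΦ H) in
theorem collapse_basePt (g : G) :
    collapse hf Φ hΦ (H.basePt Φ A) = H.toTorus hf (H.liftPt hf Φ hΦ (H.basePt Φ A) g) := by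
  rw [basePt, H.liftPt_eq hf Φ hΦ (collapse_fiberMap hf Φ hΦ false _), toTorus_multiPt]
  exact collapse_fiberMap hf Φ hΦ false _

theorem good_basePt : H.Good hf Φ hΦ (H.basePt Φ A) :=
  ⟨𝟙 _, HasHolonomy.id (H.collapse_basePt hf Φ hΦ)⟩

variable (hf Φ hΦ H) in
open Classical in
/-- A choice of paths from the base point. -/
def tau [PathConnectedSpace (Double X A)] (z : Double X A) :
    FundamentalGroupoid.mk (H.basePt Φ A) ⟶ FundamentalGroupoid.mk z :=
  if hz : H.Good hf Φ hΦ z then hz.choose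
  -- An arbitrary path is enough here: membership in the holonomy graph is only claimed for paths
  -- with good ends.
  else Path.Homotopic.Quotient.mk (PathConnectedSpace.somePath _ _)

theorem hol_tau [PathConnectedSpace (Double X A)] {z : Double X A} (hz : H.Good hf Φ hΦ z) :
    H.Hol hf Φ hΦ (H.tau hf Φ hΦ z) 1 := by
  rw [tau, dif_pos hz]
  exact hz.choose_spec

theorem mem_holonomyGraph [PathConnectedSpace (Double X A)] {c : C(unitInterval, Double X A)}
    {u : G} (hc : H.Hol hf Φ hΦ (pathClass c) u) (h0 : H.Good hf Φ hΦ (c 0)) (h1 : H.Good hf Φ hΦ (c 1)) :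
    (loopOf (H.tau hf Φ hΦ) c, u) ∈ holonomyGraph (collapse hf Φ hΦ) (H.toTorus hf)
      (H.liftPt hf Φ hΦ) (H.basePt Φ A) (H.collapse_basePt hf Φ hΦ) := by
  have h2 := (hol_tau h0).comp (hc.comp (hol_tau h1).inv)
  rw [inv_one, mul_one, one_mul] at h2
  exact h2

end SideHolonomy

end MappingTorusDouble

/-- The sides of the two polygons and the tubes, closed up by the paths `tau` without holonomy,
satisfy the relations of the double of the fiber, because polygons and tubes are images of discs and
squares. Their holonomies are the corresponding elements of the surface group itself, so
`SurfaceGroup.exists_injective` applies. -/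
theorem exists_injective_surfaceGroup_double {h m : ℕ}
    {f : CompactSurface h (m + 1) ≃ₜ CompactSurface h (m + 1)}
    (hf : f '' surfaceBoundary h (m + 1) = surfaceBoundary h (m + 1))
    {X : Type} [TopologicalSpace X] {A : Set X} (Φ : X ≃ₜ MappingTorus f)
    (hΦ : Φ '' A = mappingTorusOver f (surfaceBoundary h (m + 1)))
    [PathConnectedSpace X] : ∃ z : Double X A,
      ∃ φ : SurfaceGroup (h + m + h) →* FundamentalGroup (Double X A) z, Function.Injective φ := by
  let H : SideHolonomy h (m + 1) Bool (SurfaceGroup (h + m + h)) :=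
    DoubleData.sideHolonomy (SurfaceGroup.doubleData_isDouble h m) rfl
  have : PathConnectedSpace (Double X A) :=
    Double.pathConnectedSpace ⟨_, fiberMap_mem Φ hΦ ⟨0, by omega, 0, rfl⟩⟩
  have : Nonempty C(unitInterval × unitInterval, Double X A) := ⟨.const _ (H.basePt Φ A)⟩
  choose! T hT0 hT1 hT hTc using fun (l : ℕ) (hl : l < m + 1) => exists_tube hf Φ hΦ hl
  let t : ℕ → C(unitInterval, Double X A) := fun l => (T l).comp ⟨fun s => (0, s), by fun_prop⟩
  have htube : ∀ l < m + 1, H.Hol hf Φ hΦ (pathClass (t l)) 1 := fun l hl =>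
    H.hol_const hf Φ hΦ fun s => hTc l hl 0 s
  have hc : ∀ l < m + 1, H.u false (4 * h + 3 * l) = 1 := fun l hl => sideWord_c _ _ _ _
  have hcm : H.u true (4 * h + 3 * m) = 1 :=
    (sideWord_c _ _ _ _).trans (if_neg (lt_irrefl m))
  -- all vertices are good
  have hd0 : ∀ l < m + 1, H.Good hf Φ hΦ (doubleVertex A false (fiberMap Φ
      (surfaceMk h (m + 1) (side (4 * h + 3 * (m + 1)) (4 * h + 3 * l + 1) 0)))) := by
    intro l hl
    rw [← side_one]
    have h1 := H.hol_sidePath hf Φ hΦ false (show 4 * h + 3 * l < _ by omega)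
    rw [hc l hl] at h1
    refine SideHolonomy.Good.of_path h1 ?_
    change H.Good hf Φ hΦ (doubleVertex A false (fiberMap Φ (surfaceMk h (m + 1) _)))
    have := SideHolonomy.good_basePt (H := H) (hf := hf) (hΦ := hΦ)
    rwa [SideHolonomy.basePt, ← surfaceMk_hole_vertex (show l ≤ m + 1 by omega)] at this
  have hd1 : ∀ l < m + 1, H.Good hf Φ hΦ (doubleVertex A true (fiberMap Φ
      (surfaceMk h (m + 1) (side (4 * h + 3 * (m + 1)) (4 * h + 3 * l + 1) 0)))) := by
    intro l hl
    rw [← hT1 l hl]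
    refine SideHolonomy.Good.of_path (htube l hl) ?_
    change H.Good hf Φ hΦ (T l (0, 0))
    rw [hT0 l hl]
    exact hd0 l hl
  -- The base vertex of the second polygon is reached through the last tube, since the last `c₁` is
  -- chosen trivial.
  have hbase1 : H.Good hf Φ hΦ (doubleVertex A true (fiberMap Φ
      (surfaceMk h (m + 1) (side (4 * h + 3 * (m + 1)) 0 0)))) := by
    rw [← surfaceMk_hole_vertex (show m ≤ m + 1 by omega)]
    have h1 := H.hol_sidePath hf Φ hΦ true (show 4 * h + 3 * m < _ by omega)
    rw [hcm] at h1
    refine SideHolonomy.Good.of_path_symm h1 ?_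
    change H.Good hf Φ hΦ (doubleVertex A true (fiberMap Φ (surfaceMk h (m + 1) _)))
    rw [side_one]
    exact hd1 m (by omega)
  have hgood : ∀ k, ∀ j ≤ 4 * h + 3 * (m + 1), H.Good hf Φ hΦ (doubleVertex A k (fiberMap Φ
      (surfaceMk h (m + 1) (side (4 * h + 3 * (m + 1)) j 0)))) := by
    intro k j hj
    cases k
    · exact surfaceMk_vertex_cases (P := fun x => H.Good hf Φ hΦ (doubleVertex A false
        (fiberMap Φ x))) SideHolonomy.good_basePt hd0 hj
    · exact surfaceMk_vertex_cases (P := fun x => H.Good hf Φ hΦ (doubleVertex A true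
        (fiberMap Φ x))) hbase1 hd1 hj
  let U : Bool → ℕ → (FundamentalGroup (Double X A) (H.basePt Φ A))ᵐᵒᵖ := fun k j =>
    loopOf (H.tau hf Φ hΦ) (H.sidePath Φ A k j)
  let S := holonomyGraph (collapse hf Φ hΦ) (H.toTorus hf)
      (H.liftPt hf Φ hΦ) (H.basePt Φ A) (H.collapse_basePt hf Φ hΦ)
  have hU : ∀ k, ∀ j < 4 * h + 3 * (m + 1), (U k j, H.u k j) ∈ S := by
    intro k j hj
    refine SideHolonomy.mem_holonomyGraph (H.hol_sidePath hf Φ hΦ k hj) (hgood k j hj.le) ?_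
    change H.Good hf Φ hΦ (doubleVertex A k (fiberMap Φ (surfaceMk h (m + 1) _)))
    rw [side_one]
    exact hgood k (j + 1) hj
  let D : DoubleData (FundamentalGroup (Double X A) (H.basePt Φ A))ᵐᵒᵖ :=
    { a₀ := fun i => U false (4 * i)
      b₀ := fun i => U false (4 * i + 1)
      c₀ := fun l => U false (4 * h + 3 * l)
      d₀ := fun l => U false (4 * h + 3 * l + 1)
      a₁ := fun i => U true (4 * i)
      b₁ := fun i => U true (4 * i + 1)
      c₁ := fun l => U true (4 * h + 3 * l)
      d₁ := fun l => U true (4 * h + 3 * l + 1)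
      t := fun l => loopOf (H.tau hf Φ hΦ) (t l) }
  have hrel : ∀ k, wordProd (fun i => ⁅U k (4 * i), U k (4 * i + 1)⁆) h *
      wordProd (fun l => U k (4 * h + 3 * l) * U k (4 * h + 3 * l + 1) *
        (U k (4 * h + 3 * l))⁻¹) (m + 1) = 1 := by
    intro k
    rw [← wordProd_sides]
    · exact wordProd_loopOf_side _ (by omega) _
    · exact fun i hi => loopOf_symm _ fun t => congrArg (fun x => doubleVertex A k (fiberMap Φ x))
        (surfaceMk_handleA hi t)
    · exact fun i hi => loopOf_symm _ fun t => congrArg (fun x => doubleVertex A k (fiberMap Φ x))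
        (surfaceMk_handleB hi t)
    · exact fun l hl => loopOf_symm _ fun t => congrArg (fun x => doubleVertex A k (fiberMap Φ x))
        (surfaceMk_hole hl t)
  have hD : D.IsDouble h m := by
    refine ⟨hrel false, hrel true, fun l hl => ?_⟩
    rw [eq_mul_inv_iff_mul_eq]
    exact loopOf_square _ (T l) (fun s => rfl) (fun s => hT l hl s) (fun s => (hT0 l hl s).symm)
      fun s => (hT1 l hl s).symm
  have hDS : (D.prod (SurfaceGroup.doubleData h m)).MemOn h m S := by
    constructor
    · intro i hi
      have := hU false (4 * i) (by omega)
      rwa [show H.u false (4 * i) = _ from sideWord_a _ _ _ _ hi] at this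
    · intro i hi
      have := hU false (4 * i + 1) (by omega)
      rwa [show H.u false (4 * i + 1) = _ from sideWord_b _ _ _ _ hi] at this
    · intro l hl
      have := hU false (4 * h + 3 * l) (by omega)
      rwa [show H.u false (4 * h + 3 * l) = _ from sideWord_c _ _ _ _] at this
    · intro l hl
      have := hU false (4 * h + 3 * l + 1) (by omega)
      rwa [show H.u false (4 * h + 3 * l + 1) = _ from sideWord_d _ _ _ _] at this
    · intro i hi
      have := hU true (4 * i) (by omega)
      rwa [show H.u true (4 * i) = _ from sideWord_a _ _ _ _ hi] at this
    · intro i hi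
      have := hU true (4 * i + 1) (by omega)
      rwa [show H.u true (4 * i + 1) = _ from sideWord_b _ _ _ _ hi] at this
    · intro l hl
      have := hU true (4 * h + 3 * l) (by omega)
      rwa [show H.u true (4 * h + 3 * l) = _ from sideWord_c _ _ _ _] at this
    · intro l hl
      refine SideHolonomy.mem_holonomyGraph (htube l hl) ?_ ?_
      · change H.Good hf Φ hΦ (T l (0, 0))
        rw [hT0 l hl]
        exact hd0 l hl
      · change H.Good hf Φ hΦ (T l (0, 1))
        rw [hT1 l hl]
        exact hd1 l hl
  have hS : Function.Injective ((MonoidHom.fst _ _).comp S.subtype) := by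
    refine injective_fst_holonomyGraph (fun g g' hg => ?_) fun c hc => H.nullPath_of_toTorus hf hc
    rw [SideHolonomy.basePt, H.liftPt_eq hf Φ hΦ (collapse_fiberMap hf Φ hΦ false _),
      H.liftPt_eq hf Φ hΦ (collapse_fiberMap hf Φ hΦ false _)] at hg
    exact H.coverPt_injective false (x := surfaceMk h (m + 1) (side _ 0 0)) hg
  obtain ⟨φ, hφ⟩ := SurfaceGroup.exists_injective h m S hS D hD hDS
  -- Concatenation is multiplication in the opposite group; inversion identifies that group with the
  -- fundamental group.
  let e := (MulEquiv.inv' (FundamentalGroup (Double X A) (H.basePt Φ A))).symm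
  exact ⟨H.basePt Φ A, e.toMonoidHom.comp φ, e.injective.comp hφ⟩

end

end

section

open Topology
noncomputable section

/-! # Hyperbolic space and horoballs -/

section Lorentz

theorem lorentz_eq (x y : Fin 4 → ℝ) :
    lorentz x y = -(x 0 * y 0) + (x 1 * y 1 + x 2 * y 2 + x 3 * y 3) := by
  rw [lorentz, Fin.sum_univ_three]
  rfl

theorem lorentz_comm (x y : Fin 4 → ℝ) : lorentz x y = lorentz y x := by
  simp only [lorentz_eq]
  ring

theorem lorentz_add_smul (a b : ℝ) (x y z : Fin 4 → ℝ) :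
    lorentz (a • x + b • y) z = a * lorentz x z + b * lorentz y z := by
  simp only [lorentz_eq, Pi.add_apply, Pi.smul_apply, smul_eq_mul]
  ring

theorem lorentz_add_smul_self (a b : ℝ) (x y : Fin 4 → ℝ) :
    lorentz (a • x + b • y) (a • x + b • y) =
      a ^ 2 * lorentz x x + 2 * a * b * lorentz x y + b ^ 2 * lorentz y y := by
  simp only [lorentz_eq, Pi.add_apply, Pi.smul_apply, smul_eq_mul]
  ring

@[fun_prop]
theorem Continuous.lorentz {T : Type*} [TopologicalSpace T] {f g : T → Fin 4 → ℝ}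
    (hf : Continuous f) (hg : Continuous g) : Continuous fun t => lorentz (f t) (g t) := by
  simp only [lorentz_eq]
  fun_prop

theorem spatial_le {y z : Fin 4 → ℝ} {k l : ℝ} (hk : 0 ≤ k) (hl : 0 ≤ l)
    (hy : y 1 ^ 2 + y 2 ^ 2 + y 3 ^ 2 ≤ k ^ 2) (hz : z 1 ^ 2 + z 2 ^ 2 + z 3 ^ 2 ≤ l ^ 2) :
    y 1 * z 1 + y 2 * z 2 + y 3 * z 3 ≤ k * l := by
  refine le_of_sq_le_sq ?_ (mul_nonneg hk hl)
  calc (y 1 * z 1 + y 2 * z 2 + y 3 * z 3) ^ 2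
      ≤ (y 1 ^ 2 + y 2 ^ 2 + y 3 ^ 2) * (z 1 ^ 2 + z 2 ^ 2 + z 3 ^ 2) := by
        nlinarith [sq_nonneg (y 1 * z 2 - y 2 * z 1), sq_nonneg (y 1 * z 3 - y 3 * z 1),
          sq_nonneg (y 2 * z 3 - y 3 * z 2)]
    _ ≤ k ^ 2 * l ^ 2 := mul_le_mul hy hz (by positivity) (by positivity)
    _ = (k * l) ^ 2 := by ring

theorem lorentz_nonpos {y z : Fin 4 → ℝ} (hy : lorentz y y ≤ 0) (hy0 : 0 ≤ y 0)
    (hz : lorentz z z ≤ 0) (hz0 : 0 ≤ z 0) : lorentz y z ≤ 0 := by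
  rw [lorentz_eq] at *
  have := spatial_le (y := y) (z := z) hy0 hz0 (by linarith) (by linarith)
  linarith

/-- A vector in the closed light cone is future-pointing if it pairs negatively with a
future-pointing one. -/
theorem pos_of_lorentz_neg {y z : Fin 4 → ℝ} (hy : lorentz y y ≤ 0) (hy0 : 0 ≤ y 0)
    (hz : lorentz z z ≤ 0) (h : lorentz y z < 0) : 0 < z 0 := by
  by_contra! hz0
  have h1 := lorentz_nonpos (z := (-1 : ℝ) • z + (0 : ℝ) • z) hy hy0
    (by rw [lorentz_add_smul_self]; linarith) (by simpa using hz0)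
  rw [lorentz_comm, lorentz_add_smul, lorentz_comm z y] at h1
  linarith

/-- With `k` the length of the spatial part of `y`, Cauchy-Schwarz gives `-⟨y, z⟩ ≥ (y 0 - k) * z
0`. Since `(y 0 - k) * (y 0 + k) = 1` and `k ≤ y 0`, the first factor is at least `1 / (2 * y 0)`.
-/
theorem le_lorentz {y z : Fin 4 → ℝ} (hy : y ∈ hyperbolicSpace 3) (hz : lorentz z z ≤ 0)
    (hz0 : 0 ≤ z 0) : z 0 ≤ 2 * y 0 * -lorentz y z := by
  obtain ⟨h1, h2⟩ := hy
  rw [lorentz_eq] at *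
  set k := Real.sqrt (y 1 ^ 2 + y 2 ^ 2 + y 3 ^ 2) with hk
  have hk0 : 0 ≤ k := Real.sqrt_nonneg _
  have hk2 : k ^ 2 = y 1 ^ 2 + y 2 ^ 2 + y 3 ^ 2 := Real.sq_sqrt (by positivity)
  have h3 := spatial_le (y := y) (z := z) hk0 hz0 hk2.ge (by linarith)
  have h4 : k ≤ y 0 := le_of_sq_le_sq (by nlinarith) h2.le
  have h5 : 1 ≤ 2 * y 0 * (y 0 - k) := by nlinarith
  calc z 0 ≤ (2 * y 0 * (y 0 - k)) * z 0 := le_mul_of_one_le_left hz0 h5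
    _ = 2 * y 0 * (y 0 * z 0 - k * z 0) := by ring
    _ ≤ _ := mul_le_mul_of_nonneg_left (by linarith) (by linarith)

theorem abs_le_of_causal {z : Fin 4 → ℝ} (hz : lorentz z z ≤ 0) (hz0 : 0 ≤ z 0) (i : Fin 4) :
    |z i| ≤ z 0 := by
  rw [lorentz_eq] at hz
  refine abs_le_of_sq_le_sq ?_ hz0
  fin_cases i <;> simp only [Fin.zero_eta, Fin.mk_one, Fin.reduceFinMk] <;>
    nlinarith [sq_nonneg (z 1), sq_nonneg (z 2), sq_nonneg (z 3)]

theorem causal_of_mem {x : Fin 4 → ℝ} (hx : x ∈ hyperbolicSpace 3) : lorentz x x ≤ 0 := by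
  rw [hx.1]
  norm_num

end Lorentz

section Points

/-- The origin of hyperbolic space. -/
def hypOrigin : Fin 4 → ℝ := ![1, 0, 0, 0]

theorem hypOrigin_mem : hypOrigin ∈ hyperbolicSpace 3 := by
  constructor
  · rw [lorentz_eq]; simp [hypOrigin]
  · simp [hypOrigin]

/-- The straight segment stays in the open future cone and is rescaled onto the hyperboloid. -/
theorem joinedIn_hyperbolicSpace {x y : Fin 4 → ℝ} (hx : x ∈ hyperbolicSpace 3)
    (hy : y ∈ hyperbolicSpace 3) : JoinedIn (hyperbolicSpace 3) x y := by
  have hz : ∀ t : unitInterval, lorentz ((1 - (t : ℝ)) • x + (t : ℝ) • y)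
      ((1 - (t : ℝ)) • x + (t : ℝ) • y) < 0 := by
    intro t
    have h1 := lorentz_nonpos (causal_of_mem hx) hx.2.le (causal_of_mem hy) hy.2.le
    have h2 := mul_nonneg (sub_nonneg.2 t.2.2) t.2.1
    rw [lorentz_add_smul_self, hx.1, hy.1]
    nlinarith [mul_nonneg h2 (neg_nonneg.2 h1), sq_nonneg (2 * (t : ℝ) - 1)]
  have h0 : ∀ t : unitInterval, 0 < ((1 - (t : ℝ)) • x + (t : ℝ) • y) 0 := by
    intro t
    have h1 := mul_nonneg (sub_nonneg.2 t.2.2) hx.2.le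
    have h2 := mul_nonneg t.2.1 hy.2.le
    simp only [Pi.add_apply, Pi.smul_apply, smul_eq_mul]
    rcases t.2.1.eq_or_lt with h | h
    · rw [← h]
      simpa using hx.2
    · have := mul_pos h hy.2
      linarith
  let c : unitInterval → ℝ := fun t => (Real.sqrt (-lorentz ((1 - (t : ℝ)) • x + (t : ℝ) • y)
    ((1 - (t : ℝ)) • x + (t : ℝ) • y)))⁻¹
  have hc : ∀ t, 0 < c t := fun t => inv_pos.2 (Real.sqrt_pos.2 (neg_pos.2 (hz t)))
  have hcont : Continuous c := Continuous.inv₀ (by fun_prop) fun t =>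
    (Real.sqrt_pos.2 (neg_pos.2 (hz t))).ne'
  -- The zero summand brings the point into the form of `lorentz_add_smul_self`.
  refine ⟨⟨⟨fun t => c t • ((1 - (t : ℝ)) • x + (t : ℝ) • y) + (0 : ℝ) • x, by fun_prop⟩,
    ?_, ?_⟩, fun t => ⟨?_, ?_⟩⟩
  · simp [c, hx.1]
  · simp [c, hy.1]
  · change lorentz (c t • _ + (0 : ℝ) • x) (c t • _ + (0 : ℝ) • x) = -1
    rw [lorentz_add_smul_self]
    have h1 : c t ^ 2 = (-lorentz ((1 - (t : ℝ)) • x + (t : ℝ) • y)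
      ((1 - (t : ℝ)) • x + (t : ℝ) • y))⁻¹ := by
      rw [inv_pow, Real.sq_sqrt (neg_pos.2 (hz t)).le]
    rw [h1]
    have := (hz t).ne
    field_simp
    ring
  · have := mul_pos (hc t) (h0 t)
    change 0 < c t * _ + 0 * x 0
    rwa [zero_mul, add_zero]

/-- The reflection of a light-like vector in the time axis. -/
def opposite (w : Fin 4 → ℝ) : Fin 4 → ℝ := ![w 0, -w 1, -w 2, -w 3]

theorem lorentz_opposite {w : Fin 4 → ℝ} (hw : w ∈ futureLightCone 3) :
    lorentz w (opposite w) = -2 * w 0 ^ 2 := by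
  have := hw.1
  rw [lorentz_eq] at *
  simp only [opposite, Matrix.cons_val]
  linarith

theorem opposite_mem {w : Fin 4 → ℝ} (hw : w ∈ futureLightCone 3) :
    opposite w ∈ futureLightCone 3 := by
  refine ⟨?_, hw.2⟩
  have := hw.1
  rw [lorentz_eq] at *
  simp only [opposite, Matrix.cons_val]
  linarith

/-- The points of the geodesic between the directions of a light-like vector and its opposite. -/
theorem geodesic_mem {w : Fin 4 → ℝ} (hw : w ∈ futureLightCone 3) {a b : ℝ} (ha : 0 < a)
    (hb : 0 < b) (hab : 4 * a * b * w 0 ^ 2 = 1) : a • w + b • opposite w ∈ hyperbolicSpace 3 := by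
  constructor
  · rw [lorentz_add_smul_self, hw.1, (opposite_mem hw).1, lorentz_opposite hw]
    linarith
  · have := hw.2
    simp only [opposite, Pi.add_apply, Pi.smul_apply, smul_eq_mul, Matrix.cons_val]
    positivity

theorem exists_mem_horosphere {l : Fin 4 → ℝ} (hl : l ∈ futureLightCone 3) :
    ∃ x, x ∈ horosphere l := by
  have h0 := hl.2
  -- The value of `b` makes `-⟨x, l⟩ = 2 * b * l 0 ^ 2` equal to one; `a` is then forced by the
  -- equation of the hyperboloid.
  refine ⟨_, geodesic_mem hl (a := 1 / 2) (b := 1 / (2 * l 0 ^ 2)) (by norm_num) (by positivity)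
    (by field_simp; norm_num), ?_⟩
  rw [lorentz_add_smul, hl.1, lorentz_comm, lorentz_opposite hl]
  field_simp
  norm_num

/-- Along the conic `w t` in the light cone, `⟨w t, l⟩` is a nonzero polynomial in `t`, so some
direction is orthogonal to none of the finitely many `l`. Moving towards that point at infinity
makes every `-⟨x, l⟩` arbitrarily large. -/
theorem exists_far {L : Set (Fin 4 → ℝ)} (hfin : L.Finite) (hL : L ⊆ futureLightCone 3) (R : ℝ) :
    ∃ x ∈ hyperbolicSpace 3, ∀ l ∈ L, R < -lorentz x l := by
  let w : ℝ → Fin 4 → ℝ := fun t => ![1 + t ^ 2, 1 - t ^ 2, 2 * t, 0]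
  have hw : ∀ t, w t ∈ futureLightCone 3 := by
    intro t
    refine ⟨?_, by simp only [w, Matrix.cons_val]; positivity⟩
    rw [lorentz_eq]
    simp only [w, Matrix.cons_val]
    ring
  have h1 : ∀ l ∈ L, ∀ᶠ t in Filter.atTop, lorentz (w t) l ≠ 0 := by
    intro l hl
    let q : Polynomial ℝ := .C (-(l 0 + l 1)) * .X ^ 2 + .C (2 * l 2) * .X + .C (l 1 - l 0)
    have hq : ∀ t, q.eval t = lorentz (w t) l := by
      intro t
      rw [lorentz_eq]
      simp only [q, w, Matrix.cons_val, Polynomial.eval_add, Polynomial.eval_mul,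
        Polynomial.eval_C, Polynomial.eval_X, Polynomial.eval_pow]
      ring
    have hq0 : q ≠ 0 := by
      intro h
      have e0 := hq 0
      have e1 := hq 1
      have e2 := hq (-1)
      rw [h, Polynomial.eval_zero, lorentz_eq] at e0 e1 e2
      simp only [w, Matrix.cons_val] at e0 e1 e2
      have := (hL hl).2
      linarith
    filter_upwards [Polynomial.eventually_atTop_not_isRoot q hq0] with t ht h
    exact ht ((hq t).trans h)
  obtain ⟨t, ht⟩ := ((Filter.eventually_all_finite hfin).2 h1).exists
  have h2 : ∀ l ∈ L, 0 < -lorentz (w t) l := fun l hl => by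
    have := lorentz_nonpos (hw t).1.le (hw t).2.le (hL hl).1.le (hL hl).2.le
    have := lt_of_le_of_ne this (ht l hl)
    linarith
  have h3 : ∀ l ∈ L, ∀ᶠ a : ℝ in Filter.atTop, R < a * -lorentz (w t) l := fun l hl =>
    (Filter.tendsto_id.atTop_mul_const (h2 l hl)).eventually_gt_atTop R
  obtain ⟨a, ha, ha0⟩ := (((Filter.eventually_all_finite hfin).2 h3).and
    (Filter.eventually_gt_atTop 0)).exists
  have hw0 := (hw t).2
  refine ⟨_, geodesic_mem (hw t) (a := a) (b := 1 / (4 * a * w t 0 ^ 2)) ha0 (by positivity)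
    (by field_simp), fun l hl => ?_⟩
  rw [lorentz_add_smul]
  have h4 := lorentz_nonpos (opposite_mem (hw t)).1.le (opposite_mem (hw t)).2.le (hL hl).1.le
    (hL hl).2.le
  have h5 : 0 < 1 / (4 * a * w t 0 ^ 2) := by positivity
  have := ha l hl
  nlinarith

end Points

/-! ## Families of disjoint horoballs -/

section Horoballs

/-- If `c = -⟨l, l'⟩` is at most two and positive, the normalized sum of `l` and `l'` lies in both
closed horoballs, because `(a * c) ^ 2 = c / 2 ≤ 1`. -/
theorem lorentz_lt_of_disjoint {l l' : Fin 4 → ℝ} (hl : l ∈ futureLightCone 3)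
    (hl' : l' ∈ futureLightCone 3) (h : Disjoint (closedHoroball l) (closedHoroball l')) :
    2 < -lorentz l l' := by
  by_contra! hc
  obtain ⟨x, hx, hx1, hx2⟩ : ∃ x ∈ hyperbolicSpace 3, -lorentz x l ≤ 1 ∧ -lorentz x l' ≤ 1 := by
    have h0 := hl.2
    have h0' := hl'.2
    rcases (lorentz_nonpos hl.1.le hl.2.le hl'.1.le hl'.2.le).lt_or_eq with h1 | h1
    · set c := -lorentz l l' with hcdef
      have hc0 : 0 < c := by linarith
      set a := (Real.sqrt (2 * c))⁻¹ with ha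
      have ha0 : 0 < a := inv_pos.2 (Real.sqrt_pos.2 (by linarith))
      have ha2 : 2 * c * a ^ 2 = 1 := by
        rw [ha, inv_pow, Real.sq_sqrt (by linarith)]
        field_simp
      have hac : a * c ≤ 1 := by
        refine le_of_sq_le_sq ?_ zero_le_one
        nlinarith
      refine ⟨a • l + a • l', ⟨?_, ?_⟩, ?_, ?_⟩
      · rw [lorentz_add_smul_self, hl.1, hl'.1]
        linarith
      · simp only [Pi.add_apply, Pi.smul_apply, smul_eq_mul]
        positivity
      · rw [lorentz_add_smul, hl.1, lorentz_comm l' l]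
        linarith
      · rw [lorentz_add_smul, hl'.1]
        linarith
    -- If the product vanishes, both horoballs have the same center at infinity, and a point far
    -- enough towards it from the origin lies in both; `r` bounds the two depths.
    · have ho : lorentz hypOrigin hypOrigin = -1 := hypOrigin_mem.1
      have hol : ∀ k : Fin 4 → ℝ, lorentz hypOrigin k = -k 0 := fun k => by
        rw [lorentz_eq]; simp [hypOrigin]
      set r := l 0 + l' 0 with hr
      have hr0 : 0 < r := by positivity
      have hr1 : l 0 ≤ r := by linarith
      set s := r ^ 2 / (2 * l 0) with hs
      have hs0 : 0 < s := by positivity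
      have hs2 : 2 * s * l 0 = r ^ 2 := by rw [hs]; field_simp
      set d := (Real.sqrt (1 + r ^ 2))⁻¹ with hd
      have hd0 : 0 < d := inv_pos.2 (Real.sqrt_pos.2 (by positivity))
      have hd2 : d ^ 2 * (1 + r ^ 2) = 1 := by
        rw [hd, inv_pow, Real.sq_sqrt (by positivity)]
        field_simp
      have hdr : d * r ≤ 1 := by
        refine le_of_sq_le_sq ?_ zero_le_one
        nlinarith
      refine ⟨d • hypOrigin + (d * s) • l, ⟨?_, ?_⟩, ?_, ?_⟩
      · rw [lorentz_add_smul_self, hl.1, ho, hol]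
        linear_combination -hd2 - d ^ 2 * hs2
      · have : 0 < hypOrigin 0 := hypOrigin_mem.2
        simp only [Pi.add_apply, Pi.smul_apply, smul_eq_mul]
        positivity
      · rw [lorentz_add_smul, hl.1, hol]
        nlinarith
      · rw [lorentz_add_smul, h1, hol]
        nlinarith
  exact Set.disjoint_left.1 h ⟨hx, hx1⟩ ⟨hx, hx2⟩

/-- A family of horoballs with disjoint closures. -/
structure DisjointHoroballs (L : Set (Fin 4 → ℝ)) : Prop where
  lightlike : L ⊆ futureLightCone 3
  disjoint : ∀ l ∈ L, ∀ l' ∈ L, l ≠ l' → Disjoint (closedHoroball l) (closedHoroball l')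

variable {L : Set (Fin 4 → ℝ)}

/-- The Lorentzian square of `l - l'` is `-2⟨l, l'⟩ > 4`, whereas distance at most one bounds its
spatial part by three. -/
theorem DisjointHoroballs.one_lt_dist (hL : DisjointHoroballs L) {l l' : Fin 4 → ℝ}
    (hl : l ∈ L) (hl' : l' ∈ L)
    (h : l ≠ l') : 1 < dist l l' := by
  by_contra! hd
  have h1 := lorentz_lt_of_disjoint (hL.lightlike hl) (hL.lightlike hl') (hL.disjoint l hl l' hl' h)
  have h2 : ∀ i, (l i - l' i) ^ 2 ≤ 1 := fun i => by
    have := (dist_le_pi_dist l l' i).trans hd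
    rw [Real.dist_eq] at this
    exact (sq_le_one_iff_abs_le_one _).2 this
  have h3 := (hL.lightlike hl).1
  have h4 := (hL.lightlike hl').1
  rw [lorentz_eq] at *
  nlinarith [h2 1, h2 2, h2 3, sq_nonneg (l 0 - l' 0)]

/-- Only finitely many horoballs meet a bounded set. -/
theorem DisjointHoroballs.finite_near (hL : DisjointHoroballs L) (R : ℝ) :
    {l ∈ L | ∃ x ∈ hyperbolicSpace 3, x 0 ≤ R ∧ -lorentz x l ≤ 1}.Finite := by
  -- By `le_lorentz` the vectors in question have bounded entries. They are more than one apart, so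
  -- rounding down is injective on them.
  refine Set.Finite.of_injOn (f := fun l i => ⌊l i⌋)
    (t := Set.Icc (fun _ => ⌊-(2 * R)⌋) (fun _ => ⌊2 * R⌋)) ?_ ?_ (Set.finite_Icc _ _)
  · rintro l ⟨hl, x, hx, hxR, hxl⟩
    have hl' := hL.lightlike hl
    have h0 : l 0 ≤ 2 * R := by
      have h1 := le_lorentz hx hl'.1.le hl'.2.le
      have h2 := hx.2
      have h3 := lorentz_nonpos (causal_of_mem hx) h2.le hl'.1.le hl'.2.le
      nlinarith
    have h1 : ∀ i, |l i| ≤ 2 * R := fun i => (abs_le_of_causal hl'.1.le hl'.2.le i).trans h0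
    exact ⟨fun i => Int.floor_le_floor (abs_le.1 (h1 i)).1,
      fun i => Int.floor_le_floor (abs_le.1 (h1 i)).2⟩
  · rintro l ⟨hl, -⟩ l' ⟨hl', -⟩ hll
    by_contra hne
    refine (hL.one_lt_dist hl hl' hne).not_ge ((dist_pi_le_iff zero_le_one).2 fun i => ?_)
    rw [Real.dist_eq]
    exact (Int.abs_sub_lt_one_of_floor_eq_floor (congrFun hll i)).le

theorem DisjointHoroballs.finite_of_path (hL : DisjointHoroballs L) (c : C(unitInterval, Fin 4 → ℝ))
    (hc : ∀ t, c t ∈ hyperbolicSpace 3) : {l ∈ L | ∃ t, -lorentz (c t) l ≤ 1}.Finite := by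
  obtain ⟨R, hR⟩ := (isCompact_range (f := fun t => c t 0) (by fun_prop)).bddAbove
  refine (hL.finite_near R).subset ?_
  rintro l ⟨hl, t, ht⟩
  exact ⟨hl, c t, hc t, hR ⟨t, rfl⟩, ht⟩

theorem mem_horoballComplement {x : Fin 4 → ℝ} :
    x ∈ horoballComplement L ↔ x ∈ hyperbolicSpace 3 ∧ ∀ l ∈ L, 1 ≤ -lorentz x l := by
  simp only [horoballComplement, openHoroball, Set.mem_sdiff, Set.mem_iUnion, not_exists]
  refine and_congr_right fun hx => forall₂_congr fun l hl => ?_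
  exact ⟨fun h => not_lt.1 fun h' => h ⟨hx, h'⟩, fun h h' => h.not_gt h'.2⟩

theorem DisjointHoroballs.one_lt_of_mem_horosphere (hL : DisjointHoroballs L)
    {l l' x : Fin 4 → ℝ} (hl : l ∈ L)
    (hl' : l' ∈ L) (h : l ≠ l') (hx : x ∈ horosphere l) : 1 < -lorentz x l' := by
  by_contra! h1
  exact Set.disjoint_left.1 (hL.disjoint l hl l' hl' h) ⟨hx.1, hx.2.le⟩ ⟨hx.1, h1⟩

theorem DisjointHoroballs.horosphere_subset (hL : DisjointHoroballs L)
    {l x : Fin 4 → ℝ} (hl : l ∈ L)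
    (hx : x ∈ horosphere l) : x ∈ horoballComplement L := by
  refine mem_horoballComplement.2 ⟨hx.1, fun l' hl' => ?_⟩
  by_cases h : l = l'
  · exact h ▸ hx.2.ge
  · exact (hL.one_lt_of_mem_horosphere hl hl' h hx).le

/-- A path in the union of the horospheres stays in one of them. -/
theorem DisjointHoroballs.horosphere_of_path (hL : DisjointHoroballs L)
    (c : C(unitInterval, Fin 4 → ℝ))
    (hc : ∀ t, ∃ l ∈ L, c t ∈ horosphere l) : ∃ l ∈ L, ∀ t, c t ∈ horosphere l := by
  choose f hfL hf using hc
  have hiff : ∀ t, ∀ l ∈ L, (f t = l ↔ -lorentz (c t) l = 1) := fun t l hl =>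
    ⟨fun h => h ▸ (hf t).2, fun h => by
      by_contra hne
      exact (hL.one_lt_of_mem_horosphere (hfL t) hl hne (hf t)).ne' h⟩
  have hS : {l ∈ L | ∃ t, -lorentz (c t) l ≤ 1}.Finite := hL.finite_of_path c fun t => (hf t).1
  have hclosed : ∀ l ∈ L, IsClosed {t | f t = l} := by
    intro l hl
    have : {t | f t = l} = {t | -lorentz (c t) l = 1} := Set.ext fun t => hiff t l hl
    rw [this]
    exact isClosed_eq (by fun_prop) continuous_const
  -- Only finitely many horospheres meet the path, so the complement is a finite union of closed
  -- sets.
  have hopen : IsOpen {t | f t = f 0} := by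
    have : {t | f t = f 0}ᶜ = ⋃ l ∈ {l ∈ L | ∃ t, -lorentz (c t) l ≤ 1} \ {f 0},
        {t | f t = l} := by
      ext t
      simp only [Set.mem_compl_iff, Set.mem_ofPred_eq, Set.mem_iUnion, exists_prop,
        Set.mem_sdiff, Set.mem_singleton_iff]
      exact ⟨fun h => ⟨f t, ⟨⟨hfL t, t, (hf t).2.le⟩, h⟩, rfl⟩, fun ⟨l, ⟨_, h⟩, h'⟩ => h' ▸ h⟩
    rw [← isClosed_compl_iff, this]
    exact (hS.subset Set.sdiff_subset).isClosed_biUnion fun l hl => hclosed l hl.1.1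
  have huniv : {t | f t = f 0} = Set.univ :=
    IsClopen.eq_univ ⟨hclosed _ (hfL 0), hopen⟩ ⟨0, rfl⟩
  refine ⟨f 0, hfL 0, fun t => ?_⟩
  have : f t = f 0 := huniv.ge (Set.mem_univ t)
  exact this ▸ hf t

end Horoballs

/-! ## Pushing points out of a horoball -/

section Push

/-- The retraction onto the complement of a horoball. -/
def push (l x : Fin 4 → ℝ) : Fin 4 → ℝ :=
  -- Inside the horoball the first coefficient makes the product with `l` equal to `-1`, and the
  -- second one returns the point to the hyperboloid. Outside they are `1` and `0`.
  (min 1 (-lorentz x l))⁻¹ • x + ((1 - ((min 1 (-lorentz x l))⁻¹) ^ 2) / 2) • l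

variable {l x : Fin 4 → ℝ}

theorem lorentz_neg (hl : l ∈ futureLightCone 3) (hx : x ∈ hyperbolicSpace 3) :
    0 < -lorentz x l := by
  have h1 := le_lorentz hx hl.1.le hl.2.le
  have h2 := hl.2
  have h3 := hx.2
  by_contra! h4
  nlinarith

theorem push_of_le (h : 1 ≤ -lorentz x l) : push l x = x := by
  rw [push, min_eq_left h]
  simp

theorem push_mem (hl : l ∈ futureLightCone 3) (hx : x ∈ hyperbolicSpace 3) :
    push l x ∈ hyperbolicSpace 3 := by
  rcases le_total 1 (-lorentz x l) with h | h
  · rwa [push_of_le h]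
  · have h1 := lorentz_neg hl hx
    have h2 : lorentz (push l x) (push l x) = -1 := by
      have h3 : lorentz x l ≠ 0 := (neg_pos.1 h1).ne
      rw [push, lorentz_add_smul_self, hx.1, hl.1, min_eq_right h]
      field_simp
      ring
    refine ⟨h2, pos_of_lorentz_neg hl.1.le hl.2.le (h2.le.trans (by norm_num)) ?_⟩
    rw [push, lorentz_comm, lorentz_add_smul, hl.1, min_eq_right h]
    have := inv_pos.2 h1
    nlinarith

theorem push_mem_horosphere (hl : l ∈ futureLightCone 3) (hx : x ∈ hyperbolicSpace 3)
    (h : -lorentz x l ≤ 1) : push l x ∈ horosphere l := by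
  refine ⟨push_mem hl hx, ?_⟩
  have h1 := lorentz_neg hl hx
  rw [push, lorentz_add_smul, hl.1, min_eq_right h, mul_zero, add_zero, ← mul_neg,
    inv_mul_cancel₀ h1.ne']

theorem continuous_push (hl : l ∈ futureLightCone 3) {T : Type*} [TopologicalSpace T]
    {c : T → Fin 4 → ℝ} (hc : Continuous c) (hc' : ∀ t, c t ∈ hyperbolicSpace 3) :
    Continuous fun t => push l (c t) := by
  unfold push
  have h1 : Continuous fun t => (min 1 (-lorentz (c t) l))⁻¹ :=
    Continuous.inv₀ (by fun_prop) fun t => (lt_min one_pos (lorentz_neg hl (hc' t))).ne'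
  fun_prop

/-- A path in hyperbolic space meets only finitely many of the horoballs and can be pushed out of
them one at a time. Pushed points lie on a horosphere, which is disjoint from all other closed
horoballs, so no earlier push is undone. -/
theorem DisjointHoroballs.isPathConnected {L : Set (Fin 4 → ℝ)} (hL : DisjointHoroballs L)
    (hne : (horoballComplement L).Nonempty) : IsPathConnected (horoballComplement L) := by
  refine isPathConnected_iff.2 ⟨hne, fun x hx y hy => ?_⟩
  obtain ⟨hx1, hx2⟩ := mem_horoballComplement.1 hx
  obtain ⟨hy1, hy2⟩ := mem_horoballComplement.1 hy
  obtain ⟨γ, hγ⟩ := joinedIn_hyperbolicSpace hx1 hy1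
  have hS := hL.finite_of_path γ hγ
  -- `S'` is the set of horoballs already cleared; those that `γ` never meets count as cleared from
  -- the start.
  have key : ∀ S' ⊆ {l ∈ L | ∃ t, -lorentz (γ t) l ≤ 1}, S'.Finite → ∃ γ' : Path x y,
      (∀ t, γ' t ∈ hyperbolicSpace 3) ∧ ∀ t, ∀ l ∈ L,
        l ∈ S' ∨ l ∉ {l ∈ L | ∃ t, -lorentz (γ t) l ≤ 1} → 1 ≤ -lorentz (γ' t) l := by
    intro S' hS' hfin
    induction S', hfin using Set.Finite.induction_on with
    | empty =>
      refine ⟨γ, hγ, fun t l hl h => ?_⟩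
      by_contra! h'
      exact (h.resolve_left (Set.notMem_empty l)) ⟨hl, t, h'.le⟩
    | @insert a S' ha _ ih =>
      obtain ⟨γ', h1, h2⟩ := ih ((Set.subset_insert a S').trans hS')
      have haL : a ∈ L := (hS' (Set.mem_insert a S')).1
      have ha' := hL.lightlike haL
      refine ⟨⟨⟨fun t => push a (γ' t), continuous_push ha' γ'.continuous h1⟩, ?_, ?_⟩,
        fun t => push_mem ha' (h1 t), fun t l hl h => ?_⟩
      · change push a (γ' 0) = x
        rw [γ'.source, push_of_le (hx2 a haL)]
      · change push a (γ' 1) = y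
        rw [γ'.target, push_of_le (hy2 a haL)]
      · change 1 ≤ -lorentz (push a (γ' t)) l
        rcases le_total (-lorentz (γ' t) a) 1 with h3 | h3
        · have h4 := push_mem_horosphere ha' (h1 t) h3
          by_cases hla : a = l
          · exact hla ▸ h4.2.ge
          · exact (hL.one_lt_of_mem_horosphere haL hl hla h4).le
        · rw [push_of_le h3]
          by_cases hla : l = a
          · exact hla ▸ h3
          · exact h2 t l hl (h.imp_left fun h => (Set.mem_insert_iff.1 h).resolve_left hla)
  obtain ⟨γ', h1, h2⟩ := key _ subset_rfl hS
  exact ⟨γ', fun t => mem_horoballComplement.2 ⟨h1 t, fun l hl => h2 t l hl (em _)⟩⟩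

end Push
end

end

section

open Topology
noncomputable section

/-! # Discrete groups of isometries of hyperbolic space -/

section Action

variable {g : SL(4, ℝ)}

theorem smul_eq_mulVec (g : SL(4, ℝ)) (x : Fin 4 → ℝ) : g • x = g.1.mulVec x := rfl

theorem lorentz_smul (hg : g ∈ SOplus 3) (x y : Fin 4 → ℝ) :
    lorentz (g • x) (g • y) = lorentz x y := hg.1 x y

theorem smul_mem_hyperbolicSpace (hg : g ∈ SOplus 3) {x : Fin 4 → ℝ} (hx : x ∈ hyperbolicSpace 3) :
    g • x ∈ hyperbolicSpace 3 := (hg.2 x).2 hx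

theorem smul_mem_futureLightCone (hg : g ∈ SOplus 3) {z : Fin 4 → ℝ}
    (hz : z ∈ futureLightCone 3) : g • z ∈ futureLightCone 3 := by
  have h1 : lorentz (g • z) (g • z) = 0 := by rw [lorentz_smul hg, hz.1]
  have h2 := smul_mem_hyperbolicSpace hg hypOrigin_mem
  refine ⟨h1, pos_of_lorentz_neg (causal_of_mem h2) h2.2.le h1.le ?_⟩
  rw [lorentz_smul hg]
  have := lorentz_neg hz hypOrigin_mem
  linarith

theorem smul_zero_le (hg : g ∈ SOplus 3) {x z : Fin 4 → ℝ} (hx : x ∈ hyperbolicSpace 3)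
    (hz : lorentz (g • z) (g • z) ≤ 0) (hz0 : 0 ≤ (g • z) 0) (i : Fin 4) :
    |(g • z) i| ≤ 2 * (g • x) 0 * -lorentz x z := by
  rw [← lorentz_smul hg]
  exact (abs_le_of_causal hz hz0 i).trans (le_lorentz (smul_mem_hyperbolicSpace hg hx) hz hz0)

/-- An isometry that moves a point of a bounded set to a bounded set has bounded entries. -/
theorem entry_le (hg : g ∈ SOplus 3) {x : Fin 4 → ℝ} (hx : x ∈ hyperbolicSpace 3) {R : ℝ}
    (hxR : x 0 ≤ R) (hgx : (g • x) 0 ≤ R) (i j : Fin 4) : |g.1 i j| ≤ 6 * R ^ 2 := by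
  have hcol : ∀ j, g.1 i j = (g • (Pi.single j 1 : Fin 4 → ℝ)) i := fun j => by
    rw [smul_eq_mulVec, Matrix.mulVec_single_one]
    rfl
  have hR : 0 < R := hx.2.trans_le hxR
  have hgx0 := (smul_mem_hyperbolicSpace hg hx).2
  have horigin : (Pi.single 0 1 : Fin 4 → ℝ) = hypOrigin := by
    funext k
    fin_cases k <;> simp [hypOrigin]
  have hx0 : lorentz x hypOrigin = -x 0 := by
    rw [lorentz_eq]
    simp [hypOrigin]
  have h0 : |(g • hypOrigin) i| ≤ 2 * R * R := by
    have h1 := smul_mem_hyperbolicSpace hg hypOrigin_mem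
    refine (smul_zero_le hg hx (causal_of_mem h1) h1.2.le i).trans ?_
    rw [hx0, neg_neg]
    exact mul_le_mul (by linarith) hxR hx.2.le (by linarith)
  by_cases hj : j = 0
  · rw [hcol, hj, horigin]
    nlinarith
  -- A spatial basis vector is the difference of a light-like vector and the origin. Their images
  -- are bounded by `4R²` and `2R²`, whence `6R²`.
  · have hz : lorentz (hypOrigin + Pi.single j 1) (hypOrigin + Pi.single j 1) = 0 ∧
        0 < (hypOrigin + Pi.single j 1 : Fin 4 → ℝ) 0 ∧
        lorentz x (hypOrigin + Pi.single j 1) = -x 0 + x j := by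
      simp only [lorentz_eq]
      fin_cases j <;> simp_all [hypOrigin]
    have h1 := smul_mem_futureLightCone hg ⟨hz.1, hz.2.1⟩
    have h2 := smul_zero_le hg hx h1.1.le h1.2.le i
    have h3 : |x j| ≤ x 0 := abs_le_of_causal (causal_of_mem hx) hx.2.le j
    have h4 : |(g • (hypOrigin + Pi.single j 1 : Fin 4 → ℝ)) i| ≤ 2 * R * (2 * R) := by
      refine h2.trans (mul_le_mul (by linarith) ?_ ?_ (by linarith))
      · rw [hz.2.2]
        linarith [neg_le_of_abs_le h3]
      · rw [hz.2.2]
        linarith [le_of_abs_le h3]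
    have h5 : g.1 i j = (g • (hypOrigin + Pi.single j 1 : Fin 4 → ℝ)) i - (g • hypOrigin) i := by
      rw [hcol, smul_add]
      simp
    rw [h5]
    refine (abs_sub _ _).trans ?_
    linarith

variable {Γ : Subgroup SL(4, ℝ)}

/-- By `entry_le` these elements lie in a compact part of the matrix group, which meets a discrete
subgroup in a finite set. -/
theorem finite_of_discrete (hΓ : Γ ≤ SOplus 3) (hd : DiscreteTopology Γ) (R : ℝ) :
    {g : Γ | ∃ x ∈ hyperbolicSpace 3, x 0 ≤ R ∧ (g • x) 0 ≤ R}.Finite := by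
  have h1 := Subgroup.tendsto_coe_cofinite_of_discrete Γ
    (isDiscrete_iff_discreteTopology.2 hd)
  let K : Set (Matrix (Fin 4) (Fin 4) ℝ) :=
    Set.univ.pi fun _ => Set.univ.pi fun _ => Set.Icc (-(6 * R ^ 2)) (6 * R ^ 2)
  have hK : IsCompact K := isCompact_univ_pi fun _ => isCompact_univ_pi fun _ => isCompact_Icc
  have hK' := Matrix.SpecialLinearGroup.isClosedEmbedding_val (n := Fin 4) (R := ℝ)
    |>.isCompact_preimage hK
  have h2 := h1.eventually hK'.compl_mem_cocompact
  rw [Filter.eventually_cofinite] at h2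
  refine h2.subset ?_
  rintro g ⟨x, hx, hxR, hgx⟩ hg
  exact hg fun i _ j _ => abs_le.1 (entry_le (hΓ g.2) hx hxR hgx i j)

/-- All powers of `g` fix `x`, so there are finitely many of them, and `g` is torsion. -/
theorem eq_one_of_fixed (hΓ : Γ ≤ SOplus 3) (hd : DiscreteTopology Γ)
    (ht : ∀ g ∈ Γ, IsOfFinOrder g → g = 1) {g : Γ} {x : Fin 4 → ℝ} (hx : x ∈ hyperbolicSpace 3)
    (hgx : g • x = x) : g = 1 := by
  have h1 : ∀ k : ℕ, g ^ k • x = x := by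
    intro k
    induction k with
    | zero => rw [pow_zero, one_smul]
    | succ k ih => rw [pow_succ, mul_smul, hgx, ih]
  have h2 : IsOfFinOrder g := by
    rw [← finite_powers]
    refine (finite_of_discrete hΓ hd (x 0)).subset ?_
    rintro _ ⟨k, rfl⟩
    exact ⟨x, hx, le_rfl, by simp only [h1]; exact le_rfl⟩
  exact Subtype.ext (ht g g.2 (Submonoid.isOfFinOrder_coe.2 h2))

end Action

/-! ## The truncated manifold -/

section Truncated

variable {Γ : Subgroup SL(4, ℝ)} {L : Set (Fin 4 → ℝ)}

theorem IsCuspTruncation.disjointHoroballs (hL : IsCuspTruncation Γ L) : DisjointHoroballs L :=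
  ⟨hL.lightlike, hL.disjoint⟩

theorem smul_mem_horoballComplement (hΓ : Γ ≤ SOplus 3) (hL : IsCuspTruncation Γ L) (g : Γ)
    {x : Fin 4 → ℝ} (hx : x ∈ horoballComplement L) : g • x ∈ horoballComplement L := by
  rw [mem_horoballComplement] at *
  refine ⟨smul_mem_hyperbolicSpace (hΓ g.2) hx.1, fun l hl => ?_⟩
  have h1 := hx.2 _ (hL.invariant _ (g⁻¹).2 l hl)
  rw [← lorentz_smul (hΓ g.2) x, ← smul_eq_mulVec, smul_smul, ← Subgroup.coe_mul, mul_inv_cancel,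
    Subgroup.coe_one, one_smul] at h1
  exact h1

/-- The action on the complement of the horoballs. -/
abbrev horoballAction (hΓ : Γ ≤ SOplus 3) (hL : IsCuspTruncation Γ L) :
    MulAction Γ (horoballComplement L) where
  smul g x := ⟨g • x.1, smul_mem_horoballComplement hΓ hL g x.2⟩
  one_smul x := Subtype.ext (one_smul _ x.1)
  mul_smul g g' x := Subtype.ext (mul_smul g g' x.1)

theorem isClosed_horoballComplement : IsClosed (horoballComplement L) := by
  have h : horoballComplement L = {x | lorentz x x = -1} ∩ {x | 0 ≤ x 0} ∩
      ⋂ l ∈ L, {x | 1 ≤ -lorentz x l} := by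
    ext x
    rw [mem_horoballComplement]
    simp only [hyperbolicSpace, Set.mem_inter_iff, Set.mem_ofPred_eq, Set.mem_iInter]
    -- The open condition `0 < x 0` may be replaced by a closed one, as `x 0 = 0` is impossible on
    -- the hyperboloid.
    refine and_congr_left fun _ => and_congr_right fun h => ⟨le_of_lt, fun h0 => ?_⟩
    refine lt_of_le_of_ne h0 fun h0 => ?_
    rw [lorentz_eq, ← h0] at h
    nlinarith [sq_nonneg (x 1), sq_nonneg (x 2), sq_nonneg (x 3)]
  rw [h]
  refine ((isClosed_eq (by fun_prop) continuous_const).inter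
    (isClosed_le continuous_const (by fun_prop))).inter ?_
  exact isClosed_biInter fun l _ => isClosed_le continuous_const (by fun_prop)

theorem isQuotientCoveringMap_truncated (hΓ : Γ ≤ SOplus 3) (hd : DiscreteTopology Γ)
    (ht : ∀ g ∈ Γ, IsOfFinOrder g → g = 1) (hL : IsCuspTruncation Γ L) :
    letI := horoballAction hΓ hL
    IsQuotientCoveringMap (Quotient.mk (orbitSetoid Γ (horoballComplement L))) Γ := by
  let _ := horoballAction hΓ hL
  have : LocallyCompactSpace (horoballComplement L) :=
    isClosed_horoballComplement.isClosedEmbedding_subtypeVal.locallyCompactSpace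
  have : ContinuousConstSMul Γ (horoballComplement L) := ⟨fun g => by
    refine Continuous.subtype_mk ?_ _
    change Continuous fun x : horoballComplement L => g.1.1.mulVec x.1
    fun_prop⟩
  have hcont : Continuous fun x : horoballComplement L => x.1 0 :=
    (continuous_apply 0).comp continuous_subtype_val
  have : ProperlyDiscontinuousSMul Γ (horoballComplement L) := ⟨fun {K K'} hK hK' => by
    obtain ⟨R, hR⟩ := (hK.image hcont).bddAbove
    obtain ⟨R', hR'⟩ := (hK'.image hcont).bddAbove
    refine (finite_of_discrete hΓ hd (max R R')).subset ?_
    intro g hg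
    obtain ⟨_, ⟨x, hx, rfl⟩, hgx⟩ := hg
    exact ⟨x.1, (mem_horoballComplement.1 x.2).1, (hR ⟨x, hx, rfl⟩).trans (le_max_left _ _),
      (hR' ⟨_, hgx, rfl⟩).trans (le_max_right _ _)⟩⟩
  have : IsCancelSMul Γ (horoballComplement L) := isCancelSMul_iff_eq_one_of_smul_eq.2
    fun g x hgx => eq_one_of_fixed hΓ hd ht (mem_horoballComplement.1 x.2).1
      (congrArg Subtype.val hgx)
  refine IsQuotientMap.isQuotientCoveringMap_of_properlyDiscontinuousSMul
    isQuotientMap_quotient_mk' ?_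
  intro x y
  rw [Quotient.eq]
  exact ⟨fun ⟨g, hg, h⟩ => ⟨⟨g⁻¹, Γ.inv_mem hg⟩, Subtype.ext (by
    change (g⁻¹ : SL(4, ℝ)) • y.1 = x.1
    rw [← h]
    exact inv_smul_smul g x.1)⟩, fun ⟨g, h⟩ => ⟨g⁻¹, (g⁻¹).2, by
    rw [← h]
    exact inv_smul_smul g.1 y.1⟩⟩

/-- For finite `L` the sum of all `-⟨x, l⟩` is invariant, as the group permutes `L`. It descends to
a continuous, hence bounded, function on the compact truncated manifold, which contradicts
`exists_far`. -/
theorem IsCuspTruncation.infinite (hΓ : Γ ≤ SOplus 3) (hL : IsCuspTruncation Γ L) :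
    L.Infinite := by
  intro hfin
  let s : (Fin 4 → ℝ) → ℝ := fun x => ∑ l ∈ hfin.toFinset, -lorentz x l
  have hs : ∀ g ∈ Γ, ∀ x, s (g • x) = s x := by
    intro g hg x
    refine Finset.sum_nbij' (fun l => g⁻¹ • l) (fun l => g • l) ?_ ?_ ?_ ?_ ?_
    · exact fun l hl => hfin.mem_toFinset.2
        (hL.invariant _ (Γ.inv_mem hg) l (hfin.mem_toFinset.1 hl))
    · exact fun l hl => hfin.mem_toFinset.2 (hL.invariant _ hg l (hfin.mem_toFinset.1 hl))
    · exact fun l _ => smul_inv_smul g l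
    · exact fun l _ => inv_smul_smul g l
    · intro l _
      rw [← lorentz_smul (hΓ hg) x, smul_inv_smul]
  let S : TruncatedManifold Γ L → ℝ := Quotient.lift (fun x => s x.1) (by
    rintro x y ⟨g, hg, h⟩
    rw [← h, ← smul_eq_mulVec, hs g hg])
  have hS : Continuous S := continuous_quot_lift _ (by
    change Continuous fun x : horoballComplement L => ∑ l ∈ hfin.toFinset, -lorentz x.1 l
    fun_prop)
  have := hL.compact
  obtain ⟨B, hB⟩ := (isCompact_range hS).bddAbove
  obtain ⟨x, hx, hfar⟩ := exists_far hfin hL.lightlike (max 1 B)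
  have hxX : x ∈ horoballComplement L :=
    mem_horoballComplement.2 ⟨hx, fun l hl => (le_max_left 1 B).trans (hfar l hl).le⟩
  obtain ⟨l, hl⟩ := hL.nonempty
  have h1 : S (Quotient.mk _ ⟨x, hxX⟩) ≤ B := hB ⟨_, rfl⟩
  have h2 : -lorentz x l ≤ s x := Finset.single_le_sum (f := fun l => -lorentz x l)
    (fun l hl => (lorentz_neg (hL.lightlike (hfin.mem_toFinset.1 hl)) hx).le)
    (hfin.mem_toFinset.2 hl)
  have h3 := (le_max_right 1 B).trans_lt (hfar l hl)
  exact absurd (h3.trans_le h2) h1.not_gt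

theorem mem_truncatedBoundary (hΓ : Γ ≤ SOplus 3) (hL : IsCuspTruncation Γ L)
    (x : horoballComplement L) : Quotient.mk _ x ∈ truncatedBoundary Γ L ↔
      ∃ l ∈ L, x.1 ∈ horosphere l := by
  constructor
  · rintro ⟨y, ⟨l, hl, hy⟩, hxy⟩
    obtain ⟨g, hg, h⟩ := Quotient.exact hxy
    refine ⟨g • l, hL.invariant g hg l hl, (mem_horoballComplement.1 x.2).1, ?_⟩
    rw [← h, ← smul_eq_mulVec, lorentz_smul (hΓ hg)]
    exact hy.2
  · exact fun h => ⟨x, h, rfl⟩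

end Truncated
end

end

section

open Topology
noncomputable section

/-! # Mapping tori of discs and annuli -/

section Boundary

theorem zpow_mem_iff {S : Type*} [TopologicalSpace S] {f : S ≃ₜ S} {A : Set S} (hf : f '' A = A)
    (n : ℤ) (x : S) : (f ^ n) x ∈ A ↔ x ∈ A := by
  have h1 : ∀ x, f x ∈ A ↔ x ∈ A := fun x => by
    conv_lhs => rw [← hf]
    exact f.injective.mem_set_image
  induction n with
  | zero => rfl
  | succ n ih =>
    rw [add_comm, zpow_add, zpow_one]
    exact (h1 _).trans ih
  | pred n ih =>
    rw [sub_eq_add_neg, add_comm, zpow_add, zpow_neg_one]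
    have h2 := h1 (f⁻¹ ((f ^ (-n : ℤ)) x))
    rw [show f (f⁻¹ ((f ^ (-n : ℤ)) x)) = (f ^ (-n : ℤ)) x from f.apply_symm_apply _] at h2
    exact h2.symm.trans ih

theorem torusCoverMap_mem_iff {S : Type} [TopologicalSpace S] {f : S ≃ₜ S} {A : Set S}
    (hf : f '' A = A) (x : S) (r : ℝ) :
    torusCoverMap f (x, r) ∈ mappingTorusOver f A ↔ x ∈ A := by
  constructor
  · rintro ⟨y, hy, s, h⟩
    rw [← torusCoverMap_eq_of_mem_Icc f y s s.2] at h
    obtain ⟨n, hn⟩ := ((isQuotientCoveringMap_torusCoverMap f).apply_eq_iff_mem_orbit).1 h.symm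
    have h1 : (f ^ n.toAdd) y = x := congrArg Prod.fst hn
    rw [← h1, zpow_mem_iff hf]
    exact hy
  · exact fun hx => ⟨_, (zpow_mem_iff hf _ x).2 hx, _, rfl⟩

theorem sheet_unit_injective {X : Type} [TopologicalSpace X] {A : Set X} {k k' : Unit} {x y : X}
    (h : sheet A k x = sheet A k' y) : x = y :=
  congrArg (multiLift (fun _ : Unit => ContinuousMap.id X) fun _ _ _ _ => rfl) h

end Boundary

section Annulus

variable {b : ℕ} {G : Type} [Group G]

/-- The word of the sides of the polygon of a planar surface, in which the sides before the hole
number `k` are identified by `w k`. -/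
def planarWord (w : ℕ → G) : ℕ → G :=
  sideWord 0 1 1 1 fun k => wordProd w k * (w k)⁻¹ * (wordProd w k)⁻¹

/-- Consequently the label that glues the sides `3k` and `3k + 2` is exactly `w k`. -/
theorem wordProd_planarWord (w : ℕ → G) (n : ℕ) :
    wordProd (planarWord w) (4 * 0 + 3 * n) = (wordProd w n)⁻¹ := by
  rw [planarWord, wordProd_sideWord, wordProd, one_mul]
  induction n with
  | zero => simp [wordProd]
  | succ n ih =>
    rw [wordProd, ih, wordProd]
    simp only [Pi.one_apply]
    group

/-- The covering of a planar surface with given identifications of the sides of the polygon. -/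
def planarHolonomy (w : ℕ → G) (hw : wordProd w b = 1) : SideHolonomy 0 b Unit G where
  u _ := planarWord w
  handleA _ i hi := absurd hi (Nat.not_lt_zero i)
  handleB _ i hi := absurd hi (Nat.not_lt_zero i)
  hole _ l _ := by rw [planarWord, sideWord_c', sideWord_c]
  free _ _ _ _ := rfl
  close _ := by rw [wordProd_planarWord, hw, inv_one]

/-- The polygon times the line lifts to `X`, and its paired sides differ by deck transformations `w
k` with product one. Each `w k` fixes the label of the boundary strip beside it. With at most two
holes the `w k` are trivial or mutually inverse, so they fix all labels, and so does the group they
generate. The translates of the polygon by elements fixing the labels already fill `X`, so no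
further labels occur. -/
theorem finite_boundary_labels (hb1 : 1 ≤ b) (hb : b ≤ 2)
    {f : CompactSurface 0 b ≃ₜ CompactSurface 0 b}
    (hf : f '' surfaceBoundary 0 b = surfaceBoundary 0 b) {X M : Type} [TopologicalSpace X]
    [TopologicalSpace M] [PathConnectedSpace X] {A : Set M} (Φ : M ≃ₜ MappingTorus f)
    (hΦ : Φ '' A = mappingTorusOver f (surfaceBoundary 0 b)) {Γ : Type} [Group Γ] [MulAction Γ X]
    {p : X → M} (hp : IsQuotientCoveringMap p Γ) {Λ : Type*} [MulAction Γ Λ] (lam : X → Λ)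
    (hlam : ∀ (g : Γ) x, p x ∈ A → lam (g • x) = g • lam x)
    (hpath : ∀ c : C(unitInterval, X), (∀ t, p (c t) ∈ A) → lam (c 1) = lam (c 0)) :
    (lam '' (p ⁻¹' A)).Finite := by
  have hcov := hp.isCoveringMap
  have hsm := hp.toContinuousConstSMul
  have hfree : ∀ (g : Γ) (x : X), g • x = x → g = 1 := fun g x hx =>
    isCancelSMul_iff_eq_one_of_smul_eq.1 hp.isCancelSMul g x hx
  let N := 4 * 0 + 3 * b
  let ψ : C(ClosedDisc × ℝ, M) := ⟨fun q => Φ.symm (torusCoverMap f (surfaceMk 0 b q.1, q.2)),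
    Φ.symm.continuous.comp ((continuous_torusCoverMap f).comp
      (((surfaceMk 0 b).continuous.comp continuous_fst).prodMk continuous_snd))⟩
  have hA : ∀ d r, ψ (d, r) ∈ A ↔ surfaceMk 0 b d ∈ surfaceBoundary 0 b := by
    intro d r
    rw [← torusCoverMap_mem_iff hf _ r, ← hΦ, ← Φ.injective.mem_set_image]
    exact iff_of_eq (congrArg (· ∈ Φ '' A) (Φ.apply_symm_apply _))
  let d₀ : ClosedDisc := side N 0 0
  obtain ⟨x₀, hx₀⟩ := hp.surjective (ψ (d₀, 0))
  obtain ⟨F, ⟨hF0, hF⟩, -⟩ := hcov.existsUnique_continuousMap_lifts ψ (d₀, 0) x₀ hx₀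
  replace hF : ∀ q, p (F q) = ψ q := congrFun hF
  -- the identifications of the sides
  have hid : ∀ k < b, ∃ g : Γ, ∀ (s : unitInterval) (r : ℝ), F (side N (4 * 0 + 3 * k) s, r) =
      g • F (side N (4 * 0 + 3 * k + 2) (unitInterval.symm s), r) := by
    intro k hk
    have h1 : ∀ q : unitInterval × ℝ, p (F (side N (4 * 0 + 3 * k) q.1, q.2)) =
        p (F (side N (4 * 0 + 3 * k + 2) (unitInterval.symm q.1), q.2)) := by
      intro q
      rw [hF, hF]
      refine congrArg (fun σ => Φ.symm (torusCoverMap f (σ, q.2))) ?_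
      rw [surfaceMk_hole hk, unitInterval.symm_symm]
    obtain ⟨g, hg⟩ := hp.apply_eq_iff_mem_orbit.1 (h1 (0, 0))
    refine ⟨g, fun s r => ?_⟩
    have h2 := hcov.eq_of_comp_eq (A := unitInterval × ℝ)
      (g₁ := fun q => F (side N (4 * 0 + 3 * k) q.1, q.2))
      (g₂ := fun q => g • F (side N (4 * 0 + 3 * k + 2) (unitInterval.symm q.1), q.2))
      (by fun_prop) (Continuous.const_smul (by fun_prop) g)
      (funext fun q => (h1 q).trans (hp.map_smul g).symm) (0, 0) hg.symm
    exact congrFun h2 (s, r)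
  choose! w hw using hid
  -- After a full turn around the corners the lift returns to its starting point; freeness then
  -- makes the product of the `w k` trivial.
  have hword : ∀ k ≤ b, F (side N 0 0, 0) = wordProd w k • F (side N (4 * 0 + 3 * k) 0, 0) := by
    intro k hk
    induction k with
    | zero => exact (one_smul _ _).symm
    | succ k ih =>
      rw [ih (by omega), hw k (by omega), unitInterval.symm_zero, side_one, wordProd, mul_smul]
      rfl
  have hN : side N N 0 = side N 0 0 := arcPoint_self (by omega)
  have hwb : wordProd w b = 1 := by
    have := hword b le_rfl
    rw [show 4 * 0 + 3 * b = N from rfl, hN] at this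
    exact hfree _ _ this.symm
  -- the labels of the boundary strips
  have hmem : ∀ k < b, ∀ s r, p (F (side N (4 * 0 + 3 * k + 1) s, r)) ∈ A := by
    intro k hk s r
    rw [hF, hA]
    exact ⟨k, hk, s, rfl⟩
  let l : ℕ → Λ := fun k => lam (F (side N (4 * 0 + 3 * k + 1) 0, 0))
  have hl : ∀ k < b, ∀ s r, lam (F (side N (4 * 0 + 3 * k + 1) s, r)) = l k := by
    intro k hk s r
    have := hpath ⟨fun t => F (side N (4 * 0 + 3 * k + 1) (t * s), t * r), by fun_prop⟩
      fun t => hmem k hk _ _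
    change lam (F (side N _ (1 * s), 1 * r)) = lam (F (side N _ (0 * s), 0 * r)) at this
    rwa [one_mul, one_mul, zero_mul, zero_mul] at this
  have hfix : ∀ k < b, w k • l k = l k := by
    intro k hk
    have h1 := hw k hk 1 0
    rw [unitInterval.symm_one, side_one] at h1
    rw [show side N (4 * 0 + 3 * k + 2) 0 = side N (4 * 0 + 3 * k + 1) 1 from
      (side_one _ _).symm] at h1
    conv_rhs => rw [← hl k hk 0 0, h1, hlam _ _ (hmem k hk _ _), hl k hk]
  -- This is where `b ≤ 2` enters: `w 0 * w 1 = 1`, so each fixes what the other one fixes.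
  have hfix' : ∀ k < b, ∀ j < b, w k • l j = l j := by
    intro k hk j hj
    by_cases hkj : k = j
    · rw [← hkj]
      exact hfix k hk
    · obtain rfl : b = 2 := by omega
      have h1 : w 0 * w 1 = 1 := by simpa [wordProd] using hwb
      have h2 : w k = (w j)⁻¹ := by
        have : (k = 0 ∧ j = 1) ∨ (k = 1 ∧ j = 0) := by omega
        rcases this with ⟨rfl, rfl⟩ | ⟨rfl, rfl⟩
        · exact eq_inv_of_mul_eq_one_left h1
        · exact eq_inv_of_mul_eq_one_right h1
      rw [h2, inv_smul_eq_iff, hfix j hj]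
  let S : Subgroup Γ := ⨅ j : Fin b, MulAction.stabilizer Γ (l j)
  have hS : ∀ g : Γ, g ∈ S ↔ ∀ j < b, g • l j = l j := fun g => by
    simp only [S, Subgroup.mem_iInf, MulAction.mem_stabilizer_iff]
    exact ⟨fun h j hj => h ⟨j, hj⟩, fun h j => h j j.2⟩
  let v : ℕ → S := fun k => if hk : k < b then ⟨w k, (hS _).2 (hfix' k hk)⟩ else 1
  have hv : ∀ k < b, (v k : Γ) = w k := fun k hk => by simp only [v, dif_pos hk]
  have hvb : wordProd v b = 1 := by
    refine Subtype.ext ?_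
    change S.subtype (wordProd v b) = 1
    rw [map_wordProd, ← hwb]
    exact wordProd_congr hv
  -- the covering of the surface
  let H := planarHolonomy v hvb
  -- The equivariant extension of `F` to the covering of the fiber with group `S`. Currying the line
  -- variable allows continuity to be checked on the pieces of the quotient.
  let F' : H.Cover → C(ℝ, X) := ArcGluing.totalLift
    (fun _ g d => ⟨fun r => (g : Γ) • F (d, r), Continuous.const_smul (by fun_prop) _⟩) (by
      rintro (⟨_, i | i | k⟩ | ⟨k, _, _⟩) t g
      · exact i.elim0
      · exact i.elim0
      · refine ContinuousMap.ext fun r => ?_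
        change (g : Γ) • F (side N (4 * 0 + 3 * k) t, r) =
          ((g * (wordProd (planarWord v) (4 * 0 + 3 * k) *
            (wordProd (planarWord v) (4 * 0 + 3 * (k + 1)))⁻¹) : S) : Γ) •
              F (side N (4 * 0 + 3 * k + 2) (unitInterval.symm t), r)
        rw [wordProd_planarWord, wordProd_planarWord, inv_inv, wordProd, inv_mul_cancel_left,
          Subgroup.coe_mul, hv k k.2, mul_smul, hw k k.2]
      · refine ContinuousMap.ext fun r => ?_
        change (g : Γ) • F (side N (4 * 0 + 3 * k + 1) t, r) =
          ((g * (wordProd (planarWord v) (4 * 0 + 3 * k + 1) *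
            (wordProd (planarWord v) (4 * 0 + 3 * k + 1))⁻¹) : S) : Γ) •
              F (side N (4 * 0 + 3 * k + 1) t, r)
        rw [mul_inv_cancel, mul_one])
  have hF'cont : Continuous F' := ArcGluing.continuous_totalLift _ _ fun _ g =>
    ((⟨fun q => (g : Γ) • F q, F.continuous.const_smul _⟩ : C(ClosedDisc × ℝ, X)).curry).continuous
  have hF'tot : ∀ k (g : S) d r, F' (H.gluing.tot k g d) r = (g : Γ) • F (d, r) :=
    fun _ _ _ _ => rfl
  have hF'p : ∀ z r σ, H.proj z = sheet _ () σ → p (F' z r) = Φ.symm (torusCoverMap f (σ, r)) := by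
    intro z r σ hz
    induction z using ArcGluing.Total.induction with | h k g d => ?_
    rw [hF'tot, hp.map_smul, hF]
    exact congrArg (fun σ => Φ.symm (torusCoverMap f (σ, r))) (sheet_unit_injective hz)
  -- A path from the base point to `x` is projected to the mapping torus, lifted to the fiber times
  -- the line and then to `H.Cover`. By unique lifting, its image under `F'` is the original path.
  have hsurj : ∀ x, ∃ z r, F' z r = x := by
    intro x
    obtain ⟨c⟩ := PathConnectedSpace.joined (F (d₀, 0)) x
    let m : C(unitInterval, MappingTorus f) := ⟨fun t => Φ (p (c t)),
      Φ.continuous.comp (hp.continuous.comp c.continuous)⟩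
    obtain ⟨q, hq, hq0⟩ := (isQuotientCoveringMap_torusCoverMap f).isCoveringMap.exists_path_lifts
      m (surfaceMk 0 b d₀, 0) (by
        change Φ (p (c 0)) = _
        rw [c.source, hF]
        exact Φ.apply_symm_apply _)
    have hfst : Continuous fun e : TorusCover f => e.1 := continuous_fst
    have hsnd : Continuous fun e : TorusCover f => e.2 := continuous_snd
    let m' : C(unitInterval, MultiDouble Unit (surfaceBoundary 0 b)) :=
      ⟨fun t => sheet _ () (q t).1, (sheet _ ()).continuous.comp (hfst.comp q.continuous)⟩
    obtain ⟨e, he, he0⟩ := H.isQuotientCoveringMap_proj.isCoveringMap.exists_path_lifts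
      m' (H.gluing.tot () 1 d₀) (by
        change sheet _ () (q 0).1 = _
        rw [hq0]
        rfl)
    have h1 := hcov.eq_of_comp_eq (A := unitInterval) (g₁ := fun t => F' (e t) (q t).2) (g₂ := c)
      (by
        have h2 : Continuous fun t => F' (e t) := hF'cont.comp e.continuous
        have h3 : Continuous fun t => (q t).2 := hsnd.comp q.continuous
        fun_prop)
      c.continuous (funext fun t => by
        refine (hF'p (e t) (q t).2 (q t).1 (congrFun he t)).trans ?_
        refine Φ.symm_apply_eq.2 ?_
        exact congrFun hq t) 0 (by
        rw [he0, hq0, hF'tot, c.source]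
        exact one_smul _ _)
    exact ⟨e 1, (q 1).2, (congrFun h1 1).trans c.target⟩
  refine (Set.finite_range fun j : Fin b => l j).subset ?_
  rintro _ ⟨x, hx, rfl⟩
  obtain ⟨z, r, rfl⟩ := hsurj x
  obtain ⟨σ, hσ⟩ : ∃ σ, H.proj z = sheet _ () σ := by
    induction z using ArcGluing.Total.induction with | h k g d => ?_
    exact ⟨surfaceMk 0 b d, rfl⟩
  have hσ' : σ ∈ surfaceBoundary 0 b := by
    rw [← torusCoverMap_mem_iff hf _ r, ← hΦ]
    exact ⟨_, hx, by rw [hF'p z r σ hσ, Φ.apply_symm_apply]⟩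
  obtain ⟨k, hk, s, rfl⟩ := hσ'
  obtain ⟨g, hg⟩ := H.isQuotientCoveringMap_proj.apply_eq_iff_mem_orbit.1
    (hσ.trans (H.proj_tot () 1 (arcPoint N (4 * 0 + 3 * k + 1) s)).symm)
  refine ⟨⟨k, hk⟩, ?_⟩
  have h1 : F' z r = (g : Γ) • F (side N (4 * 0 + 3 * k + 1) s, r) := by
    rw [← hg]
    change F' (H.gluing.tot () (g * 1) (arcPoint N (4 * 0 + 3 * k + 1) s)) r = _
    rw [mul_one]
    rfl
  rw [h1, hlam _ _ (hmem k hk s r), hl k hk]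
  exact ((hS _).1 g.2 k hk).symm

end Annulus
end

end

/-! ### Exclusion of the disc and the annulus, and the conclusion -/

section

open Topology

/-- The fiber of a fibered truncated hyperbolic manifold is neither a disc nor an annulus. -/
theorem IsCuspTruncation.two_lt_of_fibered {Γ : Subgroup SL(4, ℝ)} {L : Set (Fin 4 → ℝ)}
    (hΓ : Γ ≤ SOplus 3) (hd : DiscreteTopology Γ) (ht : ∀ g ∈ Γ, IsOfFinOrder g → g = 1)
    (hL : IsCuspTruncation Γ L) {b : ℕ} (hb : 1 ≤ b)
    {f : CompactSurface 0 b ≃ₜ CompactSurface 0 b}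
    (hf : f '' surfaceBoundary 0 b = surfaceBoundary 0 b)
    (Φ : TruncatedManifold Γ L ≃ₜ MappingTorus f)
    (hΦ : Φ '' truncatedBoundary Γ L = mappingTorusOver f (surfaceBoundary 0 b)) : 2 < b := by
  by_contra! hb2
  let _ := horoballAction hΓ hL
  have hdis := hL.disjointHoroballs
  have hne : (horoballComplement L).Nonempty := by
    obtain ⟨l, hl⟩ := hL.nonempty
    obtain ⟨x, hx⟩ := exists_mem_horosphere (hL.lightlike hl)
    exact ⟨x, hdis.horosphere_subset hl hx⟩
  have : PathConnectedSpace (horoballComplement L) :=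
    isPathConnected_iff_pathConnectedSpace.1 (hdis.isPathConnected hne)
  -- A boundary point is labelled by the horoball on whose horosphere it lies; the value `0`
  -- elsewhere is never used.
  let lam : horoballComplement L → Fin 4 → ℝ := fun x =>
    open Classical in if hx : ∃ l ∈ L, x.1 ∈ horosphere l then hx.choose else 0
  have hlam : ∀ (x : horoballComplement L), ∀ l ∈ L, x.1 ∈ horosphere l → lam x = l := by
    intro x l hl hxl
    have hx : ∃ l ∈ L, x.1 ∈ horosphere l := ⟨l, hl, hxl⟩
    simp only [lam, dif_pos hx]
    by_contra hne
    exact (hdis.one_lt_of_mem_horosphere hx.choose_spec.1 hl hne hx.choose_spec.2).ne' hxl.2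
  refine (hL.infinite hΓ) ((finite_boundary_labels hb hb2 hf Φ hΦ
    (isQuotientCoveringMap_truncated hΓ hd ht hL) lam ?_ ?_).subset ?_)
  · intro g x hx
    obtain ⟨l, hl, hxl⟩ := (mem_truncatedBoundary hΓ hL x).1 hx
    rw [hlam x l hl hxl]
    refine hlam _ _ (hL.invariant g.1 g.2 l hl) ⟨(mem_horoballComplement.1 (g • x).2).1, ?_⟩
    exact (congrArg Neg.neg (lorentz_smul (hΓ g.2) x.1 l)).trans hxl.2
  · intro c hc
    obtain ⟨l, hl, h⟩ := hdis.horosphere_of_path ⟨fun t => (c t).1, by fun_prop⟩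
      fun t => (mem_truncatedBoundary hΓ hL (c t)).1 (hc t)
    rw [hlam _ l hl (h 1), hlam _ l hl (h 0)]
  · intro l hl
    obtain ⟨x, hx⟩ := exists_mem_horosphere (hL.lightlike hl)
    let y : horoballComplement L := ⟨x, hdis.horosphere_subset hl hx⟩
    exact ⟨y, (mem_truncatedBoundary hΓ hL y).2 ⟨l, hl, hx⟩, hlam y l hl hx⟩

/-- The mapping torus of a homeomorphism of a compact surface is path connected. -/
theorem mappingTorus_pathConnectedSpace {h b : ℕ} (f : CompactSurface h b ≃ₜ CompactSurface h b) :
    PathConnectedSpace (MappingTorus f) := by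
  have : PathConnectedSpace (CompactSurface h b) :=
    (Quot.mk_surjective (r := ArcGlue h b)).pathConnectedSpace continuous_quot_mk
  exact (Quot.mk_surjective (r := TorusGlue f)).pathConnectedSpace continuous_quot_mk

end

theorem mainTheorem10
    (Γ : Subgroup SL(4, ℝ)) (hΓ : Γ ≤ SOplus 3) (hdiscrete : DiscreteTopology Γ)
    (htorsionfree : ∀ g ∈ Γ, IsOfFinOrder g → g = 1)
    (L : Set (Fin 4 → ℝ)) (hL : IsCuspTruncation Γ L)
    (hfibered : IsFibered (TruncatedManifold Γ L) (truncatedBoundary Γ L)) :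
    (∀ (x : Double (TruncatedManifold Γ L) (truncatedBoundary Γ L))
        (y : FoldedDouble (TruncatedManifold Γ L) (truncatedBoundary Γ L)),
      ∃ f : FundamentalGroup (Double (TruncatedManifold Γ L) (truncatedBoundary Γ L)) x →*
          FundamentalGroup (FoldedDouble (TruncatedManifold Γ L) (truncatedBoundary Γ L)) y,
        Function.Injective f) ∧
      ∀ y : FoldedDouble (TruncatedManifold Γ L) (truncatedBoundary Γ L),
        HasSurfaceSubgroup
          (FundamentalGroup (FoldedDouble (TruncatedManifold Γ L) (truncatedBoundary Γ L)) y) := by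
  obtain ⟨h, b, hb, f, hf, Φ, hΦ⟩ := hfibered
  have := mappingTorus_pathConnectedSpace f
  have : PathConnectedSpace (TruncatedManifold Γ L) :=
    Φ.symm.surjective.pathConnectedSpace Φ.symm.continuous
  refine ⟨exists_injective_double_foldedDouble, fun y => ?_⟩
  -- This says that the genus `2h + b - 1` of the double of the fiber is at least two. Only `h = 0`
  -- needs hyperbolic geometry.
  have hhb : 2 < 2 * h + b := by
    rcases Nat.eq_zero_or_pos h with rfl | hh
    · have := hL.two_lt_of_fibered hΓ hdiscrete htorsionfree hb hf Φ hΦ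
      omega
    · omega
  obtain ⟨m, rfl⟩ : ∃ m, b = m + 1 := ⟨b - 1, by omega⟩
  obtain ⟨z, φ, hφ⟩ := exists_injective_surfaceGroup_double hf Φ hΦ
  obtain ⟨ψ, hψ⟩ := exists_injective_double_foldedDouble z y
  exact .of_surfaceGroup (by omega) (ψ.comp φ) (hψ.comp hφ)
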